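/- Let $\varepsilon_0>0$, put $\Delta_{\varepsilon_0}=\{z\in\mathbb C:|z|<\varepsilon_0\}$, let $\alpha\in\mathbb R$, and let $a(z)=\sum_{n\ge 1}a_nz^n$ be a holomorphic function on $\Delta_{\varepsilon_0}$ that is not identically zero. Let $p$ and $q$ be real-valued $\mathcal C^\infty$-smooth functions on $(0,\varepsilon_0)$ and $[0,\varepsilon_0)$ respectively, such that $q(0)=0$ and such that the function $g$ with $g(z)=e^{p(|z|)}$ for $0<|z|<\varepsilon_0$ and $g(0)=0$ is $\mathcal C^\infty$-smooth on $\Delta_{\varepsilon_0}$ and vanishes to infinite order at $0$ (all its partial derivatives of all orders vanish at $0$). For $z_2\in\Delta_{\varepsilon_0}$ put $$R(z_2)=q(|z_2|)-\mathrm{Re}\sum_{n\ge1}\frac{a_n}{n}z_2^n,$$ $$P_1(z_2)=\exp\Big[p(|z_2|)+\mathrm{Re}\sum_{n\ge1}\frac{a_n}{in}z_2^n-\log|\cos R(z_2)|\Big]\ (z_2\ne0),\qquad P_1(0)=0,$$ and let $$P=\tfrac1\alpha\log(1+\alpha P_1),\quad F(z_2,t)=-\tfrac1\alpha\log\Big|\frac{\cos(R(z_2)+\alpha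 t)}{\cos R(z_2)}\Big|\quad\text{if }\alpha\neq0,$$ $$P=P_1,\quad F(z_2,t)=\tan(R(z_2))\,t\quad\text{if }\alpha=0.$$ Let $M(a,\alpha,p,q)$ be the germ at $(0,0)\in\mathbb C^2$ of the set $\{\mathrm{Re}\,z_1+P(z_2)+F(z_2,\mathrm{Im}\,z_1)=0\}$, and let $\mathrm{Aut}(M(a,\alpha,p,q),0)$ be the set of germs at $0$ of biholomorphisms between neighbourhoods of $0$ in $\mathbb C^2$ that fix $0$ and map $M(a,\alpha,p,q)$ into itself. For $t\in\mathbb R$ let, near the origin and with the principal branch of the logarithm, $$\phi_t^{a,\alpha}(z_1,z_2)=\Big(-\tfrac1\alpha\log\Big[1+(e^{-\alpha z_1}-1)\exp\Big(\int_0^ta(z_2e^{i\tau})\,d\tau\Big)\Big],\ z_2e^{it}\Big)\quad\text{if }\alpha\ne0,$$ $$\phi_t^{a,\alpha}(z_1,z_2)=\Big(z_1\exp\Big(\int_0^ta(z_2e^{i\tau})\,d\tau\Big),\ z_2e^{it}\Big)\quad\text{if }\alpha=0.$$ Then, as sets of germs at $0$, $$\mathrm{Aut}\big(M(a,\alpha,p,q),0\big)=\{\phi_t^{a,\alpha}: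 t\in\mathbb R\}.$$ Moreover $\{\phi^{a,\alpha}_t\}_{t\in\mathbb R}$ is the one-parameter group generated by the holomorphic vector field $$H^{a,\alpha}(z_1,z_2)=L^\alpha(z_1)a(z_2)\frac{\partial}{\partial z_1}+iz_2\frac{\partial}{\partial z_2},\qquad L^\alpha(z_1)=\tfrac1\alpha(e^{\alpha z_1}-1)\ \text{if }\alpha\neq0,\quad L^0(z_1)=z_1;$$ that is, there is an open neighbourhood $U$ of $0$ in $\mathbb C^2$ such that all the maps $\phi_t^{a,\alpha}$, $t\in\mathbb R$, are holomorphic on $U$ and, for all $z\in U$ and $s,t\in\mathbb R$, $\phi^{a,\alpha}_0(z)=z$, $\phi^{a,\alpha}_s(\phi^{a,\alpha}_t(z))=\phi^{a,\alpha}_{s+t}(z)$ and $\frac{d}{dt}\phi^{a,\alpha}_t(z)=H^{a,\alpha}(\phi^{a,\alpha}_t(z))$. -/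

import Mathlib

open scoped Topology ContDiff

noncomputable section

namespace InfiniteType

/-- A real-valued function `g` on `ℂ = ℝ²` vanishes to infinite order at `0`:
all its real derivatives of all orders vanish at `0`. -/
def VanishesToInfiniteOrder (g : ℂ → ℝ) : Prop :=
  ∀ n : ℕ, iteratedFDeriv ℝ n g 0 = 0

/-- The function `z ↦ exp (p |z|)` for `z ≠ 0`, extended by `0` at `z = 0`. -/
def expRadial (p : ℝ → ℝ) (z : ℂ) : ℝ :=
  if z = 0 then 0 else Real.exp (p ‖z‖)

/-- `R(z) = q(|z|) - Re (∑_{n ≥ 1} (a_n / n) z^n)`; the sequence `c` lists the `a_n`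
(only the entries with `n ≥ 1` are used). -/
def R (c : ℕ → ℂ) (q : ℝ → ℝ) (z : ℂ) : ℝ :=
  q ‖z‖ - (∑' n : ℕ, c (n + 1) / ((n : ℂ) + 1) * z ^ (n + 1)).re

/-- `P₁(z) = exp (p(|z|) + Re (∑_{n ≥ 1} (a_n / (i n)) z^n) - log |cos R(z)|)` for `z ≠ 0`,
and `P₁(0) = 0`. -/
def P₁ (c : ℕ → ℂ) (p q : ℝ → ℝ) (z : ℂ) : ℝ :=
  if z = 0 then 0
  else Real.exp (p ‖z‖
    + (∑' n : ℕ, c (n + 1) / (Complex.I * ((n : ℂ) + 1)) * z ^ (n + 1)).re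
    - Real.log |Real.cos (R c q z)|)

/-- `P = (1/α) log (1 + α P₁)` if `α ≠ 0`, and `P = P₁` if `α = 0`. -/
def P (c : ℕ → ℂ) (α : ℝ) (p q : ℝ → ℝ) (z : ℂ) : ℝ :=
  if α = 0 then P₁ c p q z
  else 1 / α * Real.log (1 + α * P₁ c p q z)

/-- `F(z, t) = -(1/α) log |cos (R(z) + α t) / cos R(z)|` if `α ≠ 0`, and
`F(z, t) = tan (R(z)) t` if `α = 0`. -/
def F (c : ℕ → ℂ) (α : ℝ) (q : ℝ → ℝ) (z : ℂ) (t : ℝ) : ℝ :=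
  if α = 0 then Real.tan (R c q z) * t
  else -(1 / α) * Real.log |Real.cos (R c q z + α * t) / Real.cos (R c q z)|

/-- The set `Re z₁ + P(z₂) + F(z₂, Im z₁) = 0`, `|z₂| < ε₀`, in `ℂ²`; only its germ at the
origin matters. -/
def M (ε₀ : ℝ) (c : ℕ → ℂ) (α : ℝ) (p q : ℝ → ℝ) : Set (ℂ × ℂ) :=
  {z | ‖z.2‖ < ε₀ ∧ z.1.re + P c α p q z.2 + F c α q z.2 z.1.im = 0}

/-- The stability group of the germ at `x` of a subset `S` of `ℂ²`: the germs at `x` of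
biholomorphic maps between neighbourhoods of `x` that fix `x` and map `S` into itself
near `x`. -/
def Aut (S : Set (ℂ × ℂ)) (x : ℂ × ℂ) : Set (Filter.Germ (𝓝 x) (ℂ × ℂ)) :=
  {f | ∃ e : OpenPartialHomeomorph (ℂ × ℂ) (ℂ × ℂ),
    x ∈ e.source ∧
    DifferentiableOn ℂ e e.source ∧
    DifferentiableOn ℂ e.symm e.target ∧
    e x = x ∧
    (∀ᶠ z in 𝓝 x, z ∈ S → e z ∈ S) ∧
    f = ((e : ℂ × ℂ → ℂ × ℂ) : Filter.Germ (𝓝 x) (ℂ × ℂ))}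

/-- `L^α(w) = (exp (α w) - 1) / α` if `α ≠ 0`, and `L^0(w) = w`. -/
def L (α : ℝ) (w : ℂ) : ℂ :=
  if α = 0 then w else 1 / (α : ℂ) * (Complex.exp ((α : ℂ) * w) - 1)

/-- The holomorphic vector field `L^α(z₁) a(z₂) ∂/∂z₁ + i z₂ ∂/∂z₂`. -/
def H (a : ℂ → ℂ) (α : ℝ) (z : ℂ × ℂ) : ℂ × ℂ :=
  (L α z.1 * a z.2, Complex.I * z.2)

/-- The factor `exp (∫₀ᵗ a(w e^{iτ}) dτ)`. -/
def flowFactor (a : ℂ → ℂ) (t : ℝ) (w : ℂ) : ℂ :=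
  Complex.exp (∫ τ in (0 : ℝ)..t, a (w * Complex.exp (Complex.I * (τ : ℂ))))

/-- The map `φ_t^{a,α}`; the logarithm is the principal branch. -/
def φ (a : ℂ → ℂ) (α : ℝ) (t : ℝ) (z : ℂ × ℂ) : ℂ × ℂ :=
  (if α = 0 then z.1 * flowFactor a t z.2
    else -(1 / (α : ℂ)) *
      Complex.log (1 + (Complex.exp (-(α : ℂ) * z.1) - 1) * flowFactor a t z.2),
    z.2 * Complex.exp (Complex.I * (t : ℂ)))

end InfiniteType

end

namespace InfiniteType

/-! Put A(z) = ∑ (a_n / n) z ^ n, so that z A' = a, and ζ = (1 - e^{-α z₁}) / α (ζ = z₁ if α = 0).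
In the coordinates w = ζ e^{i A(z₂)}, z = z₂ the germ becomes the model Re (w e^{-i q(|z|)}) +
G(|z|) = 0 with G = e^p (`mem_M_iff`), and the flow becomes the rotation (w, z) ↦ (w, z e^{it})
(`ModelChart.φ_eq`). The model depends on z only through |z|, so the flow preserves it, and the
group law is that of rotations. What remains is `eq_rotation`: a biholomorphic germ (f₁, f₂) that
fixes 0 and maps the model into itself is such a rotation.

The engine is the tension between holomorphy and flatness of G. A holomorphic function of one
variable that is flat at 0 vanishes, and a bound on the real part of a holomorphic function, up to a
factor with nonzero limit, bounds the function itself (`isBigO_of_re_mul_isBigO`). On the other hand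
G, being positive and flat, cannot behave like a power: G(s) / s ^ K is not bounded below along
smaller and smaller radii (`false_of_descent`), and G' / G is not O(1 / s).

Points w = e^{iq} (iτ - G) over z with τ = τ(z) chosen freely lie on the model, and the equation for
the image is read along such curves. With τ = 0 it shows that f₁ is flat on w = 0, hence f₁ = w k.
With τ = |z| ^ n it shows that the argument of k(0, z) compensates q(|z|) - q(|f₂(0, z)|) up to a
flat error. Returning to τ = 0, the equation says that a factor with positive limit times G(|z|) is
G at the modulus of the image of z. Descent then makes h(z) = f₂(0, z) satisfy |h'(0)| = 1, excludes
any higher-order term of h, and gives k(0, z) = 1 (`rotation_on_curve`).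

Thus, after removing a rotation, the map is the identity on w = 0. If it is (w (1 + w ^ j k), z + w
^ j l), taking τ = x G and comparing terms of order G ^ (j + 1) gives for each real x a flat
expression in k(0, z), l(0, z), q' and G' / G (`isFlat_leading_term`). With x = tan ψ this is a
trigonometric expression in ψ with two frequencies, which can be separated; since G' / G is too
large, l(0, z) = 0 and then k(0, z) = 0 (`tangency_improves`). By induction the map agrees with a
rotation to infinite order at 0, hence identically.

Holomorphic functions are divided by w repeatedly; for this it is enough to work with continuous
functions holomorphic in each variable. -/

open Set Filter Asymptotics Metric

/-! ### Descent for positive flat functions of one real variable. -/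

/-- A positive function vanishing faster than `s ^ K` at `0` cannot have `G s / s ^ K` bounded
below by its values at smaller points. -/
theorem false_of_descent {G : ℝ → ℝ} {δ : ℝ} (K : ℕ) (hδ : 0 < δ) (hc : ContinuousOn G (Icc 0 δ))
    (hpos : ∀ s ∈ Ioc 0 δ, 0 < G s) (hflat : ∀ᶠ s in 𝓝[>] (0 : ℝ), G s ≤ s ^ (K + 1))
    (h : ∀ s ∈ Ioc 0 δ, ∃ t ∈ Ioo 0 s, G s * t ^ K ≤ G t * s ^ K) : False := by
  obtain ⟨η₀, hη₀, hη⟩ := mem_nhdsGT_iff_exists_Ioo_subset.1 hflat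
  have hη₀ : 0 < η₀ := hη₀
  set c := G δ / δ ^ K with hcdef
  have hGδ := hpos δ ⟨hδ, le_rfl⟩
  have hcpos : 0 < c := by positivity
  set η := min c η₀ with hηdef
  have hηpos : 0 < η := lt_min hcpos hη₀
  have hsmall : ∀ s, 0 < s → s < η → G s < c * s ^ K := by
    intro s hs hs'
    have h1 : G s ≤ s ^ (K + 1) := hη ⟨hs, hs'.trans_le (min_le_right _ _)⟩
    have h2 : s < c := hs'.trans_le (min_le_left _ _)
    calc G s ≤ s ^ K * s := by rw [← pow_succ]; exact h1
      _ < s ^ K * c := by gcongr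
      _ = c * s ^ K := mul_comm _ _
  -- By flatness the points of (0, δ] with G s / s ^ K ≥ c stay above η, so they form a compact set;
  -- the hypothesis moves its least element to a smaller one.
  set S := Icc η δ ∩ {s | c * s ^ K ≤ G s} with hS
  have hmem : ∀ s ∈ Ioc 0 δ, c * s ^ K ≤ G s → s ∈ S := by
    intro s hs hle
    refine ⟨⟨?_, hs.2⟩, hle⟩
    by_contra hlt
    exact absurd (hsmall s hs.1 (not_le.1 hlt)) (not_lt.2 hle)
  have hScomp : IsCompact S := by
    have hsub : Icc η δ ⊆ Icc 0 δ := Icc_subset_Icc_left hηpos.le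
    have : IsClosed S := by
      have hcl := (((continuous_const.mul (continuous_pow K)).continuousOn (s := Icc η δ)).prodMk
        (hc.mono hsub)).preimage_isClosed_of_isClosed isClosed_Icc
        (isClosed_le continuous_fst continuous_snd) (f := fun s => (c * s ^ K, G s))
      exact hcl
    exact isCompact_Icc.of_isClosed_subset this inter_subset_left
  have hδS : δ ∈ S := hmem δ ⟨hδ, le_rfl⟩ (by rw [hcdef]; field_simp; exact le_rfl)
  obtain ⟨s, hsS, hsmin⟩ := hScomp.exists_isLeast ⟨δ, hδS⟩
  have hs0 : 0 < s := hηpos.trans_le hsS.1.1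
  obtain ⟨t, ht, hle⟩ := h s ⟨hs0, hsS.1.2⟩
  have htS : t ∈ S := by
    refine hmem t ⟨ht.1, ht.2.le.trans hsS.1.2⟩ ?_
    have h1 : c * s ^ K ≤ G s := hsS.2
    have hsK : 0 < s ^ K := by positivity
    have htK : 0 < t ^ K := pow_pos ht.1 _
    refine le_of_mul_le_mul_right ?_ hsK
    calc c * t ^ K * s ^ K = c * s ^ K * t ^ K := by ring
      _ ≤ G s * t ^ K := by gcongr
      _ ≤ G t * s ^ K := hle
  exact absurd (hsmin htS) (not_le.2 ht.2)

/-- The data of the model hypersurface: a positive function `G` flat at the origin, and a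
function `q` of class `C^{1,1}` up to the origin. -/
structure Profile (G G' q q' : ℝ → ℝ) : Prop where
  G_zero : G 0 = 0
  G_pos : ∀ᶠ s in 𝓝[>] (0 : ℝ), 0 < G s
  G_deriv : ∀ᶠ s in 𝓝 (0 : ℝ), HasDerivAt G (G' s) s
  G_flat : ∀ n : ℕ, ∀ᶠ s in 𝓝 (0 : ℝ), |G s| ≤ |s| ^ n
  G'_flat : ∀ n : ℕ, ∀ᶠ s in 𝓝 (0 : ℝ), |G' s| ≤ |s| ^ n
  G_taylor : ∀ n : ℕ, ∀ᶠ s in 𝓝[>] (0 : ℝ), ∀ t, |t - s| ≤ s →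
    |G t - G s - G' s * (t - s)| ≤ s ^ n * (t - s) ^ 2
  q_zero : q 0 = 0
  q_taylor : ∃ C δ : ℝ, 0 < C ∧ 0 < δ ∧ ∀ s ∈ Ico 0 δ, |q' s| ≤ C ∧ ∀ t ∈ Ico 0 δ,
    |q t - q s| ≤ C * |t - s| ∧ |q t - q s - q' s * (t - s)| ≤ C * (t - s) ^ 2

namespace Profile

variable {G G' q q' : ℝ → ℝ}

theorem exists_good_radius (H : Profile G G' q q') : ∃ δ > 0,
    (∀ s ∈ Ioc 0 δ, 0 < G s) ∧ (∀ s ∈ Icc 0 δ, HasDerivAt G (G' s) s) ∧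
      ContinuousOn G (Icc 0 δ) := by
  obtain ⟨a, ha, h1⟩ := mem_nhdsGT_iff_exists_Ioo_subset.1 H.G_pos
  obtain ⟨b, hb, h2⟩ := Metric.eventually_nhds_iff.1 H.G_deriv
  have ha : 0 < a := ha
  have hd : ∀ s ∈ Icc 0 (min (a / 2) (b / 2)), HasDerivAt G (G' s) s := by
    intro s hs
    refine h2 ?_
    rw [Real.dist_eq, sub_zero, abs_of_nonneg hs.1]
    linarith [hs.2, min_le_right (a / 2) (b / 2)]
  refine ⟨min (a / 2) (b / 2), by positivity, fun s hs => h1 ⟨hs.1, ?_⟩, hd, ?_⟩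
  · linarith [hs.2, min_le_left (a / 2) (b / 2)]
  · exact fun s hs => (hd s hs).continuousAt.continuousWithinAt

theorem G_flat_le (H : Profile G G' q q') (n : ℕ) : ∀ᶠ s in 𝓝[>] (0 : ℝ), G s ≤ s ^ n := by
  filter_upwards [nhdsWithin_le_nhds (H.G_flat n), self_mem_nhdsWithin] with s hs h0
  rw [abs_of_pos (show 0 < s from h0)] at hs
  exact (le_abs_self _).trans hs

theorem false_of_descent (H : Profile G G' q q') (K : ℕ)
    (h : ∀ᶠ s in 𝓝[>] (0 : ℝ), ∃ t ∈ Ioo 0 s, G s * t ^ K ≤ G t * s ^ K) : False := by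
  obtain ⟨δ, hδ, h1, h2, h3⟩ := H.exists_good_radius
  obtain ⟨a, ha, h4⟩ := mem_nhdsGT_iff_exists_Ioo_subset.1 h
  have ha : 0 < a := ha
  have hle : min δ (a / 2) ≤ δ := min_le_left _ _
  refine InfiniteType.false_of_descent (δ := min δ (a / 2)) K (by positivity)
    (h3.mono (Icc_subset_Icc_right hle)) (fun s hs => h1 s ⟨hs.1, hs.2.trans hle⟩)
    (H.G_flat_le _) (fun s hs => h4 ⟨hs.1, ?_⟩)
  linarith [hs.2, min_le_right δ (a / 2)]

/-- The logarithmic derivative of a flat function is not `O(1 / s)`. -/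
theorem false_of_logDeriv_le (H : Profile G G' q q') (N : ℕ)
    (h : ∀ᶠ s in 𝓝[>] (0 : ℝ), s * |G' s| ≤ N * G s) : False := by
  obtain ⟨δ, hδ, h1, h2, h3⟩ := H.exists_good_radius
  obtain ⟨a, ha, h4⟩ := mem_nhdsGT_iff_exists_Ioo_subset.1 h
  have ha : 0 < a := ha
  refine H.false_of_descent N ?_
  -- The derivative of G / s ^ N has the sign of s G' - N G ≤ 0, so halving s does not decrease the
  -- quotient, which is the descent with t = s / 2.
  have hanti : AntitoneOn (fun s => G s / s ^ N) (Ioo 0 (min δ a)) := by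
    have hder : ∀ s ∈ Ioo 0 (min δ a), HasDerivAt (fun s => G s / s ^ N)
        ((G' s * s ^ N - G s * (N * s ^ (N - 1))) / (s ^ N) ^ 2) s := by
      intro s hs
      have hs0 : 0 < s := hs.1
      exact (h2 s ⟨hs.1.le, hs.2.le.trans (min_le_left _ _)⟩).div (hasDerivAt_pow N s)
        (by positivity)
    refine antitoneOn_of_deriv_nonpos (convex_Ioo _ _)
      (fun s hs => (hder s hs).continuousAt.continuousWithinAt) ?_ ?_
    · intro s hs
      rw [interior_Ioo] at hs
      exact (hder s hs).differentiableAt.differentiableWithinAt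
    · intro s hs
      rw [interior_Ioo] at hs
      rw [(hder s hs).deriv]
      have hs0 : 0 < s := hs.1
      refine div_nonpos_of_nonpos_of_nonneg ?_ (by positivity)
      have h5 : s * |G' s| ≤ N * G s := h4 ⟨hs.1, hs.2.trans_le (min_le_right _ _)⟩
      -- With truncated subtraction s ^ (N - 1) * s = s ^ N needs N > 0.
      rcases Nat.eq_zero_or_pos N with rfl | hN
      · have : G' s ≤ 0 := by
          have : s * |G' s| ≤ 0 := by simpa using h5
          nlinarith [le_abs_self (G' s), abs_nonneg (G' s)]
        simpa using this
      · have hpow : s ^ N = s ^ (N - 1) * s := by rw [← pow_succ, Nat.sub_add_cancel hN]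
        rw [hpow]
        have : s ^ (N - 1) * (s * G' s - N * G s) ≤ 0 := by
          refine mul_nonpos_of_nonneg_of_nonpos (by positivity) ?_
          nlinarith [le_abs_self (G' s)]
        linarith
  have hmin : 0 < min δ a := by positivity
  filter_upwards [Ioo_mem_nhdsGT hmin] with s hs
  have hs0 : 0 < s := hs.1
  refine ⟨s / 2, ⟨by linarith, by linarith⟩, ?_⟩
  have := hanti (a := s / 2) ⟨by linarith, by linarith [hs.2]⟩ hs (by linarith)
  have hs2 : 0 < s / 2 := by linarith
  simp only at this
  rw [div_le_div_iff₀ (by positivity) (by positivity)] at this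
  exact this

end Profile

/-! ### Orders of vanishing of holomorphic germs. -/

/-- Take d to be an m-th root of |v| / v. It is the direction of a ray along which a leading term v
z ^ m is real and positive. -/
theorem exists_unit_pow_mul_eq_norm {v : ℂ} (hv : v ≠ 0) {m : ℕ} (hm : m ≠ 0) :
    ∃ d : ℂ, ‖d‖ = 1 ∧ d ^ m * v = (‖v‖ : ℂ) := by
  have hv' : (‖v‖ : ℂ) ≠ 0 := by simpa using hv
  obtain ⟨d, hd⟩ := IsAlgClosed.exists_pow_nat_eq ((‖v‖ : ℂ) / v) (Nat.pos_of_ne_zero hm)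
  refine ⟨d, ?_, by rw [hd]; field_simp⟩
  have h1 : ‖d‖ ^ m = 1 := by
    rw [← norm_pow, hd, norm_div, Complex.norm_real, norm_norm, div_self (norm_ne_zero_iff.2 hv)]
  exact (pow_eq_one_iff_of_nonneg (norm_nonneg _) hm).1 h1

theorem tendsto_ray {d : ℂ} (hd : d ≠ 0) :
    Tendsto (fun t : ℝ => (t : ℂ) * d) (𝓝[>] (0 : ℝ)) (𝓝[≠] (0 : ℂ)) := by
  refine tendsto_nhdsWithin_iff.2 ⟨?_, ?_⟩
  · have h : ContinuousAt (fun t : ℝ => (t : ℂ) * d) 0 := by fun_prop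
    have := h.tendsto
    simp only [Complex.ofReal_zero, zero_mul] at this
    exact this.mono_left nhdsWithin_le_nhds
  · filter_upwards [self_mem_nhdsWithin] with t ht
    have : t ≠ 0 := ne_of_gt ht
    simp [this, hd]

/-- If `u` is holomorphic near `0`, vanishes at `0`, and `Re (u E) = O(z ^ n)` where `E` has a
nonzero limit, then `u = O(z ^ n)`. -/
theorem isBigO_of_re_mul_isBigO {u E : ℂ → ℂ} {E₀ : ℂ} (hu : AnalyticAt ℂ u 0) (hu0 : u 0 = 0)
    (hE : Tendsto E (𝓝[≠] 0) (𝓝 E₀)) (hE₀ : E₀ ≠ 0) {n : ℕ}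
    (h : (fun z => (u z * E z).re) =O[𝓝[≠] 0] fun z => ‖z‖ ^ n) :
    u =O[𝓝[≠] 0] fun z => ‖z‖ ^ n := by
  by_cases htop : analyticOrderAt u 0 = ⊤
  · rw [analyticOrderAt_eq_top] at htop
    have : u =ᶠ[𝓝[≠] 0] fun _ => (0 : ℂ) := htop.filter_mono nhdsWithin_le_nhds
    exact this.trans_isBigO (isBigO_zero _ _)
  obtain ⟨v, hv, hv0, huv⟩ := hu.analyticOrderAt_ne_top.1 htop
  set m := analyticOrderNatAt u 0 with hm
  simp only [sub_zero, smul_eq_mul] at huv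
  -- For m = 0 no choice of ray could align the leading coefficient; this is where u(0) = 0 enters.
  have hm0 : m ≠ 0 := by
    intro h0
    have := huv.self_of_nhds
    rw [h0, hu0] at this
    simp only [pow_zero, one_mul] at this
    exact hv0 this.symm
  have hvt : Tendsto v (𝓝[≠] 0) (𝓝 (v 0)) := hv.continuousAt.tendsto.mono_left nhdsWithin_le_nhds
  have hmn : n ≤ m := by
    by_contra hlt
    push Not at hlt
    -- On this ray the leading term of u E is t ^ m |v(0) E₀|; if m < n, dividing the bound by t ^ m
    -- forces v(0) E₀ = 0.
    obtain ⟨d, hd1, hd⟩ := exists_unit_pow_mul_eq_norm (mul_ne_zero hv0 hE₀) hm0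
    have hd0 : d ≠ 0 := by rintro rfl; simp at hd1
    have hray := tendsto_ray hd0
    have h1 : Tendsto (fun t : ℝ => (d ^ m * (v (t * d) * E (t * d))).re) (𝓝[>] 0)
        (𝓝 ‖v 0 * E₀‖) := by
      have := (Complex.continuous_re.tendsto _).comp
        (((hvt.mul hE).comp hray).const_mul (d ^ m))
      rw [hd, Complex.ofReal_re] at this
      exact this
    have h2 := h.comp_tendsto hray
    have h3 : (fun t : ℝ => (d ^ m * (v (t * d) * E (t * d))).re) =O[𝓝[>] 0]
        fun t : ℝ => t ^ (n - m) := by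
      have h4 : (fun t : ℝ => t ^ m * (d ^ m * (v (t * d) * E (t * d))).re) =O[𝓝[>] 0]
          fun t : ℝ => t ^ m * t ^ (n - m) := by
        refine (h2.congr' ?_ ?_)
        · filter_upwards [hray.eventually (huv.filter_mono nhdsWithin_le_nhds)] with t ht
          simp only [Function.comp]
          rw [ht, ← Complex.re_ofReal_mul]
          congr 1
          push_cast
          ring
        · filter_upwards [self_mem_nhdsWithin] with t ht
          have ht : (0 : ℝ) < t := ht
          simp only [Function.comp]
          rw [norm_mul, hd1, mul_one, Complex.norm_real, Real.norm_of_nonneg ht.le, ← pow_add,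
            Nat.add_sub_cancel' hlt.le]
      have h5 : (fun t : ℝ => (t ^ m)⁻¹) =O[𝓝[>] 0] fun t : ℝ => (t ^ m)⁻¹ := isBigO_refl _ _
      refine (h5.mul h4).congr' ?_ ?_
      · filter_upwards [self_mem_nhdsWithin] with t ht
        have ht : (0 : ℝ) < t := ht
        field_simp
      · filter_upwards [self_mem_nhdsWithin] with t ht
        have ht : (0 : ℝ) < t := ht
        field_simp
    have h6 : Tendsto (fun t : ℝ => t ^ (n - m)) (𝓝[>] 0) (𝓝 0) := by
      have hc : ContinuousAt (fun t : ℝ => t ^ (n - m)) 0 := by fun_prop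
      have := hc.tendsto
      simp only [zero_pow (Nat.sub_ne_zero_of_lt hlt)] at this
      exact this.mono_left nhdsWithin_le_nhds
    have h7 := tendsto_nhds_unique h1 (h3.trans_tendsto h6)
    rw [norm_eq_zero] at h7
    exact mul_ne_zero hv0 hE₀ h7
  have h8 : u =O[𝓝[≠] 0] fun z => ‖z‖ ^ m := by
    have h9 : (fun z => z ^ m * v z) =O[𝓝[≠] 0] fun z => ‖z‖ ^ m * 1 := by
      refine IsBigO.mul ?_ (hvt.isBigO_one ℝ)
      exact IsBigO.of_bound 1 (Eventually.of_forall fun z => by simp)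
    simp only [mul_one] at h9
    exact (EventuallyEq.trans_isBigO (huv.filter_mono nhdsWithin_le_nhds) h9)
  refine h8.trans (IsBigO.of_bound 1 ?_)
  have hb : ∀ᶠ z : ℂ in 𝓝[≠] 0, ‖z‖ < 1 :=
    nhdsWithin_le_nhds (by simpa [ball, dist_zero_right] using ball_mem_nhds (0 : ℂ) one_pos)
  filter_upwards [hb] with z hz
  rw [one_mul, norm_pow, norm_norm, norm_pow, norm_norm]
  exact pow_le_pow_of_le_one (norm_nonneg _) hz.le hmn

/-- A germ of finite order m is z ^ m times a function with nonzero value at 0, which O(z ^ (m + 1))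
excludes. -/
theorem eventually_eq_zero_of_isBigO {u : ℂ → ℂ} (hu : AnalyticAt ℂ u 0)
    (h : ∀ n : ℕ, u =O[𝓝[≠] 0] fun z => ‖z‖ ^ n) : ∀ᶠ z in 𝓝 0, u z = 0 := by
  by_contra htop
  rw [← analyticOrderAt_eq_top] at htop
  obtain ⟨v, hv, hv0, huv⟩ := hu.analyticOrderAt_ne_top.1 htop
  set m := analyticOrderNatAt u 0 with hm
  simp only [sub_zero, smul_eq_mul] at huv
  have hvt : Tendsto v (𝓝[≠] 0) (𝓝 (v 0)) := hv.continuousAt.tendsto.mono_left nhdsWithin_le_nhds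
  have h1 : v =O[𝓝[≠] 0] fun z => ‖z‖ := by
    refine ((isBigO_refl (fun z : ℂ => (z ^ m)⁻¹) (𝓝[≠] 0)).norm_right.mul (h (m + 1))).congr' ?_ ?_
    · filter_upwards [self_mem_nhdsWithin, huv.filter_mono nhdsWithin_le_nhds] with z hz hz'
      have hz : z ≠ 0 := hz
      rw [hz']
      field_simp
    · filter_upwards [self_mem_nhdsWithin] with z hz
      have hz : 0 < ‖z‖ := norm_pos_iff.2 hz
      simp only [norm_inv, norm_pow]
      rw [pow_succ]
      field_simp
  have h2 : Tendsto (fun z : ℂ => ‖z‖) (𝓝[≠] 0) (𝓝 0) := by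
    simpa using (continuous_norm.tendsto (0 : ℂ)).mono_left nhdsWithin_le_nhds
  exact hv0 (tendsto_nhds_unique hvt (h1.trans_tendsto h2))

/-! ### Division by w for separately holomorphic functions. -/

/-- Continuous functions of `(w, z)` on a polydisc which are holomorphic in each variable. -/
structure SepHolo (f : ℂ × ℂ → ℂ) (r : ℝ) : Prop where
  cont : ContinuousOn f (ball 0 r)
  left : ∀ z ∈ ball (0 : ℂ) r, DifferentiableOn ℂ (fun w => f (w, z)) (ball 0 r)
  right : ∀ w ∈ ball (0 : ℂ) r, DifferentiableOn ℂ (fun z => f (w, z)) (ball 0 r)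

theorem mem_ball_prod {p : ℂ × ℂ} {r : ℝ} : p ∈ ball (0 : ℂ × ℂ) r ↔ ‖p.1‖ < r ∧ ‖p.2‖ < r := by
  rw [mem_ball_zero_iff, Prod.norm_def, max_lt_iff]

theorem SepHolo.of_differentiableOn {f : ℂ × ℂ → ℂ} {r : ℝ}
    (h : DifferentiableOn ℂ f (ball 0 r)) : SepHolo f r := by
  refine ⟨h.continuousOn, fun z hz => ?_, fun w hw => ?_⟩
  · refine h.comp (f := fun w => (w, z)) (by fun_prop) fun w hw => ?_
    exact mem_ball_prod.2 ⟨by simpa using hw, by simpa using hz⟩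
  · refine h.comp (f := fun z => (w, z)) (by fun_prop) fun z hz => ?_
    exact mem_ball_prod.2 ⟨by simpa using hw, by simpa using hz⟩

/-- The bound is clear on |w| = R, where the quotient is a genuine difference quotient; the maximum
principle carries it inside, including to w = 0. -/
theorem norm_dslope_le {f : ℂ → ℂ} {r R M : ℝ} (hR : 0 < R) (hRr : R < r)
    (hf : DifferentiableOn ℂ f (ball 0 r)) (hM : ∀ w, ‖w‖ ≤ R → ‖f w‖ ≤ M) {w : ℂ} (hw : ‖w‖ ≤ R) :
    ‖dslope f 0 w‖ ≤ 2 * M / R := by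
  have hd : DifferentiableOn ℂ (dslope f 0) (ball 0 r) :=
    (Complex.differentiableOn_dslope (ball_mem_nhds 0 (hR.trans hRr))).2 hf
  have hfr : ∀ ξ ∈ frontier (ball (0 : ℂ) R), ‖dslope f 0 ξ‖ ≤ 2 * M / R := by
    intro ξ hξ
    rw [frontier_ball _ hR.ne', mem_sphere_zero_iff_norm] at hξ
    have hξ0 : ξ ≠ 0 := by rintro rfl; simp at hξ; exact hR.ne hξ
    rw [dslope_of_ne _ hξ0, slope_def_field, norm_div, sub_zero, hξ]
    gcongr
    calc ‖f ξ - f 0‖ ≤ ‖f ξ‖ + ‖f 0‖ := norm_sub_le _ _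
      _ ≤ M + M := add_le_add (hM _ hξ.le) (hM _ (by simpa using hR.le))
      _ = 2 * M := by ring
  have hcl : closure (ball (0 : ℂ) R) = closedBall 0 R := closure_ball _ hR.ne'
  refine Complex.norm_le_of_forall_mem_frontier_norm_le isBounded_ball ?_ hfr ?_
  · refine DifferentiableOn.diffContOnCl ?_
    rw [hcl]
    exact hd.mono (closedBall_subset_ball hRr)
  · rw [hcl]; simpa using hw

/-- Division by the first coordinate. -/
theorem SepHolo.exists_eq_add_mul {f : ℂ × ℂ → ℂ} {r : ℝ} (hr : 0 < r) (h : SepHolo f r) :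
    ∃ g : ℂ × ℂ → ℂ, SepHolo g (r / 2) ∧ ∀ p : ℂ × ℂ, f p = f (0, p.2) + p.1 * g p := by
  set g : ℂ × ℂ → ℂ := fun p => dslope (fun w => f (w, p.2)) 0 p.1 with hg
  have hr2 : r / 2 < r := by linarith
  have hr0 : 0 < r / 2 := by linarith
  obtain ⟨M, hM⟩ := (isCompact_closedBall (0 : ℂ × ℂ) (r / 2)).exists_bound_of_continuousOn
    (h.cont.mono (closedBall_subset_ball hr2))
  have hM' : ∀ z : ℂ, ‖z‖ < r / 2 → ∀ w, ‖w‖ ≤ r / 2 → ‖f (w, z)‖ ≤ M := by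
    intro z hz w hw
    refine hM _ ?_
    rw [mem_closedBall_zero_iff, Prod.norm_def]
    exact max_le hw hz.le
  have hgd : ∀ z : ℂ, ‖z‖ < r / 2 → DifferentiableOn ℂ (fun w => g (w, z)) (ball 0 r) :=
    fun z hz => (Complex.differentiableOn_dslope (ball_mem_nhds 0 hr)).2
      (h.left z (by simpa using hz.trans hr2))
  have hgb : ∀ z : ℂ, ‖z‖ < r / 2 → ∀ w, ‖w‖ ≤ r / 2 → ‖g (w, z)‖ ≤ 2 * M / (r / 2) :=
    fun z hz w hw => norm_dslope_le hr0 hr2 (h.left z (by simpa using hz.trans hr2)) (hM' z hz) hw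
  set C := 2 * (2 * M / (r / 2)) / (r / 2) with hC
  -- The slope estimate, applied once more to g itself, gives a Lipschitz bound at w = 0 uniform in
  -- z. It yields both the joint continuity of g at w = 0 and the uniform convergence g(w, ·) → g(0,
  -- ·).
  have hgl : ∀ z : ℂ, ‖z‖ < r / 2 → ∀ w, ‖w‖ ≤ r / 2 → ‖g (w, z) - g (0, z)‖ ≤ C * ‖w‖ := by
    intro z hz w hw
    have h1 := norm_dslope_le hr0 hr2 (hgd z hz) (hgb z hz) hw
    have h2 := sub_smul_dslope (fun w => g (w, z)) 0 w
    simp only [sub_zero, smul_eq_mul] at h2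
    rw [← h2, norm_mul, mul_comm]
    gcongr
  have heq : ∀ p : ℂ × ℂ, f p = f (0, p.2) + p.1 * g p := by
    intro p
    have h2 := sub_smul_dslope (fun w => f (w, p.2)) 0 p.1
    simp only [sub_zero, smul_eq_mul] at h2
    rw [hg]
    simp only [h2]
    ring
  have hne : ∀ w z : ℂ, w ≠ 0 → g (w, z) = (f (w, z) - f (0, z)) / w := by
    intro w z hw
    have := heq (w, z)
    simp only at this
    rw [this]; field_simp; ring
  have hright_ne : ∀ w : ℂ, ‖w‖ < r / 2 → w ≠ 0 →
      DifferentiableOn ℂ (fun z => g (w, z)) (ball 0 (r / 2)) := by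
    intro w hw hw0
    have : (fun z => g (w, z)) = fun z => (f (w, z) - f (0, z)) / w := by
      ext z; exact hne w z hw0
    rw [this]
    refine DifferentiableOn.div_const (DifferentiableOn.sub ?_ ?_) _
    · exact (h.right w (by simpa using hw.trans hr2)).mono (ball_subset_ball hr2.le)
    · exact (h.right 0 (by simpa using hr)).mono (ball_subset_ball hr2.le)
  have hunif : TendstoUniformlyOn (fun w z => g (w, z)) (fun z => g (0, z)) (𝓝[≠] 0)
      (ball 0 (r / 2)) := by
    rw [Metric.tendstoUniformlyOn_iff]
    intro ε hε
    have h1 : Tendsto (fun w : ℂ => C * ‖w‖) (𝓝[≠] 0) (𝓝 0) := by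
      have : Continuous fun w : ℂ => C * ‖w‖ := by fun_prop
      simpa using (this.tendsto 0).mono_left nhdsWithin_le_nhds
    filter_upwards [h1.eventually (gt_mem_nhds hε),
      nhdsWithin_le_nhds (ball_mem_nhds (0 : ℂ) hr0)] with w hw hw' z hz
    rw [dist_comm, dist_eq_norm]
    exact (hgl z (by simpa using hz) w (by simpa using (mem_ball_zero_iff.1 hw').le)).trans_lt hw
  -- Holomorphy in z is evident for w ≠ 0 from the quotient formula; at w = 0 it is inherited by the
  -- uniform limit.
  have hright0 : DifferentiableOn ℂ (fun z => g (0, z)) (ball 0 (r / 2)) := by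
    refine hunif.tendstoLocallyUniformlyOn.differentiableOn ?_ isOpen_ball
    filter_upwards [self_mem_nhdsWithin, nhdsWithin_le_nhds (ball_mem_nhds (0 : ℂ) hr0)]
      with w hw hw'
    exact hright_ne w (by simpa using hw') hw
  refine ⟨g, ⟨?_, ?_, ?_⟩, heq⟩
  · intro p hp
    refine ContinuousAt.continuousWithinAt ?_
    rw [mem_ball_prod] at hp
    by_cases hp0 : p.1 = 0
    · have hz : ContinuousAt (fun q : ℂ × ℂ => g (0, q.2)) p := by
        refine ContinuousAt.comp (g := fun z => g (0, z)) (f := fun q : ℂ × ℂ => q.2) ?_ (by fun_prop)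
        exact (hright0.differentiableAt (isOpen_ball.mem_nhds (by simpa using hp.2))).continuousAt
      have hdiff : Tendsto (fun q : ℂ × ℂ => g q - g (0, q.2)) (𝓝 p) (𝓝 0) := by
        have hlim : Tendsto (fun q : ℂ × ℂ => C * ‖q.1‖) (𝓝 p) (𝓝 0) := by
          have : Continuous fun q : ℂ × ℂ => C * ‖q.1‖ := by fun_prop
          simpa [hp0] using this.tendsto p
        refine squeeze_zero_norm' ?_ hlim
        have hpb : ∀ᶠ q : ℂ × ℂ in 𝓝 p, q ∈ ball (0 : ℂ × ℂ) (r / 2) :=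
          isOpen_ball.mem_nhds (mem_ball_prod.2 hp)
        filter_upwards [hpb] with q hq
        rw [mem_ball_prod] at hq
        exact hgl q.2 hq.2 q.1 hq.1.le
      have := hdiff.add hz.tendsto
      simp only [sub_add_cancel, zero_add] at this
      have hgp : g (0, p.2) = g p := by rw [← hp0]
      rw [hgp] at this
      exact this
    · have hev : g =ᶠ[𝓝 p] fun q => (f q - f (0, q.2)) / q.1 := by
        have : ∀ᶠ q : ℂ × ℂ in 𝓝 p, q.1 ≠ 0 := (continuous_fst.tendsto p).eventually_ne hp0
        filter_upwards [this] with q hq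
        exact hne q.1 q.2 hq
      refine ContinuousAt.congr ?_ hev.symm
      have hpr : p ∈ ball (0 : ℂ × ℂ) r := mem_ball_prod.2 ⟨hp.1.trans hr2, hp.2.trans hr2⟩
      have hpr' : ((0 : ℂ), p.2) ∈ ball (0 : ℂ × ℂ) r :=
        mem_ball_prod.2 ⟨by simpa using hr, hp.2.trans hr2⟩
      refine ContinuousAt.div (ContinuousAt.sub (h.cont.continuousAt (isOpen_ball.mem_nhds hpr)) ?_)
        continuousAt_fst hp0
      exact ContinuousAt.comp (f := fun q : ℂ × ℂ => ((0 : ℂ), q.2))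
        (h.cont.continuousAt (isOpen_ball.mem_nhds hpr')) (by fun_prop)
  · exact fun z hz => (hgd z (by simpa using hz)).mono (ball_subset_ball hr2.le)
  · intro w hw
    by_cases hw0 : w = 0
    · rw [hw0]; exact hright0
    · exact hright_ne w (by simpa using hw) hw0

/-- Germs at the origin of functions continuous and separately holomorphic near the origin. -/
def IsSep (f : ℂ × ℂ → ℂ) : Prop := ∃ r > 0, SepHolo f r

namespace IsSep
variable {f : ℂ × ℂ → ℂ}

theorem continuousAt (h : IsSep f) : ContinuousAt f 0 := by
  obtain ⟨r, hr, h⟩ := h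
  exact h.cont.continuousAt (ball_mem_nhds 0 hr)

theorem analyticAt (h : IsSep f) : AnalyticAt ℂ (fun z => f (0, z)) 0 := by
  obtain ⟨r, hr, h⟩ := h
  exact (h.right 0 (by simpa using hr)).analyticAt (ball_mem_nhds 0 hr)

theorem exists_eq_add_mul (h : IsSep f) :
    ∃ g : ℂ × ℂ → ℂ, IsSep g ∧ ∀ p : ℂ × ℂ, f p = f (0, p.2) + p.1 * g p := by
  obtain ⟨r, hr, h⟩ := h
  obtain ⟨g, hg, hfg⟩ := h.exists_eq_add_mul hr
  exact ⟨g, ⟨r / 2, by linarith, hg⟩, hfg⟩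

theorem of_differentiable (h : ∀ᶠ p in 𝓝 (0 : ℂ × ℂ), DifferentiableAt ℂ f p) : IsSep f := by
  obtain ⟨r, hr, h⟩ := Metric.eventually_nhds_iff_ball.1 h
  exact ⟨r, hr, .of_differentiableOn fun p hp => (h p hp).differentiableWithinAt⟩

theorem const_mul (h : IsSep f) (c : ℂ) : IsSep fun p => c * f p := by
  obtain ⟨r, hr, h⟩ := h
  exact ⟨r, hr, continuousOn_const.mul h.cont, fun z hz => (h.left z hz).const_mul c,
    fun w hw => (h.right w hw).const_mul c⟩

theorem isBigO_one (h : IsSep f) {W : ℂ → ℂ} (hW : Tendsto W (𝓝[≠] 0) (𝓝 0)) :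
    (fun z => f (W z, z)) =O[𝓝[≠] 0] fun _ => (1 : ℝ) := by
  have : Tendsto (fun z => (W z, z)) (𝓝[≠] 0) (𝓝 ((0 : ℂ), (0 : ℂ))) :=
    hW.prodMk_nhds (tendsto_id.mono_left nhdsWithin_le_nhds)
  exact (h.continuousAt.tendsto.comp this).isBigO_one ℝ

/-- Along a curve `(W z, z)`, the value differs from that at `(0, z)` by `O(W)`. -/
theorem sub_isBigO (h : IsSep f) {W : ℂ → ℂ} (hW : Tendsto W (𝓝[≠] 0) (𝓝 0)) :
    (fun z => f (W z, z) - f (0, z)) =O[𝓝[≠] 0] W := by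
  obtain ⟨g, hg, hfg⟩ := h.exists_eq_add_mul
  have h1 := (isBigO_refl W (𝓝[≠] 0)).norm_right.mul (hg.isBigO_one hW)
  simp only [mul_one] at h1
  refine h1.of_norm_right.congr_left fun z => ?_
  rw [hfg (W z, z)]; simp

end IsSep

/-! ### Flat functions on ℂ. -/

/-- `u` vanishes to infinite order at `0`. -/
def IsFlat {E : Type*} [Norm E] (u : ℂ → E) : Prop :=
  ∀ n : ℕ, u =O[𝓝[≠] 0] fun z => ‖z‖ ^ n

namespace IsFlat

theorem add {E : Type*} [SeminormedAddCommGroup E] {u v : ℂ → E} (hu : IsFlat u) (hv : IsFlat v) :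
    IsFlat fun z => u z + v z := fun n => (hu n).add (hv n)

theorem sub {E : Type*} [SeminormedAddCommGroup E] {u v : ℂ → E} (hu : IsFlat u) (hv : IsFlat v) :
    IsFlat fun z => u z - v z := fun n => (hu n).sub (hv n)

theorem neg {E : Type*} [SeminormedAddCommGroup E] {u : ℂ → E} (hu : IsFlat u) :
    IsFlat fun z => -u z := fun n => (hu n).neg_left

theorem of_isBigO {E F : Type*} [Norm E] [SeminormedAddCommGroup F] {u : ℂ → E} {v : ℂ → F}
    (hv : IsFlat v) (h : u =O[𝓝[≠] 0] v) : IsFlat u := fun n => h.trans (hv n)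

theorem congr' {E : Type*} [Norm E] {u v : ℂ → E} (hu : IsFlat u) (h : u =ᶠ[𝓝[≠] 0] v) :
    IsFlat v := fun n => (hu n).congr' h EventuallyEq.rfl

theorem mul_isBigO_one {R : Type*} [NormedRing R] {u v : ℂ → R}
    (hu : IsFlat u) (hv : v =O[𝓝[≠] 0] fun _ => (1 : ℝ)) : IsFlat fun z => u z * v z := fun n => by
  simpa using (hu n).mul hv

theorem isBigO_one {E : Type*} [Norm E] {u : ℂ → E} (hu : IsFlat u) :
    u =O[𝓝[≠] 0] fun _ => (1 : ℝ) := by simpa using hu 0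

theorem tendsto_zero {E : Type*} [NormedAddCommGroup E] {u : ℂ → E} (hu : IsFlat u) :
    Tendsto u (𝓝[≠] 0) (𝓝 0) := by
  have h2 : Tendsto (fun z : ℂ => ‖z‖ ^ 1) (𝓝[≠] 0) (𝓝 0) := by
    simpa using (continuous_norm.tendsto (0 : ℂ)).mono_left nhdsWithin_le_nhds
  exact (hu 1).trans_tendsto h2

/-- Dividing a flat function by a power of `‖z‖` leaves it flat. -/
theorem of_pow_mul {u : ℂ → ℝ} {m : ℕ} (h : IsFlat fun z => ‖z‖ ^ m * u z) : IsFlat u := fun n => by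
  have h1 := (isBigO_refl (fun z : ℂ => (‖z‖ ^ m)⁻¹) (𝓝[≠] 0)).mul (h (m + n))
  refine h1.congr' ?_ ?_
  · filter_upwards [self_mem_nhdsWithin] with z hz
    have hz : 0 < ‖z‖ := norm_pos_iff.2 hz
    field_simp
  · filter_upwards [self_mem_nhdsWithin] with z hz
    have hz : 0 < ‖z‖ := norm_pos_iff.2 hz
    rw [pow_add]
    field_simp

theorem of_re {E : Type*} [Norm E] {u : ℂ → E} {v : ℂ → ℂ} (hv : IsFlat v)
    (h : ∀ z, ‖u z‖ ≤ ‖v z‖) : IsFlat u :=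
  hv.of_isBigO (IsBigO.of_bound 1 (Eventually.of_forall fun z => by simpa using h z))

end IsFlat

theorem tendsto_norm_pnhds : Tendsto (fun z : ℂ => ‖z‖) (𝓝[≠] 0) (𝓝[>] 0) := by
  refine tendsto_nhdsWithin_iff.2 ⟨?_, ?_⟩
  · simpa using (continuous_norm.tendsto (0 : ℂ)).mono_left nhdsWithin_le_nhds
  · filter_upwards [self_mem_nhdsWithin] with z hz
    exact norm_pos_iff.2 hz

theorem tendsto_norm_zero' : Tendsto (fun z : ℂ => ‖z‖) (𝓝[≠] 0) (𝓝 0) :=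
  tendsto_norm_pnhds.mono_right nhdsWithin_le_nhds

theorem tendsto_norm_comp {y : ℂ → ℂ} {l : Filter ℂ} (hy : Tendsto y l (𝓝 0)) :
    Tendsto (fun z => ‖y z‖) l (𝓝 0) := by simpa using hy.norm

namespace Profile
variable {G G' q q' : ℝ → ℝ}

theorem isFlat_G_comp (H : Profile G G' q q') {y : ℂ → ℂ} (hy : y =O[𝓝[≠] 0] fun z => ‖z‖) :
    IsFlat fun z => G ‖y z‖ := fun n => by
  have hy0 : Tendsto y (𝓝[≠] 0) (𝓝 0) := hy.trans_tendsto tendsto_norm_zero'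
  have h1 : (fun z => G ‖y z‖) =O[𝓝[≠] 0] fun z => ‖y z‖ ^ n := by
    refine IsBigO.of_bound 1 ?_
    filter_upwards [(tendsto_norm_comp hy0).eventually (H.G_flat n)] with z hz
    simpa using hz
  exact h1.trans (hy.norm_left.pow n)

theorem isFlat_G (H : Profile G G' q q') : IsFlat fun z : ℂ => G ‖z‖ :=
  H.isFlat_G_comp (y := fun z => z) (isBigO_refl _ _).norm_right

theorem isFlat_G' (H : Profile G G' q q') : IsFlat fun z : ℂ => G' ‖z‖ := fun n => by
  refine IsBigO.of_bound 1 ?_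
  filter_upwards [tendsto_norm_zero'.eventually (H.G'_flat n)] with z hz
  simpa using hz

theorem G_pos' (H : Profile G G' q q') : ∀ᶠ z : ℂ in 𝓝[≠] 0, 0 < G ‖z‖ :=
  tendsto_norm_pnhds.eventually H.G_pos

theorem q_sub_isBigO (H : Profile G G' q q') {l : Filter ℂ} {y₁ y₂ : ℂ → ℂ} (h1 : Tendsto y₁ l (𝓝 0))
    (h2 : Tendsto y₂ l (𝓝 0)) :
    (fun z => q ‖y₁ z‖ - q ‖y₂ z‖) =O[l] fun z => ‖y₁ z‖ - ‖y₂ z‖ := by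
  obtain ⟨C, δ, hC, hδ, h⟩ := H.q_taylor
  refine IsBigO.of_bound C ?_
  filter_upwards [(tendsto_norm_comp h1).eventually (gt_mem_nhds hδ),
    (tendsto_norm_comp h2).eventually (gt_mem_nhds hδ)] with z hz1 hz2
  exact ((h _ ⟨norm_nonneg _, hz2⟩).2 _ ⟨norm_nonneg _, hz1⟩).1

theorem tendsto_q (H : Profile G G' q q') {l : Filter ℂ} {y : ℂ → ℂ} (h : Tendsto y l (𝓝 0)) :
    Tendsto (fun z => q ‖y z‖) l (𝓝 0) := by
  have := H.q_sub_isBigO h (tendsto_const_nhds (x := (0 : ℂ)))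
  simp only [norm_zero, H.q_zero, sub_zero] at this
  exact this.trans_tendsto (tendsto_norm_comp h)

theorem eventually_continuousAt_q (H : Profile G G' q q') :
    ∀ᶠ z : ℂ in 𝓝 0, ContinuousAt (fun z : ℂ => q ‖z‖) z := by
  obtain ⟨C, δ, hC, hδ, h⟩ := H.q_taylor
  filter_upwards [ball_mem_nhds (0 : ℂ) hδ] with z hz
  have hlim : Tendsto (fun x : ℂ => C * |‖x‖ - ‖z‖|) (𝓝 z) (𝓝 0) := by
    have : Continuous fun x : ℂ => C * |‖x‖ - ‖z‖| := by fun_prop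
    simpa using this.tendsto z
  refine tendsto_iff_dist_tendsto_zero.2 (squeeze_zero' (Eventually.of_forall fun _ => dist_nonneg)
    ?_ hlim)
  filter_upwards [isOpen_ball.mem_nhds hz] with x hx
  exact ((h _ ⟨norm_nonneg _, by simpa using hz⟩).2 _ ⟨norm_nonneg _, by simpa using hx⟩).1

theorem eventually_continuousAt_G (H : Profile G G' q q') :
    ∀ᶠ z : ℂ in 𝓝 0, ContinuousAt (fun z : ℂ => G ‖z‖) z := by
  have : Tendsto (fun z : ℂ => ‖z‖) (𝓝 0) (𝓝 0) := by simpa using continuous_norm.tendsto (0 : ℂ)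
  filter_upwards [this.eventually H.G_deriv] with z hz
  exact ContinuousAt.comp (f := fun z : ℂ => ‖z‖) hz.continuousAt continuous_norm.continuousAt

end Profile

/-! ### The model hypersurface and identities along curves in it. -/

/-- The hypersurface `Re (w e^{-i q(|z|)}) + G(|z|) = 0`. -/
def Model (G q : ℝ → ℝ) : Set (ℂ × ℂ) :=
  {p | (p.1 * Complex.exp (((-q ‖p.2‖ : ℝ) : ℂ) * Complex.I)).re + G ‖p.2‖ = 0}

/-- The point over `z` of `Model G q` with parameter `τ z`. -/
noncomputable def curve (G q : ℝ → ℝ) (τ : ℂ → ℝ) (z : ℂ) : ℂ :=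
  Complex.exp ((q ‖z‖ : ℂ) * Complex.I) * (Complex.I * τ z - G ‖z‖)

theorem exp_mul_I_mul_exp_mul_I (x y : ℝ) : Complex.exp ((x : ℂ) * Complex.I) *
    Complex.exp (((-y : ℝ) : ℂ) * Complex.I) = Complex.exp (((x - y : ℝ) : ℂ) * Complex.I) := by
  rw [← Complex.exp_add]; push_cast; ring_nf

theorem curve_mem_model {G q : ℝ → ℝ} (τ : ℂ → ℝ) (z : ℂ) : (curve G q τ z, z) ∈ Model G q := by
  have h := exp_mul_I_mul_exp_mul_I (q ‖z‖) (q ‖z‖)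
  simp only [Model, curve, mem_ofPred_eq]
  rw [mul_right_comm, h]
  simp

theorem norm_curve {G q : ℝ → ℝ} (τ : ℂ → ℝ) (z : ℂ) :
    ‖curve G q τ z‖ = ‖Complex.I * τ z - G ‖z‖‖ := by
  rw [curve, norm_mul, Complex.norm_exp_ofReal_mul_I, one_mul]

theorem norm_curve_zero {G q : ℝ → ℝ} (z : ℂ) : ‖curve G q (fun _ => 0) z‖ = ‖G ‖z‖‖ := by
  rw [norm_curve]; simp

section Identities
variable {G G' q q' : ℝ → ℝ} {f₁ f₂ k : ℂ × ℂ → ℂ} {τ : ℂ → ℝ}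

theorem Profile.curve_isBigO (H : Profile G G' q q') {n : ℕ}
    (hτ : τ =O[𝓝[≠] 0] fun z => ‖z‖ ^ n) : curve G q τ =O[𝓝[≠] 0] fun z => ‖z‖ ^ n := by
  have h1 : curve G q τ =O[𝓝[≠] 0] fun z => ‖τ z‖ + ‖G ‖z‖‖ := by
    refine IsBigO.of_bound 1 (Eventually.of_forall fun z => ?_)
    rw [norm_curve, one_mul, Real.norm_of_nonneg (by positivity)]
    refine (norm_sub_le _ _).trans ?_
    simp
  exact h1.trans (hτ.norm_left.add (H.isFlat_G n).norm_left)

theorem Profile.tendsto_curve (H : Profile G G' q q') (hτ : τ =O[𝓝[≠] 0] fun z => ‖z‖) :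
    Tendsto (curve G q τ) (𝓝[≠] 0) (𝓝 0) := by
  have := H.curve_isBigO (τ := τ) (n := 1) (by simpa using hτ)
  simp only [pow_one] at this
  exact this.trans_tendsto tendsto_norm_zero'

theorem tendsto_prod_pnhds {W : ℂ → ℂ} (hW : Tendsto W (𝓝[≠] 0) (𝓝 0)) :
    Tendsto (fun z => (W z, z)) (𝓝[≠] 0) (𝓝 (0 : ℂ × ℂ)) :=
  hW.prodMk_nhds (tendsto_id.mono_left nhdsWithin_le_nhds)

theorem IsSep.tendsto_curve (H : Profile G G' q q') (hf : IsSep f₁)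
    (hτ : τ =O[𝓝[≠] 0] fun z => ‖z‖) :
    Tendsto (fun z => f₁ (curve G q τ z, z)) (𝓝[≠] 0) (𝓝 (f₁ 0)) :=
  hf.continuousAt.tendsto.comp (tendsto_prod_pnhds (H.tendsto_curve hτ))

theorem curve_identity (H : Profile G G' q q')
    (hτ : τ =O[𝓝[≠] 0] fun z => ‖z‖)
    (hN : ∀ᶠ p in 𝓝 (0 : ℂ × ℂ), p ∈ Model G q → (f₁ p, f₂ p) ∈ Model G q) :
    ∀ᶠ z in 𝓝[≠] 0, (f₁ (curve G q τ z, z) *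
      Complex.exp (((-q ‖f₂ (curve G q τ z, z)‖ : ℝ) : ℂ) * Complex.I)).re
        = -G ‖f₂ (curve G q τ z, z)‖ := by
  filter_upwards [(tendsto_prod_pnhds (H.tendsto_curve hτ)).eventually hN] with z hz
  have := hz (curve_mem_model τ z)
  simp only [Model, mem_ofPred_eq] at this
  linarith

/-- The point w of the curve carries the phase e^{i q(|z|)}, so when f₁ = w k only the difference of
the values of q at the two moduli remains. -/
theorem curve_identity_mul (H : Profile G G' q q')
    (hτ : τ =O[𝓝[≠] 0] fun z => ‖z‖)
    (hN : ∀ᶠ p in 𝓝 (0 : ℂ × ℂ), p ∈ Model G q → (p.1 * k p, f₂ p) ∈ Model G q) :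
    ∀ᶠ z in 𝓝[≠] 0, ((Complex.I * τ z - G ‖z‖) * (k (curve G q τ z, z) *
      Complex.exp (((q ‖z‖ - q ‖f₂ (curve G q τ z, z)‖ : ℝ) : ℂ) * Complex.I))).re
        = -G ‖f₂ (curve G q τ z, z)‖ := by
  filter_upwards [curve_identity (f₁ := fun p => p.1 * k p) H hτ hN] with z hz
  rw [← hz, ← exp_mul_I_mul_exp_mul_I]
  congr 1
  rw [curve]
  ring

/-- `f₂ (W z, z) = O(z)` along curves in the model. -/
theorem IsSep.curve_isBigO (H : Profile G G' q q') (hf : IsSep f₂) (hf0 : f₂ 0 = 0)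
    (hτ : τ =O[𝓝[≠] 0] fun z => ‖z‖) :
    (fun z => f₂ (curve G q τ z, z)) =O[𝓝[≠] 0] fun z => ‖z‖ := by
  have h1 : (fun z => f₂ (curve G q τ z, z) - f₂ (0, z)) =O[𝓝[≠] 0] fun z => ‖z‖ := by
    refine (hf.sub_isBigO (H.tendsto_curve hτ)).trans ?_
    simpa using H.curve_isBigO (τ := τ) (n := 1) (by simpa using hτ)
  have h2 : (fun z => f₂ (0, z)) =O[𝓝[≠] 0] fun z => ‖z‖ := by
    have := hf.analyticAt.differentiableAt.isBigO_sub
    simp only [sub_zero, Prod.mk_zero_zero, hf0] at this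
    exact this.norm_right.mono nhdsWithin_le_nhds
  exact (h1.add h2).congr_left fun z => by ring

theorem tendsto_exp_mul_I {u : ℂ → ℝ} {l : Filter ℂ} (h : Tendsto u l (𝓝 0)) :
    Tendsto (fun z => Complex.exp ((u z : ℂ) * Complex.I)) l (𝓝 1) := by
  have hc : Continuous fun x : ℝ => Complex.exp ((x : ℂ) * Complex.I) := by fun_prop
  simpa [Function.comp_def] using (hc.tendsto 0).comp h

theorem zero_isBigO_norm : (fun _ : ℂ => (0 : ℝ)) =O[𝓝[≠] 0] fun z : ℂ => ‖z‖ := isBigO_zero _ _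

/-- The complex curve `w = 0` is preserved. -/
theorem fst_eq_zero (H : Profile G G' q q') (hf₁ : IsSep f₁) (hf₂ : IsSep f₂) (h1 : f₁ 0 = 0)
    (h2 : f₂ 0 = 0)
    (hN : ∀ᶠ p in 𝓝 (0 : ℂ × ℂ), p ∈ Model G q → (f₁ p, f₂ p) ∈ Model G q) :
    ∀ᶠ z in 𝓝 0, f₁ (0, z) = 0 := by
  have hy := hf₂.curve_isBigO H h2 zero_isBigO_norm
  have hy0 := hf₂.tendsto_curve H zero_isBigO_norm
  rw [h2] at hy0
  set W := curve G q (fun _ => 0) with hW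
  -- With parameter zero the curve is O(G). Replacing f₁(W, z) by f₁(0, z) therefore costs a flat
  -- error, and the equation makes Re (f₁(0, z) E) flat with E → 1.
  have hWflat : IsFlat W := H.isFlat_G.of_isBigO
    (IsBigO.of_bound 1 (Eventually.of_forall fun z => by rw [norm_curve_zero, one_mul]))
  set E : ℂ → ℂ := fun z => Complex.exp (((-q ‖f₂ (W z, z)‖ : ℝ) : ℂ) * Complex.I) with hE
  have hE1 : Tendsto E (𝓝[≠] 0) (𝓝 1) :=
    tendsto_exp_mul_I (by simpa using (H.tendsto_q hy0).neg)
  have hflat : IsFlat fun z => (f₁ (0, z) * E z).re := by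
    have ha := (H.isFlat_G_comp hy).neg
    have hb : IsFlat fun z => ((f₁ (W z, z) - f₁ (0, z)) * E z).re :=
      ((hWflat.of_isBigO (hf₁.sub_isBigO hWflat.tendsto_zero)).mul_isBigO_one
        (hE1.isBigO_one ℝ)).of_re fun z => Complex.abs_re_le_norm _
    refine (ha.sub hb).congr' ?_
    filter_upwards [curve_identity H zero_isBigO_norm hN] with z hz
    rw [← hz, sub_mul, Complex.sub_re]
    ring
  exact eventually_eq_zero_of_isBigO hf₁.analyticAt fun n =>
    isBigO_of_re_mul_isBigO hf₁.analyticAt h1 hE1 one_ne_zero (hflat n)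

/-- The argument of the multiplier `k (0, z)` is determined by `q` up to a flat error. -/
theorem isFlat_im_multiplier (H : Profile G G' q q') (hk : IsSep k) (hf₂ : IsSep f₂) (h2 : f₂ 0 = 0)
    (hN : ∀ᶠ p in 𝓝 (0 : ℂ × ℂ), p ∈ Model G q → (p.1 * k p, f₂ p) ∈ Model G q) :
    IsFlat fun z => (k (0, z) *
      Complex.exp (((q ‖z‖ - q ‖f₂ (0, z)‖ : ℝ) : ℂ) * Complex.I)).im := by
  -- The exponent n + 1 keeps the parameter τ = |z| ^ (n + 1) of size O(|z|) for every n; exponent 0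
  -- follows from exponent 1.
  suffices h : ∀ n : ℕ, (fun z => (k (0, z) *
      Complex.exp (((q ‖z‖ - q ‖f₂ (0, z)‖ : ℝ) : ℂ) * Complex.I)).im) =O[𝓝[≠] 0]
        fun z => ‖z‖ ^ (n + 1) by
    intro n
    rcases n with _ | n
    · refine (h 0).trans ?_
      simpa using tendsto_norm_zero'.isBigO_one ℝ
    · exact h n
  intro n
  set τ : ℂ → ℝ := fun z => ‖z‖ ^ (n + 1) with hτdef
  have hτ : τ =O[𝓝[≠] 0] fun z => ‖z‖ := by
    have := (isBigO_refl (fun z : ℂ => ‖z‖) (𝓝[≠] 0)).mul ((tendsto_norm_zero'.pow n).isBigO_one ℝ)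
    simp only [mul_one] at this
    exact this.congr_left fun z => by rw [hτdef]; simp only [pow_succ]; ring
  have hWO : curve G q τ =O[𝓝[≠] 0] fun z => ‖z‖ ^ (n + 1) := H.curve_isBigO (isBigO_refl _ _)
  have hW0 := H.tendsto_curve hτ
  have hy := hf₂.curve_isBigO H h2 hτ
  have hy0 := hf₂.tendsto_curve H hτ
  have hk0 := hk.tendsto_curve H hτ
  have hid := curve_identity_mul H hτ hN
  rw [h2] at hy0
  set W := curve G q τ with hW
  set e : ℂ → ℂ := fun z => Complex.exp (((q ‖z‖ - q ‖f₂ (W z, z)‖ : ℝ) : ℂ) * Complex.I) with he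
  set e₀ : ℂ → ℂ := fun z => Complex.exp (((q ‖z‖ - q ‖f₂ (0, z)‖ : ℝ) : ℂ) * Complex.I) with he₀
  have he1 : ∀ z, ‖e z‖ = 1 := fun z => Complex.norm_exp_ofReal_mul_I _
  have hbdd : (fun z => (k (W z, z) * e z)) =O[𝓝[≠] 0] fun _ => (1 : ℝ) := by
    have := (hk0.isBigO_one ℝ).mul (IsBigO.of_bound (g := fun _ : ℂ => (1 : ℝ)) (f := e)
      (l := 𝓝[≠] 0) 1 (Eventually.of_forall fun z => by simp [he1]))
    simpa using this
  have hre : (fun z => (k (W z, z) * e z).re) =O[𝓝[≠] 0] fun _ => (1 : ℝ) :=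
    (IsBigO.of_bound 1 (Eventually.of_forall fun z => by
      rw [one_mul]; exact Complex.abs_re_le_norm _)).trans hbdd
  -- The identity reads τ Im (k e) = G(|f₂|) - G(|z|) Re (k e), whose right side is flat; dividing
  -- by τ, a power of |z|, keeps flatness. Passing from w = W z to w = 0 then costs O(W) = O(|z| ^
  -- (n + 1)).
  have h3 : IsFlat fun z => (k (W z, z) * e z).im := by
    refine IsFlat.of_pow_mul (m := n + 1) ?_
    have := (H.isFlat_G_comp hy).sub (H.isFlat_G.mul_isBigO_one hre)
    refine this.congr' ?_
    filter_upwards [hid] with z hz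
    simp only [Complex.mul_re, Complex.sub_re, Complex.sub_im, Complex.I_re, Complex.I_im,
      Complex.ofReal_re, Complex.ofReal_im, Complex.mul_im] at hz ⊢
    linarith
  have hf₂0 : Tendsto (fun z => f₂ (0, z)) (𝓝[≠] 0) (𝓝 0) := by
    have := hf₂.analyticAt.continuousAt.tendsto.mono_left (nhdsWithin_le_nhds (s := {0}ᶜ))
    rwa [show f₂ (0, 0) = 0 from h2] at this
  have hde : (fun z => e z - e₀ z) =O[𝓝[≠] 0] fun z => ‖z‖ ^ (n + 1) := by
    have ha : (fun z => e z - e₀ z) =O[𝓝[≠] 0] fun z => q ‖f₂ (W z, z)‖ - q ‖f₂ (0, z)‖ := by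
      refine IsBigO.of_bound 1 (Eventually.of_forall fun z => ?_)
      have hsplit : e z - e₀ z = e₀ z * (Complex.exp (((-(q ‖f₂ (W z, z)‖ - q ‖f₂ (0, z)‖) : ℝ) : ℂ)
          * Complex.I) - 1) := by
        rw [mul_sub, exp_mul_I_mul_exp_mul_I, mul_one, he]
        simp only
        congr 4
        ring_nf
      rw [hsplit, norm_mul, Complex.norm_exp_ofReal_mul_I, one_mul, one_mul, mul_comm _ Complex.I]
      refine (Real.norm_exp_I_mul_ofReal_sub_one_le).trans ?_
      rw [norm_neg]
    refine ha.trans ((H.q_sub_isBigO hy0 hf₂0).trans ?_)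
    refine IsBigO.trans (IsBigO.of_bound 1 (Eventually.of_forall fun z => ?_))
      ((hf₂.sub_isBigO hW0).trans hWO)
    rw [one_mul]
    exact abs_norm_sub_norm_le _ _
  have hk0' : (fun z => k (0, z)) =O[𝓝[≠] 0] fun _ => (1 : ℝ) :=
    hk.isBigO_one (W := fun _ => 0) tendsto_const_nhds
  have h4 : (fun z => k (W z, z) * e z - k (0, z) * e₀ z) =O[𝓝[≠] 0] fun z => ‖z‖ ^ (n + 1) := by
    have ha := ((hk.sub_isBigO hW0).trans hWO).mul (IsBigO.of_bound (g := fun _ : ℂ => (1 : ℝ))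
      (f := e) (l := 𝓝[≠] 0) 1 (Eventually.of_forall fun z => by simp [he1]))
    have hb := hk0'.mul hde
    simp only [mul_one, one_mul] at ha hb
    exact (ha.add hb).congr_left fun z => by ring
  have h5 : (fun z => (k (W z, z) * e z - k (0, z) * e₀ z).im) =O[𝓝[≠] 0] fun z => ‖z‖ ^ (n + 1) :=
    (IsBigO.of_bound 1 (Eventually.of_forall fun z => by
      rw [one_mul]; exact Complex.abs_im_le_norm _)).trans h4
  exact ((h3 (n + 1)).sub h5).congr_left fun z => by simp only [Complex.sub_im]; ring

end Identities

/-! ### The map on the invariant curve w = 0. -/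

section
variable {G G' q q' : ℝ → ℝ}

/-- A radial change of scale `s ↦ Y s` multiplying a flat function by a factor with a positive
limit is tangent to the identity. -/
theorem Profile.tangent_to_id (H : Profile G G' q q') {Y ρ : ℝ → ℝ} {β κ : ℝ} (hβ : 0 < β)
    (hκ : 0 < κ) (hY0 : Y 0 = 0) (hYc : ∀ᶠ s in 𝓝[>] (0 : ℝ), ContinuousOn Y (Icc 0 s))
    (hYβ : Tendsto (fun s => Y s / s) (𝓝[>] 0) (𝓝 β)) (hρ : Tendsto ρ (𝓝[>] 0) (𝓝 κ))
    (h : ∀ᶠ s in 𝓝[>] (0 : ℝ), ρ s * G s = G (Y s)) : β = 1 := by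
  rcases lt_trichotomy β 1 with hlt | heq | hgt
  · exfalso
    obtain ⟨r, hr1, hr2⟩ := exists_between hlt
    have hr0 : 0 < r := hβ.trans hr1
    -- For β < 1 pass from s to Y s: G keeps at least the fraction κ / 2, while s ^ K is multiplied
    -- by at most r ^ K < κ / 2.
    obtain ⟨K, hK⟩ := exists_pow_lt_of_lt_one (half_pos hκ) hr2
    refine H.false_of_descent K ?_
    filter_upwards [hYβ.eventually (gt_mem_nhds hr1), hYβ.eventually (lt_mem_nhds hβ),
      hρ.eventually (lt_mem_nhds (half_lt_self hκ)), h, H.G_pos, self_mem_nhdsWithin]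
      with s h1 h2 h3 h4 h5 hs
    have hs : 0 < s := hs
    rw [div_lt_iff₀ hs] at h1
    have h2' : 0 < Y s := by rwa [lt_div_iff₀ hs, zero_mul] at h2
    refine ⟨Y s, ⟨h2', by nlinarith⟩, ?_⟩
    have h6 : (Y s) ^ K ≤ (r * s) ^ K := pow_le_pow_left₀ h2'.le h1.le K
    rw [mul_pow] at h6
    have hsK : 0 < s ^ K := by positivity
    calc G s * Y s ^ K ≤ G s * (κ / 2 * s ^ K) := by
          have := mul_le_mul_of_nonneg_right hK.le hsK.le
          gcongr
          linarith
      _ = (κ / 2 * G s) * s ^ K := by ring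
      _ ≤ (ρ s * G s) * s ^ K := by gcongr
      _ = G (Y s) * s ^ K := by rw [h4]
  · exact heq
  · exfalso
    obtain ⟨r, hr1, hr2⟩ := exists_between hgt
    have hr0 : 0 < r := one_pos.trans hr1
    obtain ⟨K, hK⟩ := pow_unbounded_of_one_lt (2 * κ) hr1
    refine H.false_of_descent K ?_
    have hev : ∀ᶠ s in 𝓝[>] (0 : ℝ), r * s < Y s ∧ ρ s < 2 * κ ∧ ρ s * G s = G (Y s) ∧ 0 < G s := by
      filter_upwards [hYβ.eventually (lt_mem_nhds hr2), hρ.eventually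
        (gt_mem_nhds (show κ < 2 * κ by linarith)), h, H.G_pos, self_mem_nhdsWithin]
        with s h1 h2 h3 h4 hs
      have hs : 0 < s := hs
      rw [lt_div_iff₀ hs] at h1
      exact ⟨h1, h2, h3, h4⟩
    obtain ⟨δ, hδ, hev⟩ := mem_nhdsGT_iff_exists_Ioo_subset.1 hev
    filter_upwards [hYc, Ioo_mem_nhdsGT (show (0 : ℝ) < δ from hδ)] with s hc hs
    have hs0 : 0 < s := hs.1
    obtain ⟨h1, -, -, -⟩ := hev hs
    -- For β > 1 run the map backwards: by continuity s = Y t for some t < s, where G s ≤ 2 κ G t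
    -- and s ^ K ≥ r ^ K t ^ K with r ^ K > 2 κ.
    obtain ⟨t, ht, hts⟩ := intermediate_value_Icc hs0.le hc
      (show s ∈ Icc (Y 0) (Y s) from ⟨by rw [hY0]; exact hs0.le, by nlinarith⟩)
    have ht0 : 0 < t := by
      rcases ht.1.eq_or_lt with h0 | h0
      · rw [← h0, hY0] at hts; exact absurd hts hs0.ne
      · exact h0
    obtain ⟨h2, h3, h4, h5⟩ := hev (show t ∈ Ioo 0 δ from ⟨ht0, ht.2.trans_lt hs.2⟩)
    rw [hts] at h2 h4
    refine ⟨t, ⟨ht0, by nlinarith⟩, ?_⟩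
    have htK : 0 < t ^ K := by positivity
    rw [← h4]
    calc ρ t * G t * t ^ K ≤ 2 * κ * G t * t ^ K := by gcongr
      _ ≤ r ^ K * G t * t ^ K := by gcongr
      _ = G t * (r * t) ^ K := by rw [mul_pow]; ring
      _ ≤ G t * s ^ K := by gcongr

/-- A flat function cannot change by a factor `1 - O(s ^ m)` when the radius shrinks by a factor
`1 - c s ^ m`. -/
theorem Profile.false_of_slow_descent (H : Profile G G' q q') {Y ρ : ℝ → ℝ} {c C : ℝ} {m : ℕ}
    (hm : m ≠ 0) (hc : 0 < c) (hY : ∀ᶠ s in 𝓝[>] (0 : ℝ), 0 < Y s ∧ Y s ≤ s * (1 - c * s ^ m))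
    (hρ : ∀ᶠ s in 𝓝[>] (0 : ℝ), 1 - C * s ^ m ≤ ρ s)
    (h : ∀ᶠ s in 𝓝[>] (0 : ℝ), ρ s * G s = G (Y s)) : False := by
  -- With x = s ^ m, Bernoulli's inequality gives (1 - c x) ^ K ≤ 1 / (1 + K c x). For K c > 2 |C|
  -- and |C| x ≤ 1 / 2 this is at most 1 - |C| x ≤ ρ, which is what descent to Y s requires.
  obtain ⟨K, hK⟩ := exists_nat_gt (2 * |C| / c)
  rw [div_lt_iff₀ hc] at hK
  have hsm : Tendsto (fun s : ℝ => s ^ m) (𝓝[>] 0) (𝓝 0) := by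
    have := (continuous_pow m).tendsto (0 : ℝ)
    rw [zero_pow hm] at this
    exact this.mono_left nhdsWithin_le_nhds
  refine H.false_of_descent K ?_
  filter_upwards [hY, hρ, h, H.G_pos, self_mem_nhdsWithin,
    hsm.eventually (gt_mem_nhds (show (0 : ℝ) < 1 / (2 * (|C| + 1)) by positivity)),
    hsm.eventually (gt_mem_nhds (show (0 : ℝ) < 1 / c by positivity))] with s h1 h2 h3 h4 hs h5 h6
  have hs : 0 < s := hs
  have hx : 0 < s ^ m := by positivity
  set x := s ^ m with hxdef
  rw [lt_div_iff₀ (by positivity)] at h5 h6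
  have hcx : 0 < c * x := by positivity
  refine ⟨Y s, ⟨h1.1, by nlinarith⟩, ?_⟩
  have hpos : 0 ≤ 1 - c * x := by linarith
  have hb : (1 - c * x) ^ K * (1 + K * (c * x)) ≤ 1 := by
    have hbern : 1 + K * (c * x) ≤ (1 + c * x) ^ K :=
      one_add_mul_le_pow (by linarith) K
    calc (1 - c * x) ^ K * (1 + K * (c * x)) ≤ (1 - c * x) ^ K * (1 + c * x) ^ K := by gcongr
      _ = (1 - (c * x) ^ 2) ^ K := by rw [← mul_pow]; ring_nf
      _ ≤ 1 := pow_le_one₀ (by nlinarith) (by nlinarith)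
  have habs : 0 ≤ |C| := abs_nonneg C
  have hfac : (1 - c * x) ^ K ≤ ρ s := by
    have hone : 1 ≤ (1 - |C| * x) * (1 + K * (c * x)) := by
      have h7 : |C| * x ≤ 1 / 2 := by nlinarith
      have h8 : 2 * |C| * x ≤ K * (c * x) := by nlinarith
      have h9 : 0 ≤ |C| * x := by positivity
      nlinarith
    have hD : 0 < 1 + K * (c * x) := by positivity
    have h10 : (1 - c * x) ^ K ≤ 1 - |C| * x :=
      le_of_mul_le_mul_right (hb.trans hone) hD
    refine h10.trans (le_trans ?_ h2)
    nlinarith [le_abs_self C]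
  have h6' : (Y s) ^ K ≤ (s * (1 - c * x)) ^ K := pow_le_pow_left₀ h1.1.le h1.2 K
  rw [mul_pow] at h6'
  have hsK : 0 < s ^ K := by positivity
  calc G s * Y s ^ K ≤ G s * (s ^ K * (1 - c * x) ^ K) := by gcongr
    _ ≤ G s * (s ^ K * ρ s) := by gcongr
    _ = (ρ s * G s) * s ^ K := by ring
    _ = G (Y s) * s ^ K := by rw [h3]

/-- Along the ray in a direction where `b z (1 + z ^ m v z)` moves radially. -/
theorem radial_displacement {y v : ℂ → ℂ} {b d : ℂ} {m : ℕ} {a : ℝ} (hb : ‖b‖ = 1) (hd : ‖d‖ = 1)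
    (hv : Tendsto v (𝓝[≠] 0) (𝓝 (v 0))) (hdv : d ^ m * v 0 = (a : ℂ)) (hm : m ≠ 0)
    (hy : (fun z => y z - b * z * (1 + z ^ m * v z)) =O[𝓝[≠] 0] fun z => ‖z‖ ^ (m + 2))
    {ε : ℝ} (hε : 0 < ε) :
    ∀ᶠ s : ℝ in 𝓝[>] (0 : ℝ), |‖y (s * d)‖ - s * (1 + a * s ^ m)| ≤ ε * (s * s ^ m) := by
  have hd0 : d ≠ 0 := by rintro rfl; simp at hd
  have hray := tendsto_ray hd0
  obtain ⟨C, hC⟩ := (hy.comp_tendsto hray).bound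
  have hsm : Tendsto (fun s : ℝ => a * s ^ m) (𝓝[>] 0) (𝓝 0) := by
    have h1 : Continuous fun s : ℝ => a * s ^ m := by fun_prop
    have := h1.tendsto (0 : ℝ)
    simp only [zero_pow hm, mul_zero] at this
    exact this.mono_left nhdsWithin_le_nhds
  have hsC : Tendsto (fun s : ℝ => C * s) (𝓝[>] 0) (𝓝 0) := by
    have h1 : Continuous fun s : ℝ => C * s := by fun_prop
    have := h1.tendsto (0 : ℝ)
    simp only [mul_zero] at this
    exact this.mono_left nhdsWithin_le_nhds
  have hlim : Tendsto (fun s : ℝ => ‖d ^ m * v (s * d) - a‖) (𝓝[>] 0) (𝓝 0) := by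
    have := (((hv.comp hray).const_mul (d ^ m)).sub_const (a : ℂ)).norm
    simpa [hdv, Function.comp_def] using this
  filter_upwards [hC, hsm.eventually (lt_mem_nhds (show (-1 : ℝ) < 0 by norm_num)),
    hsC.eventually (gt_mem_nhds (half_pos hε)), hlim.eventually (gt_mem_nhds (half_pos hε)),
    self_mem_nhdsWithin] with s h1 h2 h3 h4 hs
  have hs : 0 < s := hs
  simp only [Function.comp, norm_mul, hd, mul_one, Complex.norm_real, Real.norm_of_nonneg hs.le,
    norm_pow] at h1
  -- Since b and d are unimodular, the main term of y has modulus exactly s (1 + a s ^ m) once this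
  -- is positive.
  have hnorm : ‖b * d * ((s * (1 + a * s ^ m) : ℝ) : ℂ)‖ = s * (1 + a * s ^ m) := by
    rw [norm_mul, norm_mul, hb, hd, Complex.norm_real, Real.norm_of_nonneg]
    · ring
    · have : 0 < 1 + a * s ^ m := by linarith
      positivity
  rw [← hnorm]
  refine (abs_norm_sub_norm_le _ _).trans ?_
  have hsplit : y (s * d) - b * d * ((s * (1 + a * s ^ m) : ℝ) : ℂ)
      = (y (s * d) - b * (s * d) * (1 + (s * d) ^ m * v (s * d)))
        + b * d * ((s * s ^ m : ℝ) : ℂ) * (d ^ m * v (s * d) - a) := by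
    push_cast
    ring
  rw [hsplit]
  have hpos : 0 < s * s ^ m := by positivity
  calc _ ≤ C * s ^ (m + 2) + s * s ^ m * (ε / 2) := by
        refine (norm_add_le _ _).trans (add_le_add h1 ?_)
        rw [norm_mul, norm_mul, norm_mul, hb, hd, Complex.norm_real, Real.norm_of_nonneg hpos.le]
        simp only [one_mul]
        gcongr
    _ = (C * s) * (s * s ^ m) + s * s ^ m * (ε / 2) := by ring
    _ ≤ ε / 2 * (s * s ^ m) + s * s ^ m * (ε / 2) := by gcongr
    _ = ε * (s * s ^ m) := by ring

end

section
variable {G G' q q' : ℝ → ℝ} {f₁ f₂ k : ℂ × ℂ → ℂ}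

/-- If `(0, z) ↦ b z (1 + u z)` on the invariant curve, with `u = O(z ^ n)`, then the multiplier
differs from its value at the origin by `O(z ^ n)`. -/
theorem multiplier_sub_isBigO (H : Profile G G' q q') (hk : IsSep k)
    (hf₂ : IsSep f₂) (h2 : f₂ 0 = 0) {κ : ℝ} (hκ : k 0 = κ)
    (hflat : IsFlat fun z => (k (0, z) *
      Complex.exp (((q ‖z‖ - q ‖f₂ (0, z)‖ : ℝ) : ℂ) * Complex.I)).im)
    {b : ℂ} (hb : ‖b‖ = 1) {u : ℂ → ℂ} {n : ℕ} (hu : u =O[𝓝[≠] 0] fun z => ‖z‖ ^ n)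
    (hh : ∀ᶠ z in 𝓝[≠] 0, f₂ (0, z) = b * z * (1 + u z)) :
    (fun z => k (0, z) - κ) =O[𝓝[≠] 0] fun z => ‖z‖ ^ n := by
  have hf₂0 : Tendsto (fun z => f₂ (0, z)) (𝓝[≠] 0) (𝓝 0) := by
    have := hf₂.analyticAt.continuousAt.tendsto.mono_left (nhdsWithin_le_nhds (s := {0}ᶜ))
    rwa [show f₂ (0, 0) = 0 from h2] at this
  have hid : Tendsto (fun z : ℂ => z) (𝓝[≠] 0) (𝓝 0) := tendsto_id.mono_left nhdsWithin_le_nhds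
  set η : ℂ → ℝ := fun z => q ‖z‖ - q ‖f₂ (0, z)‖ with hη
  have hηO : η =O[𝓝[≠] 0] fun z => ‖z‖ ^ n := by
    refine (H.q_sub_isBigO hid hf₂0).trans ?_
    have h3 : (fun z => ‖z‖ - ‖f₂ (0, z)‖) =O[𝓝[≠] 0] fun z => ‖z‖ * ‖u z‖ := by
      refine IsBigO.of_bound 1 ?_
      filter_upwards [hh] with z hz
      rw [hz, one_mul, Real.norm_of_nonneg (by positivity : 0 ≤ ‖z‖ * ‖u z‖)]
      calc ‖‖z‖ - ‖b * z * (1 + u z)‖‖ = |‖b * z‖ - ‖b * z * (1 + u z)‖| := by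
            rw [norm_mul b z, hb, one_mul, Real.norm_eq_abs]
        _ ≤ ‖b * z - b * z * (1 + u z)‖ := abs_norm_sub_norm_le _ _
        _ = ‖b * z * u z‖ := by rw [← norm_neg]; congr 1; ring
        _ = ‖z‖ * ‖u z‖ := by rw [norm_mul, norm_mul, hb, one_mul]
    refine h3.trans ?_
    simpa using (tendsto_norm_zero'.isBigO_one ℝ).mul hu.norm_left
  have hη0 : Tendsto η (𝓝[≠] 0) (𝓝 0) := by
    simpa using (H.tendsto_q hid).sub (H.tendsto_q hf₂0)
  have he := tendsto_exp_mul_I hη0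
  have han : AnalyticAt ℂ (fun z => k (0, z) - (κ : ℂ)) 0 := hk.analyticAt.sub analyticAt_const
  -- The factor -i turns real parts into imaginary parts: Im ((k - κ) e^{iη}) = Im (k e^{iη}) - κ
  -- sin η, a flat term minus one of size O(η) = O(|z| ^ n).
  refine isBigO_of_re_mul_isBigO (E := fun z => -Complex.I * Complex.exp ((η z : ℂ) * Complex.I))
    han (by rw [Prod.mk_zero_zero, hκ, sub_self]) (he.const_mul (-Complex.I)) (by simp) ?_
  have h4 : (fun z => κ * Real.sin (η z)) =O[𝓝[≠] 0] fun z => ‖z‖ ^ n := by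
    refine IsBigO.const_mul_left (IsBigO.trans (IsBigO.of_bound 1 ?_) hηO) κ
    exact Eventually.of_forall fun z => by
      rw [one_mul, Real.norm_eq_abs, Real.norm_eq_abs]; exact Real.abs_sin_le_abs
  refine ((hflat n).sub h4).congr_left fun z => ?_
  simp only [Complex.mul_re, Complex.mul_im, Complex.sub_re, Complex.sub_im, Complex.neg_re,
    Complex.neg_im, Complex.I_re, Complex.I_im, Complex.ofReal_re, Complex.ofReal_im,
    Complex.exp_ofReal_mul_I_re, Complex.exp_ofReal_mul_I_im, hη]
  ring

/-- A factor multiplying a flat function under a displacement of order `G` tends to `1`. -/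
theorem Profile.factor_eq_one (H : Profile G G' q q') {y : ℂ → ℂ} {b : ℂ} (hb : ‖b‖ = 1)
    (hy : (fun z => y z - b * z) =O[𝓝[≠] 0] fun z => G ‖z‖) {ρ : ℂ → ℝ} {κ : ℝ}
    (hρ : Tendsto ρ (𝓝[≠] 0) (𝓝 κ)) (h : ∀ᶠ z in 𝓝[≠] 0, ρ z * G ‖z‖ = G ‖y z‖) : κ = 1 := by
  obtain ⟨C, hC⟩ := hy.bound
  have hlim : Tendsto (fun z : ℂ => |G' ‖z‖| * C + C ^ 2 * G ‖z‖) (𝓝[≠] 0) (𝓝 0) := by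
    simpa using (H.isFlat_G'.tendsto_zero.abs.mul_const C).add
      (H.isFlat_G.tendsto_zero.const_mul (C ^ 2))
  -- The Taylor estimate for G at s applies to displacements of size at most s.
  have hCG : ∀ᶠ z : ℂ in 𝓝[≠] 0, C * G ‖z‖ ≤ ‖z‖ := by
    have h1 : (fun z : ℂ => C * G ‖z‖) =o[𝓝[≠] 0] fun z => ‖z‖ := by
      have h2 : (fun z : ℂ => C * G ‖z‖) =O[𝓝[≠] 0] fun z => ‖z‖ ^ 2 :=
        (H.isFlat_G 2).const_mul_left C
      refine h2.trans_isLittleO ?_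
      have := ((isLittleO_one_iff ℝ).2 tendsto_norm_zero').mul_isBigO
        (isBigO_refl (fun z : ℂ => ‖z‖) (𝓝[≠] 0))
      simp only [one_mul] at this
      exact this.congr_left fun z => by ring
    filter_upwards [h1.bound one_pos] with z hz
    rw [one_mul, norm_norm] at hz
    exact (le_abs_self _).trans hz
  -- The displacement is at most C G, so G changes by at most |G'| C G + (C G) ^ 2; after division
  -- by G, |ρ - 1| ≤ C |G'| + C ^ 2 G → 0.
  have h3 : Tendsto (fun z => ρ z - 1) (𝓝[≠] 0) (𝓝 0) := by
    refine squeeze_zero_norm' ?_ hlim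
    filter_upwards [hC, h, H.G_pos', hCG, tendsto_norm_pnhds.eventually (H.G_taylor 0)]
      with z h1 h2 h3 h4 h5
    rw [Real.norm_of_nonneg h3.le] at h1
    have hd : |‖y z‖ - ‖z‖| ≤ C * G ‖z‖ := by
      have := abs_norm_sub_norm_le (y z) (b * z)
      rw [norm_mul, hb, one_mul] at this
      exact this.trans h1
    have h6 := h5 ‖y z‖ (hd.trans h4)
    rw [pow_zero, one_mul] at h6
    have hsq : (‖y z‖ - ‖z‖) ^ 2 ≤ (C * G ‖z‖) ^ 2 := by
      rw [← sq_abs]; exact pow_le_pow_left₀ (abs_nonneg _) hd 2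
    have h7 : |G ‖y z‖ - G ‖z‖| ≤ |G' ‖z‖| * (C * G ‖z‖) + (C * G ‖z‖) ^ 2 := by
      calc |G ‖y z‖ - G ‖z‖| = |(G ‖y z‖ - G ‖z‖ - G' ‖z‖ * (‖y z‖ - ‖z‖))
            + G' ‖z‖ * (‖y z‖ - ‖z‖)| := by congr 1; ring
        _ ≤ _ := abs_add_le _ _
        _ ≤ (C * G ‖z‖) ^ 2 + |G' ‖z‖| * (C * G ‖z‖) := by
            rw [abs_mul]
            gcongr
            exact h6.trans hsq
        _ = _ := by ring
    rw [← h2] at h7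
    have h8 : |ρ z * G ‖z‖ - G ‖z‖| = |ρ z - 1| * G ‖z‖ := by
      rw [← abs_of_pos h3, ← abs_mul, abs_of_pos h3]; congr 1; ring
    rw [h8] at h7
    refine le_of_mul_le_mul_right (h7.trans_eq ?_) h3
    ring
  have := tendsto_nhds_unique h3 (hρ.sub_const 1)
  linarith

theorem isPreconnected_sphere_complex (r : ℝ) : IsPreconnected (sphere (0 : ℂ) r) :=
  isPreconnected_sphere (by rw [Complex.rank_real_complex]; norm_num) 0 r

/-- On the invariant curve `w = 0` the map is a rotation, and the multiplier is `1`. -/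
theorem rotation_on_curve (H : Profile G G' q q') (hk : IsSep k) (hf₂ : IsSep f₂) (h2 : f₂ 0 = 0)
    (hN : ∀ᶠ p in 𝓝 (0 : ℂ × ℂ), p ∈ Model G q → (p.1 * k p, f₂ p) ∈ Model G q)
    (hk0 : k 0 ≠ 0) (hb0 : deriv (fun z => f₂ (0, z)) 0 ≠ 0) :
    ∃ b : ℂ, ‖b‖ = 1 ∧ (∀ᶠ z in 𝓝 0, k (0, z) = 1) ∧ ∀ᶠ z in 𝓝 0, f₂ (0, z) = b * z := by
  have hf20 : f₂ (0, 0) = 0 := h2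
  have hk0' : k (0, 0) ≠ 0 := hk0
  have hid : Tendsto (fun z : ℂ => z) (𝓝[≠] 0) (𝓝 0) := tendsto_id.mono_left nhdsWithin_le_nhds
  have hf₂0 : Tendsto (fun z => f₂ (0, z)) (𝓝[≠] 0) (𝓝 0) := by
    have := hf₂.analyticAt.continuousAt.tendsto.mono_left (nhdsWithin_le_nhds (s := {0}ᶜ))
    rwa [hf20] at this
  have hflat := isFlat_im_multiplier H hk hf₂ h2 hN
  -- the multiplier at the origin is real
  set κ := (k 0).re with hκdef
  have hκ : k 0 = κ := by
    have h1 : Tendsto (fun z => k (0, z)) (𝓝[≠] 0) (𝓝 (k 0)) :=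
      hk.analyticAt.continuousAt.tendsto.mono_left nhdsWithin_le_nhds
    have h3 := h1.mul (tendsto_exp_mul_I
      (by simpa using (H.tendsto_q hid).sub (H.tendsto_q hf₂0)))
    have h4 := tendsto_nhds_unique ((Complex.continuous_im.tendsto _).comp h3) hflat.tendsto_zero
    rw [mul_one] at h4
    exact Complex.ext (by simp [hκdef]) (by simpa using h4)
  set W := curve G q (fun _ => 0) with hW
  have hW0 : Tendsto W (𝓝[≠] 0) (𝓝 0) := H.tendsto_curve zero_isBigO_norm
  have hWG : W =O[𝓝[≠] 0] fun z => G ‖z‖ :=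
    IsBigO.of_bound 1 (Eventually.of_forall fun z => by rw [norm_curve_zero, one_mul])
  set y : ℂ → ℂ := fun z => f₂ (W z, z) with hy
  have hyh : (fun z => y z - f₂ (0, z)) =O[𝓝[≠] 0] fun z => G ‖z‖ := (hf₂.sub_isBigO hW0).trans hWG
  have hy0 : Tendsto y (𝓝[≠] 0) (𝓝 0) := by
    have := hf₂.tendsto_curve H (τ := fun _ => 0) zero_isBigO_norm
    rwa [h2] at this
  -- On the curve with τ = 0 the equation of the model becomes ρ(z) G(|z|) = G(|y(z)|), with ρ → κ.
  set ρ : ℂ → ℝ := fun z => (k (W z, z) *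
    Complex.exp (((q ‖z‖ - q ‖y z‖ : ℝ) : ℂ) * Complex.I)).re with hρdef
  have hρG : ∀ᶠ z in 𝓝[≠] 0, ρ z * G ‖z‖ = G ‖y z‖ := by
    filter_upwards [curve_identity_mul H zero_isBigO_norm hN] with z hz
    simp only [Complex.ofReal_zero, mul_zero, zero_sub, neg_mul, Complex.neg_re,
      Complex.re_ofReal_mul, neg_inj] at hz
    rw [← hz, mul_comm]
  have hη0 : Tendsto (fun z => q ‖z‖ - q ‖y z‖) (𝓝[≠] 0) (𝓝 0) := by
    simpa using (H.tendsto_q hid).sub (H.tendsto_q hy0)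
  have hρ : Tendsto ρ (𝓝[≠] 0) (𝓝 κ) := by
    have h1 := (hk.tendsto_curve H (τ := fun _ => 0) zero_isBigO_norm).mul (tendsto_exp_mul_I hη0)
    have := (Complex.continuous_re.tendsto _).comp h1
    rw [mul_one] at this
    exact this
  -- radial behaviour of `y`
  set h : ℂ → ℂ := fun z => f₂ (0, z) with hh
  have hh0 : h 0 = 0 := h2
  set b := deriv h 0 with hbdef
  set D := dslope h 0 with hD
  have hDan : AnalyticAt ℂ D 0 := by
    obtain ⟨p, hp⟩ := hf₂.analyticAt
    exact ⟨_, hp.has_fpower_series_dslope_fslope⟩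
  have hD0 : D 0 = b := dslope_same _ _
  have hhD : ∀ z, h z = z * D z := by
    intro z
    have := sub_smul_dslope h 0 z
    simp only [sub_zero, smul_eq_mul, hh0] at this
    exact this.symm
  have hyz : Tendsto (fun z => ‖y z‖ / ‖z‖) (𝓝[≠] 0) (𝓝 ‖b‖) := by
    have h1 : Tendsto (fun z => (y z - h z) / z) (𝓝[≠] 0) (𝓝 0) := by
      have h3 : (fun z => (y z - h z) / z) =O[𝓝[≠] 0] fun z : ℂ => ‖z‖ := by
        have h4 := (isBigO_refl (fun z : ℂ => z⁻¹) (𝓝[≠] 0)).norm_right.mul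
          (hyh.trans (H.isFlat_G 2))
        refine h4.congr' (Eventually.of_forall fun z => by ring) ?_
        filter_upwards [self_mem_nhdsWithin] with z hz
        have hz : 0 < ‖z‖ := norm_pos_iff.2 hz
        rw [norm_inv]
        field_simp
      exact h3.trans_tendsto tendsto_norm_zero'
    have h5 := (h1.add (hDan.continuousAt.tendsto.mono_left nhdsWithin_le_nhds)).norm
    rw [zero_add, hD0] at h5
    refine h5.congr' ?_
    filter_upwards [self_mem_nhdsWithin] with z hz
    have hz : z ≠ 0 := hz
    rw [hhD z, ← norm_div]
    congr 1
    field_simp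
    ring
  have hbpos : 0 < ‖b‖ := norm_pos_iff.2 hb0
  have hypos : ∀ᶠ z in 𝓝[≠] 0, y z ≠ 0 := by
    filter_upwards [hyz.eventually (lt_mem_nhds hbpos)] with z hz h0
    rw [h0, norm_zero, zero_div] at hz
    exact lt_irrefl _ hz
  have hyG : ∀ᶠ z in 𝓝[≠] 0, 0 < G ‖y z‖ :=
    (tendsto_nhdsWithin_iff.2 ⟨hy0, hypos⟩).eventually H.G_pos'
  have hκpos : 0 < κ := by
    have h1 : 0 ≤ κ := by
      refine ge_of_tendsto hρ ?_
      filter_upwards [hρG, hyG, H.G_pos'] with z h1 h3 h4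
      rw [← h1] at h3
      exact (pos_of_mul_pos_left h3 h4.le).le
    refine h1.lt_of_ne fun h0 => hk0 ?_
    rw [hκ, ← h0, Complex.ofReal_zero]
  -- Continuity near 0, not only at 0, is needed for the intermediate value arguments on rays and
  -- circles.
  have hyc : ∀ᶠ z in 𝓝 0, ContinuousAt y z := by
    obtain ⟨r, hr, hsep⟩ := hf₂
    have hW00 : W 0 = 0 := by simp [hW, curve, H.G_zero]
    have hWc : ContinuousAt W 0 :=
      continuousWithinAt_compl_self.1 (by rw [ContinuousWithinAt, hW00]; exact hW0)
    have hpair : Tendsto (fun z => (W z, z)) (𝓝 0) (𝓝 (0 : ℂ × ℂ)) := by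
      have := hWc.tendsto.prodMk_nhds (tendsto_id (x := 𝓝 (0 : ℂ)))
      rwa [hW00] at this
    filter_upwards [H.eventually_continuousAt_q, H.eventually_continuousAt_G,
      hpair.eventually (isOpen_ball.mem_nhds (mem_ball_self hr))] with z h1 h3 h4
    have hWz : ContinuousAt W z :=
      ((Complex.continuous_ofReal.continuousAt.comp h1).mul continuousAt_const).cexp.mul
        (continuousAt_const.sub (Complex.continuous_ofReal.continuousAt.comp h3))
    exact ContinuousAt.comp (f := fun z => (W z, z))
      (hsep.cont.continuousAt (isOpen_ball.mem_nhds h4)) (hWz.prodMk continuousAt_id)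
  have hyz0 : y 0 = 0 := by
    have hW00 : W 0 = 0 := by simp [hW, curve, H.G_zero]
    simp only [hy, hW00]; exact hf20
  obtain ⟨r₀, hr₀, hyc⟩ := Metric.eventually_nhds_iff_ball.1 hyc
  have hray := tendsto_ray (one_ne_zero (α := ℂ))
  simp only [mul_one] at hray
  have hb1 : ‖b‖ = 1 := by
    refine H.tangent_to_id (Y := fun s : ℝ => ‖y s‖) (ρ := fun s : ℝ => ρ s) hbpos hκpos
      (by simp [hyz0]) ?_ ?_ (hρ.comp hray) ?_
    · filter_upwards [Ioo_mem_nhdsGT hr₀] with s hs t ht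
      refine ContinuousAt.continuousWithinAt (ContinuousAt.norm ?_)
      refine ContinuousAt.comp (f := fun s : ℝ => (s : ℂ)) (hyc _ ?_)
        Complex.continuous_ofReal.continuousAt
      rw [mem_ball_zero_iff, Complex.norm_real, Real.norm_of_nonneg ht.1]
      exact ht.2.trans_lt hs.2
    · refine (hyz.comp hray).congr' ?_
      filter_upwards [self_mem_nhdsWithin] with s hs
      have hs : (0 : ℝ) < s := hs
      simp [abs_of_pos hs]
    · filter_upwards [hray.eventually hρG, self_mem_nhdsWithin] with s h1 hs
      have hs : (0 : ℝ) < s := hs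
      simpa [abs_of_pos hs] using h1
  refine ⟨b, hb1, ?_⟩
  set u : ℂ → ℂ := fun z => b⁻¹ * D z - 1 with hu
  have huan : AnalyticAt ℂ u 0 := (analyticAt_const.mul hDan).sub analyticAt_const
  have hhu : ∀ z, h z = b * z * (1 + u z) := by
    intro z
    rw [hhD z, hu]
    field_simp
    ring
  -- If h is linear, then y - b z = O(G), which gives κ = 1, and k(0, ·) - κ is flat, hence zero.
  -- Otherwise u = z ^ m v with v(0) ≠ 0, and this must be refuted.
  by_cases htop : ∀ᶠ z in 𝓝 0, u z = 0
  · have hlin : ∀ᶠ z in 𝓝 0, h z = b * z := by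
      filter_upwards [htop] with z hz
      rw [hhu z, hz, add_zero, mul_one]
    have hκ1 : κ = 1 := by
      refine H.factor_eq_one hb1 (hyh.congr' ?_ EventuallyEq.rfl) hρ hρG
      filter_upwards [hlin.filter_mono nhdsWithin_le_nhds] with z hz
      change y z - h z = _
      rw [hz]
    refine ⟨?_, hlin⟩
    have han : AnalyticAt ℂ (fun z => k (0, z) - (κ : ℂ)) 0 := hk.analyticAt.sub analyticAt_const
    have hz := eventually_eq_zero_of_isBigO han
      (fun n => multiplier_sub_isBigO H hk hf₂ h2 hκ hflat hb1 (u := u) (n := n)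
        (EventuallyEq.trans_isBigO (htop.filter_mono nhdsWithin_le_nhds) (isBigO_zero _ _))
        (Eventually.of_forall hhu))
    filter_upwards [hz] with z hz
    rw [sub_eq_zero] at hz
    rw [hz, hκ1, Complex.ofReal_one]
  · exfalso
    rw [← analyticOrderAt_eq_top] at htop
    obtain ⟨v, hv, hv0, huv⟩ := huan.analyticOrderAt_ne_top.1 htop
    set m := analyticOrderNatAt u 0 with hm
    simp only [sub_zero, smul_eq_mul] at huv
    have hm0 : m ≠ 0 := by
      intro h0
      have h1 := huv.self_of_nhds
      simp only [h0, pow_zero, one_mul] at h1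
      refine hv0 (h1.symm.trans ?_)
      simp only [hu, hD0]
      field_simp
      ring
    have hvt : Tendsto v (𝓝[≠] 0) (𝓝 (v 0)) :=
      hv.continuousAt.tendsto.mono_left nhdsWithin_le_nhds
    have huO : u =O[𝓝[≠] 0] fun z => ‖z‖ ^ m := by
      have h1 : (fun z => z ^ m * v z) =O[𝓝[≠] 0] fun z => ‖z‖ ^ m * 1 :=
        IsBigO.mul (IsBigO.of_bound 1 (Eventually.of_forall fun z => by simp)) (hvt.isBigO_one ℝ)
      simp only [mul_one] at h1
      exact EventuallyEq.trans_isBigO (huv.filter_mono nhdsWithin_le_nhds) h1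
    have hyO : (fun z => y z - b * z * (1 + z ^ m * v z)) =O[𝓝[≠] 0] fun z => ‖z‖ ^ (m + 2) := by
      refine (hyh.trans (H.isFlat_G (m + 2))).congr' ?_ EventuallyEq.rfl
      filter_upwards [huv.filter_mono nhdsWithin_le_nhds] with z hz
      change y z - h z = _
      rw [hhu z, hz]
    set c := ‖v 0‖ with hc
    have hcpos : 0 < c := norm_pos_iff.2 hv0
    -- The map h moves points outwards along the direction d₁ and inwards along d₂, by about c s ^
    -- (m + 1).
    obtain ⟨d₁, hd₁, hdv₁⟩ := exists_unit_pow_mul_eq_norm hv0 hm0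
    obtain ⟨d₂, hd₂, hdv₂⟩ := exists_unit_pow_mul_eq_norm (neg_ne_zero.2 hv0) hm0
    have hdv₂' : d₂ ^ m * v 0 = ((-c : ℝ) : ℂ) := by
      rw [norm_neg, mul_neg] at hdv₂
      rw [Complex.ofReal_neg, ← hdv₂, neg_neg]
    have hout := radial_displacement hb1 hd₁ hvt hdv₁ hm0 hyO (half_pos hcpos)
    have hin := radial_displacement hb1 hd₂ hvt hdv₂' hm0 hyO (half_pos hcpos)
    have hsm : Tendsto (fun s : ℝ => c * s ^ m) (𝓝[>] 0) (𝓝 0) := by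
      have h1 : Continuous fun s : ℝ => c * s ^ m := by fun_prop
      have := h1.tendsto (0 : ℝ)
      simp only [zero_pow hm0, mul_zero] at this
      exact this.mono_left nhdsWithin_le_nhds
    have hd20 : d₂ ≠ 0 := by rintro rfl; simp at hd₂
    have hY : ∀ᶠ s : ℝ in 𝓝[>] 0, 0 < ‖y (s * d₂)‖ ∧ ‖y (s * d₂)‖ ≤ s * (1 - c / 2 * s ^ m) := by
      filter_upwards [hin, (tendsto_ray hd20).eventually hypos] with s h1 h3
      refine ⟨norm_pos_iff.2 h3, ?_⟩
      linarith [(abs_le.1 h1).2]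
    -- On each small circle |y| exceeds the radius in the direction d₁ and falls below it along d₂.
    -- By connectedness |y(z)| = |z| somewhere on the circle, and there ρ = 1 because G > 0.
    have hκ1 : κ = 1 := by
      have hfreq : ∃ᶠ z in 𝓝[≠] 0, ρ z = 1 := by
        rw [frequently_iff]
        intro U hU
        have hU' : {z | z ∈ U ∧ ρ z * G ‖z‖ = G ‖y z‖ ∧ 0 < G ‖z‖} ∈ 𝓝[≠] (0 : ℂ) := by
          filter_upwards [hU, hρG, H.G_pos'] with z h1 h3 h4 using ⟨h1, h3, h4⟩
        rw [mem_nhdsWithin_iff] at hU'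
        obtain ⟨ε, hε, hεU⟩ := hU'
        obtain ⟨s, h1, h3, h4, h5⟩ := (hout.and (hY.and (Ioo_mem_nhdsGT
          (show (0 : ℝ) < min ε r₀ by positivity)))).exists
        have hs0 : 0 < s := h4
        have hpos : 0 < s * s ^ m := by positivity
        have hcont : ContinuousOn (fun z => ‖y z‖) (sphere 0 s) := by
          intro z hz
          refine (hyc z ?_).norm.continuousWithinAt
          rw [mem_sphere_zero_iff_norm] at hz
          rw [mem_ball_zero_iff, hz]
          exact h5.trans_le (min_le_right _ _)
        have hmem : ∀ d : ℂ, ‖d‖ = 1 → (s : ℂ) * d ∈ sphere (0 : ℂ) s := by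
          intro d hd
          rw [mem_sphere_zero_iff_norm, norm_mul, hd, mul_one, Complex.norm_real,
            Real.norm_of_nonneg hs0.le]
        obtain ⟨z, hz, hzs⟩ := (isPreconnected_sphere_complex s).intermediate_value (hmem d₂ hd₂)
          (hmem d₁ hd₁) hcont (show s ∈ Icc _ _ from ⟨by nlinarith [h3.2], by
            nlinarith [(abs_le.1 h1).1]⟩)
        rw [mem_sphere_zero_iff_norm] at hz
        have hz0 : z ≠ 0 := by rintro rfl; simp at hz; exact hs0.ne hz
        obtain ⟨hzU, hz1, hz2⟩ := hεU ⟨by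
          rw [mem_ball_zero_iff, hz]; exact h5.trans_le (min_le_left _ _), hz0⟩
        refine ⟨z, hzU, ?_⟩
        have hzs' : ‖y z‖ = ‖z‖ := hzs.trans hz.symm
        rw [hzs'] at hz1
        exact mul_right_cancel₀ hz2.ne' (hz1.trans (one_mul _).symm)
      exact (isClosed_singleton (x := (1 : ℝ))).mem_of_frequently_of_tendsto hfreq hρ
    have hkO := multiplier_sub_isBigO H hk hf₂ h2 hκ hflat hb1 huO (Eventually.of_forall hhu)
    -- As κ = 1, the factor ρ differs from 1 by O(|z| ^ m) only, while along d₂ the modulus shrinks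
    -- by the relative amount (c / 2) s ^ m: the situation excluded by slow descent.
    have hρO : (fun z => ρ z - 1) =O[𝓝[≠] 0] fun z => ‖z‖ ^ m := by
      have hk1 : (fun z => k (W z, z) - 1) =O[𝓝[≠] 0] fun z => ‖z‖ ^ m := by
        refine (((hk.sub_isBigO hW0).trans (hWG.trans (H.isFlat_G m))).add hkO).congr_left
          fun z => ?_
        rw [hκ1, Complex.ofReal_one]; ring
      have hηO : (fun z => q ‖z‖ - q ‖y z‖) =O[𝓝[≠] 0] fun z => ‖z‖ ^ m := by
        refine (H.q_sub_isBigO hid hy0).trans ?_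
        have hbz : (fun z => b * z - y z) =O[𝓝[≠] 0] fun z => ‖z‖ ^ m := by
          have h3 : (fun z => b * z * u z) =O[𝓝[≠] 0] fun z => 1 * ‖z‖ ^ m := by
            refine IsBigO.mul ?_ huO
            simpa using (hid.const_mul b).isBigO_one ℝ
          simp only [one_mul] at h3
          refine ((hyh.trans (H.isFlat_G m)).add h3).neg_left.congr_left fun z => ?_
          change -(y z - h z + b * z * u z) = _
          rw [hhu z]; ring
        refine IsBigO.trans (IsBigO.of_bound 1 (Eventually.of_forall fun z => ?_)) hbz
        have := abs_norm_sub_norm_le (b * z) (y z)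
        rwa [norm_mul, hb1, one_mul, ← Real.norm_eq_abs, ← one_mul ‖b * z - y z‖] at this
      set e : ℂ → ℂ := fun z => Complex.exp (((q ‖z‖ - q ‖y z‖ : ℝ) : ℂ) * Complex.I) with he
      have heO : (fun z => e z - 1) =O[𝓝[≠] 0] fun z => ‖z‖ ^ m := by
        refine IsBigO.trans (IsBigO.of_bound 1 (Eventually.of_forall fun z => ?_)) hηO
        rw [one_mul, he]
        simp only
        rw [mul_comm _ Complex.I]
        exact Real.norm_exp_I_mul_ofReal_sub_one_le
      have h3 : (fun z => k (W z, z) * e z - 1) =O[𝓝[≠] 0] fun z => ‖z‖ ^ m := by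
        have h4 := hk1.mul ((tendsto_exp_mul_I hη0).isBigO_one ℝ)
        simp only [mul_one] at h4
        exact (h4.add heO).congr_left fun z => by simp only [he]; ring
      refine IsBigO.trans (IsBigO.of_bound 1 (Eventually.of_forall fun z => ?_)) h3
      have : ρ z - 1 = (k (W z, z) * e z - 1).re := by
        rw [Complex.sub_re, Complex.one_re]
      rw [this, one_mul]
      exact Complex.abs_re_le_norm _
    obtain ⟨C, hC⟩ := hρO.bound
    refine H.false_of_slow_descent (Y := fun s : ℝ => ‖y (s * d₂)‖)
      (ρ := fun s : ℝ => ρ (s * d₂)) (C := C) hm0 (half_pos hcpos) hY ?_ ?_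
    · filter_upwards [(tendsto_ray hd20).eventually hC, self_mem_nhdsWithin] with s h1 hs
      have hs : (0 : ℝ) < s := hs
      simp only [norm_mul, hd₂, mul_one, Complex.norm_real, Real.norm_of_nonneg hs.le,
        norm_pow] at h1
      linarith [(abs_le.1 h1).1]
    · filter_upwards [(tendsto_ray hd20).eventually hρG, self_mem_nhdsWithin] with s h1 hs
      have hs : (0 : ℝ) < s := hs
      simpa only [norm_mul, hd₂, mul_one, Complex.norm_real, Real.norm_of_nonneg hs.le] using h1

end

/-! ### The leading term of a map tangent to the identity along w = 0. -/

/-- Second differences separate the two frequencies of a trigonometric expression. -/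
theorem isFlat_of_trig {A B : ℂ → ℂ} (b : ℕ)
    (h : ∀ ψ : ℝ, |ψ| < Real.pi / 2 → IsFlat fun z =>
      (A z).re * Real.cos ((b + 2 : ℝ) * ψ) + (A z).im * Real.sin ((b + 2 : ℝ) * ψ)
        - ((B z).re * Real.cos (b * ψ) + (B z).im * Real.sin (b * ψ)) / 2) :
    IsFlat A ∧ IsFlat fun z => (B z).re := by
  set a : ℝ := b + 2 with ha
  have ha2 : 2 ≤ a := by rw [ha]; linarith [Nat.cast_nonneg (α := ℝ) b]
  have ha0 : 0 < a := by linarith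
  -- Then a δ = π / 4, which separates cos (a δ) from cos (b δ) and keeps the angles 0 and δ, with
  -- their translates by ± δ, inside (-π/2, π/2).
  set δ := Real.pi / (4 * a) with hδ
  have hδ0 : 0 < δ := by positivity
  have haδ : a * δ = Real.pi / 4 := by rw [hδ]; field_simp
  have hδle : 2 * δ < Real.pi / 2 := by nlinarith [Real.pi_pos]
  have hcos : Real.cos (a * δ) < Real.cos (b * δ) := by
    refine Real.cos_lt_cos_of_nonneg_of_le_pi_div_two (by positivity) ?_ ?_
    · rw [haδ]; linarith [Real.pi_pos]
    · rw [ha]; nlinarith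
  set c := 2 * (Real.cos (a * δ) - Real.cos (b * δ)) with hc
  have hc0 : c ≠ 0 := by rw [hc]; intro h0; linarith
  -- Adding the values at ψ + δ and ψ - δ multiplies the two frequencies by 2 cos (a δ) and 2 cos (b
  -- δ); subtracting 2 cos (b δ) times the value at ψ removes the lower one. The angle ψ = 0 then
  -- isolates Re A, and ψ = δ isolates Im A.
  have hkey : ∀ ψ : ℝ, |ψ| < Real.pi / 2 → |ψ + δ| < Real.pi / 2 → |ψ - δ| < Real.pi / 2 →
      IsFlat fun z => (A z).re * Real.cos (a * ψ) + (A z).im * Real.sin (a * ψ) := by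
    intro ψ h1 h2 h3 n
    have h4 := ((((h _ h2).add (h _ h3)) n).sub ((h _ h1 n).const_mul_left
      (2 * Real.cos (b * δ)))).const_mul_left c⁻¹
    refine h4.congr_left fun z => ?_
    rw [inv_mul_eq_iff_eq_mul₀ hc0, hc]
    simp only [mul_add, mul_sub, Real.cos_add, Real.sin_add, Real.cos_sub, Real.sin_sub]
    ring
  have hp2 : (0 : ℝ) < Real.pi / 2 := by positivity
  have hre : IsFlat fun z => (A z).re := by
    have := hkey 0 (by simpa using hp2) (by rw [zero_add, abs_of_pos hδ0]; linarith)
      (by rw [zero_sub, abs_neg, abs_of_pos hδ0]; linarith)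
    simpa using this
  have him : IsFlat fun z => (A z).im := by
    have h1 := hkey δ (by rw [abs_of_pos hδ0]; linarith)
      (by rw [abs_of_pos (by linarith)]; linarith) (by simpa using hp2)
    rw [haδ, Real.cos_pi_div_four, Real.sin_pi_div_four] at h1
    intro n
    have h2 := ((h1 n).const_mul_left (Real.sqrt 2 / 2)⁻¹).sub (hre n)
    refine h2.congr_left fun z => ?_
    have : Real.sqrt 2 / 2 ≠ 0 := by positivity
    field_simp
    ring
  refine ⟨fun n => ?_, ?_⟩
  · have h1 : A =O[𝓝[≠] 0] fun z => |(A z).re| + |(A z).im| :=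
      IsBigO.of_bound 1 (Eventually.of_forall fun z => by
        rw [one_mul, Real.norm_of_nonneg (by positivity)]
        exact Complex.norm_le_abs_re_add_abs_im _)
    exact h1.trans ((hre n).abs_left.add (him n).abs_left)
  · intro n
    have h1 := ((hre.sub (h 0 (by simpa using hp2))) n).const_mul_left 2
    refine h1.congr_left fun z => ?_
    simp only [mul_zero, Real.cos_zero, Real.sin_zero]
    ring

/-- Put x = tan ψ, so that x i - 1 = -e^{-iψ} / cos ψ, and multiply by (-cos ψ) ^ (j + 1). The
products of cos ψ and sin ψ with frequency j split into frequencies j + 1 and j - 1. The coefficient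
of the first is K - (γ + iκ) Λ / 2, that of the second is a multiple of (γ - iκ) Λ, of which only
the real part is recovered. The condition j ≥ 1 makes j - 1 a natural number. -/
theorem isFlat_of_pencil {K Λ : ℂ → ℂ} {γ κ : ℂ → ℝ} {j : ℕ} (hj : j ≠ 0)
    (h : ∀ x : ℝ, IsFlat fun z => ((x * Complex.I - 1) ^ (j + 1) * K z).re
      + (x * κ z + γ z) * ((x * Complex.I - 1) ^ j * Λ z).re) :
    (IsFlat fun z => K z - (γ z + κ z * Complex.I) * Λ z / 2) ∧
      IsFlat fun z => γ z * (Λ z).re + κ z * (Λ z).im := by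
  obtain ⟨b, rfl⟩ := Nat.exists_eq_succ_of_ne_zero hj
  have hmain := isFlat_of_trig (A := fun z => K z - (γ z + κ z * Complex.I) * Λ z / 2)
    (B := fun z => (γ z - κ z * Complex.I) * Λ z) b ?_
  · refine ⟨hmain.1, ?_⟩
    have := hmain.2
    simpa using this
  intro ψ hψ n
  have hcos : 0 < Real.cos ψ := Real.cos_pos_of_mem_Ioo ⟨by linarith [(abs_lt.1 hψ).1],
    (abs_lt.1 hψ).2⟩
  have hω : ((Real.tan ψ : ℝ) : ℂ) * Complex.I - 1
      = ((-(Real.cos ψ)⁻¹ : ℝ) : ℂ) * Complex.exp (((-ψ : ℝ) : ℂ) * Complex.I) := by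
    have hc : (Real.cos ψ : ℂ) ≠ 0 := by exact_mod_cast hcos.ne'
    rw [Real.tan_eq_sin_div_cos, Complex.exp_mul_I, ← Complex.ofReal_cos, ← Complex.ofReal_sin,
      Real.cos_neg, Real.sin_neg]
    push_cast
    rw [← Complex.ofReal_cos, ← Complex.ofReal_sin]
    field_simp
    ring
  have hpow : ∀ m : ℕ, (((Real.tan ψ : ℝ) : ℂ) * Complex.I - 1) ^ m
      = (((-(Real.cos ψ)⁻¹) ^ m : ℝ) : ℂ) *
        Complex.exp (((-(m * ψ) : ℝ) : ℂ) * Complex.I) := by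
    intro m
    rw [hω, mul_pow, ← Complex.exp_nat_mul]
    push_cast
    congr 2
    ring
  have h1 := (h (Real.tan ψ) n).const_mul_left ((-Real.cos ψ) ^ (b + 2))
  refine h1.congr_left fun z => ?_
  have e1 : (-Real.cos ψ) ^ (b + 2) * (-(Real.cos ψ)⁻¹) ^ (b + 1 + 1) = 1 := by
    rw [show b + 1 + 1 = b + 2 from rfl, ← mul_pow, neg_mul_neg, mul_inv_cancel₀ hcos.ne', one_pow]
  have e2 : (-Real.cos ψ) ^ (b + 2) * (-(Real.cos ψ)⁻¹) ^ (b + 1) = -Real.cos ψ := by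
    rw [pow_succ, mul_right_comm, ← mul_pow, neg_mul_neg, mul_inv_cancel₀ hcos.ne', one_pow,
      one_mul]
  have htan : Real.cos ψ * Real.tan ψ = Real.sin ψ := by
    rw [mul_comm]; exact Real.tan_mul_cos hcos.ne'
  have hK := hpow (b + 1 + 1)
  have hL := hpow (b + 1)
  simp only [Nat.succ_eq_add_one] at *
  rw [hK, hL, mul_assoc, Complex.re_ofReal_mul, mul_assoc, Complex.re_ofReal_mul]
  have hgoal : ∀ P Q : ℝ, (-Real.cos ψ) ^ (b + 2) * ((-(Real.cos ψ)⁻¹) ^ (b + 1 + 1) * P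
      + (Real.tan ψ * κ z + γ z) * ((-(Real.cos ψ)⁻¹) ^ (b + 1) * Q))
      = P - (Real.sin ψ * κ z + Real.cos ψ * γ z) * Q := by
    intro P Q
    calc _ = ((-Real.cos ψ) ^ (b + 2) * (-(Real.cos ψ)⁻¹) ^ (b + 1 + 1)) * P
          + ((-Real.cos ψ) ^ (b + 2) * (-(Real.cos ψ)⁻¹) ^ (b + 1)) *
            (Real.tan ψ * κ z + γ z) * Q := by ring
      _ = P - (Real.cos ψ * Real.tan ψ * κ z + Real.cos ψ * γ z) * Q := by rw [e1, e2]; ring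
      _ = _ := by rw [htan]
  rw [hgoal]
  have hm2 : ((b + 1 + 1 : ℕ) : ℝ) * ψ = (b + 1 : ℝ) * ψ + ψ := by push_cast; ring
  have hm1 : ((b + 1 : ℕ) : ℝ) * ψ = (b + 1 : ℝ) * ψ := by push_cast; ring
  have hm3 : ((b : ℝ) + 2) * ψ = (b + 1 : ℝ) * ψ + ψ := by ring
  have hm4 : (b : ℝ) * ψ = (b + 1 : ℝ) * ψ - ψ := by ring
  rw [hm2, hm1, hm3, hm4]
  set X := (b + 1 : ℝ) * ψ
  simp only [Complex.mul_re, Complex.mul_im, Complex.sub_re, Complex.sub_im, Complex.add_re,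
    Complex.add_im, Complex.exp_ofReal_mul_I_re, Complex.exp_ofReal_mul_I_im, Complex.ofReal_re,
    Complex.ofReal_im, Complex.I_re, Complex.I_im, Complex.div_ofNat_re, Complex.div_ofNat_im,
    Real.cos_neg, Real.sin_neg]
  simp only [Real.cos_add, Real.sin_add, Real.cos_sub, Real.sin_sub]
  ring

/-- First-order expansion of the modulus. -/
theorem abs_norm_add_sub_le {z : ℂ} (hz : z ≠ 0) (h : ℂ) :
    |‖z + h‖ - ‖z‖ - (h * (starRingEnd ℂ) z).re / ‖z‖| ≤ 2 * ‖h‖ ^ 2 / ‖z‖ := by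
  have hs : 0 < ‖z‖ := norm_pos_iff.2 hz
  set s := ‖z‖ with hsdef
  set N := ‖z + h‖ with hN
  set c := (h * (starRingEnd ℂ) z).re / s with hc
  have hcs : c * s = (h * (starRingEnd ℂ) z).re := by rw [hc]; field_simp
  have hsq : N ^ 2 = s ^ 2 + 2 * (c * s) + ‖h‖ ^ 2 := by
    rw [hcs, hN, hsdef, ← Complex.normSq_eq_norm_sq, ← Complex.normSq_eq_norm_sq,
      ← Complex.normSq_eq_norm_sq, Complex.normSq_add]
    simp only [Complex.mul_re, Complex.conj_re, Complex.conj_im]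
    ring
  have hcle : |c| ≤ ‖h‖ := by
    rw [hc, abs_div, abs_of_pos hs, div_le_iff₀ hs]
    refine (Complex.abs_re_le_norm _).trans ?_
    rw [norm_mul, Complex.norm_conj]
  have hNs : |N - s| ≤ ‖h‖ := by
    have := abs_norm_sub_norm_le (z + h) z
    rwa [add_sub_cancel_left] at this
  have hN0 : 0 ≤ N := norm_nonneg _
  -- Multiplying by N + s replaces the expansion of a square root by the exact formula for N ^ 2.
  have hprod : (N - s - c) * (N + s) = c * (s - N) + ‖h‖ ^ 2 := by nlinarith
  have habs : |N - s - c| * (N + s) ≤ 2 * ‖h‖ ^ 2 := by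
    rw [← abs_of_nonneg (show 0 ≤ N + s by linarith), ← abs_mul, hprod]
    refine (abs_add_le _ _).trans ?_
    rw [abs_mul, abs_sub_comm s N, abs_of_nonneg (sq_nonneg ‖h‖)]
    nlinarith [mul_le_mul hcle hNs (abs_nonneg _) (norm_nonneg _)]
  rw [le_div_iff₀ hs]
  nlinarith [abs_nonneg (N - s - c)]

section
variable {G G' q q' : ℝ → ℝ} {k l : ℂ × ℂ → ℂ}

theorem Profile.q'_isBigO_one (H : Profile G G' q q') :
    (fun z : ℂ => q' ‖z‖) =O[𝓝[≠] 0] fun _ => (1 : ℝ) := by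
  obtain ⟨C, δ, hC, hδ, h⟩ := H.q_taylor
  refine IsBigO.of_bound C ?_
  filter_upwards [tendsto_norm_zero'.eventually (gt_mem_nhds hδ)] with z hz
  rw [norm_one, mul_one]
  exact (h _ ⟨norm_nonneg _, hz⟩).1

theorem Profile.q_taylor_isBigO (H : Profile G G' q q') {y : ℂ → ℂ}
    (hy : Tendsto y (𝓝[≠] 0) (𝓝 0)) :
    (fun z => q ‖y z‖ - q ‖z‖ - q' ‖z‖ * (‖y z‖ - ‖z‖)) =O[𝓝[≠] 0]
      fun z => (‖y z‖ - ‖z‖) ^ 2 := by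
  obtain ⟨C, δ, hC, hδ, h⟩ := H.q_taylor
  refine IsBigO.of_bound C ?_
  filter_upwards [tendsto_norm_zero'.eventually (gt_mem_nhds hδ),
    (tendsto_norm_comp hy).eventually (gt_mem_nhds hδ)] with z hz1 hz2
  rw [Real.norm_of_nonneg (sq_nonneg (‖y z‖ - ‖z‖))]
  exact ((h _ ⟨norm_nonneg _, hz1⟩).2 _ ⟨norm_nonneg _, hz2⟩).2

theorem Profile.isFlat_div_norm {u : ℂ → ℝ} (hu : IsFlat u) : IsFlat fun z => u z / ‖z‖ := by
  refine IsFlat.of_pow_mul (m := 1) (hu.congr' ?_)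
  filter_upwards [self_mem_nhdsWithin] with z hz
  have hz : 0 < ‖z‖ := norm_pos_iff.2 hz
  field_simp

theorem isBigO_re {u : ℂ → ℂ} {v : ℂ → ℝ} {l : Filter ℂ} (h : u =O[l] v) :
    (fun z => (u z).re) =O[l] v :=
  (IsBigO.of_bound 1 (Eventually.of_forall fun z => by
    rw [one_mul]; exact Complex.abs_re_le_norm _)).trans h

theorem exp_sub_one_sub_isBigO {η : ℂ → ℝ} (hη : Tendsto η (𝓝[≠] 0) (𝓝 0)) :
    (fun z => Complex.exp ((η z : ℂ) * Complex.I) - 1 - (η z : ℂ) * Complex.I) =O[𝓝[≠] 0]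
      fun z => η z ^ 2 := by
  refine IsBigO.of_bound 1 ?_
  have h1 : ∀ᶠ z in 𝓝[≠] 0, |η z| < 1 := by
    have := hη.abs
    rw [abs_zero] at this
    exact this.eventually (gt_mem_nhds one_pos)
  filter_upwards [h1] with z hz
  refine (Complex.norm_exp_sub_one_sub_id_le ?_).trans ?_
  · rw [norm_mul, Complex.norm_I, mul_one, Complex.norm_real]; exact hz.le
  · rw [norm_mul, Complex.norm_I, mul_one, Complex.norm_real, one_mul, norm_pow]

/-- The leading term of the defining equation for a map tangent to the identity to order `j`
in `w`, evaluated at `w = e^{iq} G (x i - 1)`. -/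
theorem isFlat_leading_term (H : Profile G G' q q') (hk : IsSep k) (hl : IsSep l) {j : ℕ}
    (hj : j ≠ 0) (hN : ∀ᶠ p in 𝓝 (0 : ℂ × ℂ), p ∈ Model G q →
      (p.1 * (1 + p.1 ^ j * k p), p.2 + p.1 ^ j * l p) ∈ Model G q) (x : ℝ) :
    IsFlat fun z => ((x * Complex.I - 1) ^ (j + 1) *
        (Complex.exp ((q ‖z‖ : ℂ) * Complex.I) ^ j * k (0, z))).re
      + (x * q' ‖z‖ + G' ‖z‖ / G ‖z‖) * ((x * Complex.I - 1) ^ j *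
        (Complex.exp ((q ‖z‖ : ℂ) * Complex.I) ^ j * l (0, z) *
          (starRingEnd ℂ) z / ‖z‖)).re := by
  have hid : Tendsto (fun z : ℂ => z) (𝓝[≠] 0) (𝓝 0) := tendsto_id.mono_left nhdsWithin_le_nhds
  set g : ℂ → ℝ := fun z => G ‖z‖ with hg
  set Ω : ℂ := x * Complex.I - 1 with hΩ
  set e : ℂ → ℂ := fun z => Complex.exp ((q ‖z‖ : ℂ) * Complex.I) with he
  have henorm : ∀ z, ‖e z‖ = 1 := fun z => Complex.norm_exp_ofReal_mul_I _
  have hgflat : IsFlat g := H.isFlat_G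
  -- With τ proportional to G the curve is w = g Ω e, so every power of w is an explicit power of g
  -- times a bounded factor.
  set τ : ℂ → ℝ := fun z => x * g z with hτdef
  have hτ : τ =O[𝓝[≠] 0] fun z => ‖z‖ := by
    simpa using (hgflat 1).const_mul_left x
  have hW0 := H.tendsto_curve hτ
  have hk0 := (hk.tendsto_curve H hτ).isBigO_one ℝ
  have hl0 := (hl.tendsto_curve H hτ).isBigO_one ℝ
  have hkd := hk.sub_isBigO hW0
  have hld := hl.sub_isBigO hW0
  have hid' := curve_identity_mul (k := fun p => 1 + p.1 ^ j * k p) (f₂ := fun p => p.2 + p.1 ^ j * l p)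
    H hτ hN
  have hWeq : ∀ z, curve G q τ z = (g z : ℂ) * (Ω * e z) := by
    intro z
    rw [curve, hΩ]
    simp only [he, hτdef, hg]
    push_cast
    ring
  set W := curve G q τ with hW
  have hWg : W =O[𝓝[≠] 0] g := by
    refine IsBigO.of_bound ‖Ω‖ (Eventually.of_forall fun z => ?_)
    rw [hWeq, norm_mul, norm_mul, henorm, mul_one, Complex.norm_real, mul_comm]
  have hWj : ∀ z, W z ^ j = ((g z ^ j : ℝ) : ℂ) * (Ω ^ j * e z ^ j) := by
    intro z; rw [hWeq, mul_pow, mul_pow, Complex.ofReal_pow]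
  have hkd := hkd.trans hWg
  have hld := hld.trans hWg
  set gj : ℂ → ℝ := fun z => g z ^ j with hgj
  have hWjO : (fun z => W z ^ j) =O[𝓝[≠] 0] gj := hWg.pow j
  have hgjg : gj =O[𝓝[≠] 0] g := by
    obtain ⟨i, hi⟩ := Nat.exists_eq_succ_of_ne_zero hj
    have h1 := (isBigO_refl g (𝓝[≠] 0)).mul ((hgflat.tendsto_zero.pow i).isBigO_one ℝ)
    simp only [mul_one] at h1
    exact h1.congr_left fun z => by rw [hgj, hi]; simp only [pow_succ]; ring
  have hsinv : (fun _ : ℂ => (1 : ℝ)) =O[𝓝[≠] 0] fun z => 1 / ‖z‖ := by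
    refine IsBigO.of_bound 1 ?_
    filter_upwards [self_mem_nhdsWithin, tendsto_norm_zero'.eventually (gt_mem_nhds one_pos)]
      with z hz hz1
    have hz : 0 < ‖z‖ := norm_pos_iff.2 hz
    rw [norm_one, one_mul, Real.norm_of_nonneg (by positivity)]
    exact (one_le_div₀ hz).2 hz1.le
  -- `m = g / |z|` measures the relative errors
  set m : ℂ → ℝ := fun z => g z / ‖z‖ with hm
  have hgm : g =O[𝓝[≠] 0] m := by
    have h1 := (isBigO_refl g (𝓝[≠] 0)).mul hsinv
    exact h1.congr (fun z => mul_one _) fun z => by rw [hm]; ring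
  set Y : ℂ → ℂ := fun z => z + W z ^ j * l (W z, z) with hY
  have hWjl : (fun z => W z ^ j * l (W z, z)) =O[𝓝[≠] 0] gj := by simpa using hWjO.mul hl0
  have hgj0 : Tendsto gj (𝓝[≠] 0) (𝓝 0) := hgjg.trans_tendsto hgflat.tendsto_zero
  have hY0 : Tendsto Y (𝓝[≠] 0) (𝓝 0) := by
    simpa using hid.add (hWjl.trans_tendsto hgj0)
  set D : ℂ → ℝ := fun z => ‖Y z‖ - ‖z‖ with hD
  have hDO : D =O[𝓝[≠] 0] gj := by
    refine IsBigO.trans (IsBigO.of_bound 1 (Eventually.of_forall fun z => ?_)) hWjl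
    have := abs_norm_sub_norm_le (Y z) z
    rw [hY, add_sub_cancel_left] at this
    rwa [one_mul]
  -- To first order the modulus of z changes by g ^ j δ; the error is O(g ^ j · g / |z|).
  set δ : ℂ → ℝ := fun z =>
    (Ω ^ j * (e z ^ j * l (0, z) * (starRingEnd ℂ) z / ‖z‖)).re with hδ
  have hdir : ∀ᶠ z : ℂ in 𝓝[≠] 0, ‖(starRingEnd ℂ) z / (‖z‖ : ℂ)‖ = 1 := by
    filter_upwards [self_mem_nhdsWithin] with z hz
    have hz : 0 < ‖z‖ := norm_pos_iff.2 hz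
    rw [norm_div, Complex.norm_conj, Complex.norm_real, norm_norm, div_self hz.ne']
  have hdirO : (fun z : ℂ => (starRingEnd ℂ) z / (‖z‖ : ℂ)) =O[𝓝[≠] 0] fun _ => (1 : ℝ) :=
    IsBigO.of_bound 1 (hdir.mono fun z hz => by rw [hz]; simp)
  have hgjm : (fun z => gj z * g z) =O[𝓝[≠] 0] fun z => gj z * m z := (isBigO_refl _ _).mul hgm
  have hgj2 : (fun z => gj z * gj z) =O[𝓝[≠] 0] fun z => gj z * g z := (isBigO_refl _ _).mul hgjg
  have hD1 : (fun z => D z - gj z * δ z) =O[𝓝[≠] 0] fun z => gj z * m z := by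
    have h1 : (fun z => D z - (W z ^ j * l (W z, z) * (starRingEnd ℂ) z).re / ‖z‖) =O[𝓝[≠] 0]
        fun z => gj z * m z := by
      have h2 : (fun z => D z - (W z ^ j * l (W z, z) * (starRingEnd ℂ) z).re / ‖z‖) =O[𝓝[≠] 0]
          fun z => ‖W z ^ j * l (W z, z)‖ * ‖W z ^ j * l (W z, z)‖ * (1 / ‖z‖) := by
        refine IsBigO.of_bound 2 ?_
        filter_upwards [self_mem_nhdsWithin] with z hz
        have := abs_norm_add_sub_le hz (W z ^ j * l (W z, z))
        refine this.trans_eq ?_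
        rw [Real.norm_of_nonneg (by positivity)]
        ring
      refine h2.trans ((((hWjl.norm_left.mul hWjl.norm_left).trans hgj2).mul
        (isBigO_refl (fun z : ℂ => 1 / ‖z‖) _)).congr_right fun z => ?_)
      simp only [hm]; ring
    have h3 : (fun z => (W z ^ j * l (W z, z) * (starRingEnd ℂ) z).re / ‖z‖ - gj z * δ z)
        =O[𝓝[≠] 0] fun z => gj z * g z := by
      have h4 : (fun z => W z ^ j * (l (W z, z) - l (0, z)) * ((starRingEnd ℂ) z / (‖z‖ : ℂ)))
          =O[𝓝[≠] 0] fun z => gj z * g z := by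
        simpa using (hWjO.mul hld).mul hdirO
      refine (isBigO_re h4).congr_left fun z => ?_
      rw [← Complex.div_ofReal_re, hδ, ← Complex.re_ofReal_mul, ← Complex.sub_re, hWj]
      congr 1
      ring
    exact (h1.add (h3.trans hgjm)).congr_left fun z => by ring
  set η : ℂ → ℝ := fun z => q ‖z‖ - q ‖Y z‖ with hη
  have hηO : η =O[𝓝[≠] 0] gj := by
    refine (H.q_sub_isBigO hid hY0).trans (hDO.neg_left.congr_left fun z => ?_)
    simp only [hD]; ring
  have hη0 : Tendsto η (𝓝[≠] 0) (𝓝 0) := hηO.trans_tendsto hgj0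
  have hη1 : (fun z => η z + q' ‖z‖ * D z) =O[𝓝[≠] 0] fun z => gj z * m z := by
    have h1 : (fun z => D z ^ 2) =O[𝓝[≠] 0] fun z => gj z * gj z :=
      (hDO.mul hDO).congr_left fun z => (sq _).symm
    refine (((H.q_taylor_isBigO hY0).trans h1).neg_left.trans (hgj2.trans hgjm)).congr_left
      fun z => ?_
    simp only [hη, hD]; ring
  set E : ℂ → ℂ := fun z => Complex.exp ((η z : ℂ) * Complex.I) with hE
  have hE1 : (fun z => E z - 1 - (η z : ℂ) * Complex.I) =O[𝓝[≠] 0] fun z => gj z * m z := by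
    have h1 : (fun z => η z ^ 2) =O[𝓝[≠] 0] fun z => gj z * gj z :=
      (hηO.mul hηO).congr_left fun z => (sq _).symm
    exact (exp_sub_one_sub_isBigO hη0).trans (h1.trans (hgj2.trans hgjm))
  have hE0 : (fun z => E z - 1) =O[𝓝[≠] 0] gj := by
    refine IsBigO.trans (IsBigO.of_bound 1 (Eventually.of_forall fun z => ?_)) hηO
    rw [one_mul, hE]
    simp only
    rw [mul_comm _ Complex.I]
    exact Real.norm_exp_I_mul_ofReal_sub_one_le
  -- The phase factor is 1 - i q' g ^ j δ up to the same error.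
  have hT : (fun z => E z - 1 + ((q' ‖z‖ * (gj z * δ z) : ℝ) : ℂ) * Complex.I) =O[𝓝[≠] 0]
      fun z => gj z * m z := by
    have h1 : (fun z => q' ‖z‖ * (D z - gj z * δ z)) =O[𝓝[≠] 0] fun z => gj z * m z := by
      simpa using H.q'_isBigO_one.mul hD1
    have h2 : (fun z => (((η z + q' ‖z‖ * D z) - q' ‖z‖ * (D z - gj z * δ z) : ℝ) : ℂ) * Complex.I)
        =O[𝓝[≠] 0] fun z => gj z * m z := by
      refine IsBigO.trans (IsBigO.of_bound 1 (Eventually.of_forall fun z => ?_)) (hη1.sub h1)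
      rw [norm_mul, Complex.norm_I, mul_one, one_mul, Complex.norm_real]
    refine (hE1.add h2).congr_left fun z => ?_
    push_cast
    ring
  set X : ℂ → ℂ := fun z => W z ^ j * k (W z, z) with hX
  have hXO : X =O[𝓝[≠] 0] gj := by simpa using hWjO.mul hk0
  have hX1 : (fun z => X z - W z ^ j * k (0, z)) =O[𝓝[≠] 0] fun z => gj z * m z :=
    ((hWjO.mul hkd).trans hgjm).congr_left fun z => by simp only [hX]; ring
  have hErr : (fun z => Ω * (X z - W z ^ j * k (0, z)) + Ω * (E z - 1
      + ((q' ‖z‖ * (gj z * δ z) : ℝ) : ℂ) * Complex.I) + Ω * (X z * (E z - 1))) =O[𝓝[≠] 0]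
      fun z => gj z * m z :=
    ((hX1.const_mul_left Ω).add (hT.const_mul_left Ω)).add
      (((hXO.mul hE0).trans (hgj2.trans hgjm)).const_mul_left Ω)
  set Err : ℂ → ℂ := fun z => Ω * (X z - W z ^ j * k (0, z)) + Ω * (E z - 1
      + ((q' ‖z‖ * (gj z * δ z) : ℝ) : ℂ) * Complex.I) + Ω * (X z * (E z - 1)) with hErrdef
  intro n
  have hmn : m =O[𝓝[≠] 0] fun z => ‖z‖ ^ n := Profile.isFlat_div_norm hgflat n
  have hErr' : (fun z => g z * (Err z).re) =O[𝓝[≠] 0] fun z => gj z * g z * ‖z‖ ^ n := by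
    refine ((isBigO_refl g _).mul ((isBigO_re hErr).trans ((isBigO_refl gj _).mul hmn))).congr_right
      fun z => ?_
    ring
  -- Errors here must be flat relative to g ^ (j + 1). The second-order term is, because the Taylor
  -- constant of G is O(s ^ n), and so is the error of the modulus, because it is multiplied by the
  -- flat G'.
  have hGY : (fun z => G ‖Y z‖ - g z - G' ‖z‖ * (gj z * δ z)) =O[𝓝[≠] 0]
      fun z => gj z * g z * ‖z‖ ^ n := by
    have h1 : (fun z => G ‖Y z‖ - g z - G' ‖z‖ * D z) =O[𝓝[≠] 0] fun z => gj z * g z * ‖z‖ ^ n := by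
      have hDs : ∀ᶠ z in 𝓝[≠] 0, |D z| ≤ ‖z‖ := by
        have h2 : D =O[𝓝[≠] 0] fun z => ‖z‖ ^ 2 := hDO.trans (hgjg.trans (hgflat 2))
        have h3 : (fun z : ℂ => ‖z‖ ^ 2) =o[𝓝[≠] 0] fun z : ℂ => ‖z‖ := by
          have := ((isLittleO_one_iff ℝ).2 tendsto_norm_zero').mul_isBigO
            (isBigO_refl (fun z : ℂ => ‖z‖) (𝓝[≠] 0))
          simp only [one_mul] at this
          exact this.congr_left fun z => (sq _).symm
        filter_upwards [(h2.trans_isLittleO h3).bound one_pos] with z hz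
        simpa using hz
      have h4 : (fun z => G ‖Y z‖ - g z - G' ‖z‖ * D z) =O[𝓝[≠] 0] fun z => ‖z‖ ^ n * (D z * D z) := by
        refine IsBigO.of_bound 1 ?_
        filter_upwards [hDs, tendsto_norm_pnhds.eventually (H.G_taylor n)] with z h5 h6
        have := h6 ‖Y z‖ h5
        rw [one_mul, Real.norm_of_nonneg (mul_nonneg (by positivity) (mul_self_nonneg _)),
          ← sq (D z)]
        exact this
      refine h4.trans (((isBigO_refl (fun z : ℂ => ‖z‖ ^ n) _).mul
        ((hDO.mul hDO).trans hgj2)).congr_right fun z => ?_)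
      ring
    have h7 : (fun z => G' ‖z‖ * (D z - gj z * δ z)) =O[𝓝[≠] 0] fun z => gj z * g z * ‖z‖ ^ n := by
      have h8 := (isBigO_refl (fun z : ℂ => G' ‖z‖) (𝓝[≠] 0)).mul hD1
      refine h8.trans ?_
      refine (((isBigO_refl (fun z => gj z * g z) _).mul
        (Profile.isFlat_div_norm H.isFlat_G' n))).congr_left fun z => ?_
      simp only [hm]; ring
    exact (h1.add h7).congr_left fun z => by ring
  -- Since Re Ω = -1, the terms of order g cancel in the equation; what remains has order g ^ (j +
  -- 1), and is divided by it at the end.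
  have hsum : (fun z => gj z * g z * (((Ω ^ (j + 1) * (e z ^ j * k (0, z))).re
      + (x * q' ‖z‖ + G' ‖z‖ / g z) * δ z))) =O[𝓝[≠] 0] fun z => gj z * g z * ‖z‖ ^ n := by
    refine (hGY.neg_left.sub hErr').congr' ?_ EventuallyEq.rfl
    filter_upwards [hid', H.G_pos'] with z h1 h2
    have h2 : 0 < g z := h2
    have h3 : (Complex.I * (τ z : ℂ) - (G ‖z‖ : ℂ)) = (g z : ℂ) * Ω := by
      simp only [hτdef, hg, hΩ]; push_cast; ring
    have h4 : (g z : ℂ) * Ω * ((1 + X z) * E z) = (g z : ℂ) * (Ω + ((gj z : ℝ) : ℂ) *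
        (Ω ^ (j + 1) * (e z ^ j * k (0, z))) - ((q' ‖z‖ * (gj z * δ z) : ℝ) : ℂ) * (Ω * Complex.I)
        + Err z) := by
      have h5 := hWj z
      simp only [hErrdef]
      rw [h5]
      ring
    rw [h3] at h1
    have h6 : ((g z : ℂ) * Ω * ((1 + X z) * E z)).re = -G ‖Y z‖ := h1
    rw [h4, Complex.re_ofReal_mul, Complex.add_re, Complex.sub_re, Complex.add_re,
      Complex.re_ofReal_mul, Complex.re_ofReal_mul] at h6
    have hΩre : Ω.re = -1 := by simp [hΩ]
    have hΩI : (Ω * Complex.I).re = -x := by simp [hΩ]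
    rw [hΩre, hΩI] at h6
    have hdiv : g z * (G' ‖z‖ / g z) = G' ‖z‖ := by field_simp
    linear_combination -h6 - gj z * δ z * hdiv
  have hfin := ((isBigO_refl (fun z => (gj z * g z)⁻¹) (𝓝[≠] 0)).mul hsum)
  refine hfin.congr' ?_ ?_
  · filter_upwards [H.G_pos'] with z h2
    have h2 : 0 < g z := h2
    have h3 : gj z * g z ≠ 0 := by simp only [hgj]; positivity
    rw [inv_mul_cancel_left₀ h3]
  · filter_upwards [H.G_pos'] with z h2
    have h2 : 0 < g z := h2
    have h3 : gj z * g z ≠ 0 := by simp only [hgj]; positivity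
    rw [inv_mul_cancel_left₀ h3]

end

/-! ### Tangency to all orders and rigidity of the model. -/

section
variable {G G' q q' : ℝ → ℝ} {k l f₁ f₂ : ℂ × ℂ → ℂ}

theorem Profile.false_of_logDeriv_bounded (H : Profile G G' q q') (N : ℝ)
    (h : ∀ᶠ s in 𝓝[>] (0 : ℝ), s * |G' s / G s| ≤ N) : False := by
  obtain ⟨n, hn⟩ := exists_nat_ge N
  refine H.false_of_logDeriv_le n ?_
  filter_upwards [h, H.G_pos] with s h1 h2
  rw [abs_div, abs_of_pos h2] at h1
  have h3 := mul_le_mul_of_nonneg_right (h1.trans hn) h2.le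
  have h4 : s * (|G' s| / G s) * G s = s * |G' s| := by field_simp
  rwa [h4] at h3

/-- A map preserving the model and tangent to the identity to order `j ≥ 1` in `w` is tangent to
the identity to order `j + 1`. -/
theorem tangency_improves (H : Profile G G' q q') (hk : IsSep k) (hl : IsSep l) {j : ℕ}
    (hj : j ≠ 0) (hN : ∀ᶠ p in 𝓝 (0 : ℂ × ℂ), p ∈ Model G q →
      (p.1 * (1 + p.1 ^ j * k p), p.2 + p.1 ^ j * l p) ∈ Model G q) :
    (∀ᶠ z in 𝓝 0, k (0, z) = 0) ∧ ∀ᶠ z in 𝓝 0, l (0, z) = 0 := by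
  -- With K = e ^ j k(0, z) and Λ = e ^ j l(0, z) z̄ / |z|, both K - (G' / G + i q') Λ / 2 and (G' /
  -- G) Re Λ + q' Im Λ are flat.
  obtain ⟨hK, hre⟩ := isFlat_of_pencil hj (isFlat_leading_term H hk hl hj hN)
  set e : ℂ → ℂ := fun z => Complex.exp ((q ‖z‖ : ℂ) * Complex.I) with he
  have henorm : ∀ z, ‖e z‖ = 1 := fun z => Complex.norm_exp_ofReal_mul_I _
  have hejnorm : ∀ z, ‖e z ^ j‖ = 1 := fun z => by rw [norm_pow, henorm, one_pow]
  have hid : Tendsto (fun z : ℂ => z) (𝓝[≠] 0) (𝓝 0) := tendsto_id.mono_left nhdsWithin_le_nhds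
  have hkO := hk.isBigO_one (W := fun _ => 0) tendsto_const_nhds
  have hKO : (fun z => e z ^ j * k (0, z)) =O[𝓝[≠] 0] fun _ => (1 : ℝ) :=
    (IsBigO.of_bound 1 (Eventually.of_forall fun z => by
      rw [norm_mul, hejnorm])).trans hkO
  have hΛnorm : ∀ z : ℂ, z ≠ 0 →
      ‖e z ^ j * l (0, z) * (starRingEnd ℂ) z / (‖z‖ : ℂ)‖ = ‖l (0, z)‖ := by
    intro z hz
    have hz : ‖z‖ ≠ 0 := norm_ne_zero_iff.2 hz
    rw [norm_div, norm_mul, norm_mul, hejnorm, Complex.norm_conj, Complex.norm_real, norm_norm]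
    field_simp
  have hlzero : ∀ᶠ z in 𝓝 0, l (0, z) = 0 := by
    by_contra htop
    rw [← analyticOrderAt_eq_top] at htop
    obtain ⟨v, hv, hv0, hlv⟩ := hl.analyticAt.analyticOrderAt_ne_top.1 htop
    set ν := analyticOrderNatAt (fun z => l (0, z)) 0 with hν
    simp only [sub_zero, smul_eq_mul] at hlv
    have hvt : Tendsto v (𝓝[≠] 0) (𝓝 (v 0)) :=
      hv.continuousAt.tendsto.mono_left nhdsWithin_le_nhds
    set c := ‖v 0‖ with hc
    have hc0 : 0 < c := norm_pos_iff.2 hv0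
    -- For order ν ≤ 1 the first relation suffices: (G' / G + i q') Λ is bounded and |Λ| = |l(0, z)|
    -- is at least a constant times s on the positive axis, so s G' / G is bounded.
    rcases le_or_gt ν 1 with hν1 | hν1
    · have hbd : (fun z => ((G' ‖z‖ / G ‖z‖ : ℝ) + q' ‖z‖ * Complex.I) *
          (e z ^ j * l (0, z) * (starRingEnd ℂ) z / (‖z‖ : ℂ))) =O[𝓝[≠] 0] fun _ => (1 : ℝ) :=
        ((hKO.sub hK.isBigO_one).const_mul_left 2).congr_left fun z => by ring
      obtain ⟨C, hC⟩ := hbd.bound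
      have hray := tendsto_ray (one_ne_zero (α := ℂ))
      simp only [mul_one] at hray
      refine H.false_of_logDeriv_bounded (C / (c / 2)) ?_
      filter_upwards [hray.eventually hC, hray.eventually (hlv.filter_mono nhdsWithin_le_nhds),
        hray.eventually (hvt.norm.eventually (lt_mem_nhds (half_lt_self hc0))),
        self_mem_nhdsWithin, Ioo_mem_nhdsGT one_pos] with s h1 h2 h3 hs hs1
      have hs : 0 < s := hs
      have hs' : (s : ℂ) ≠ 0 := by exact_mod_cast hs.ne'
      rw [norm_mul, hΛnorm _ hs', h2, norm_mul, norm_pow, Complex.norm_real,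
        Real.norm_of_nonneg hs.le, norm_one, mul_one] at h1
      have h4 : |G' s / G s| ≤ ‖((G' s / G s : ℝ) : ℂ) + q' s * Complex.I‖ := by
        have := Complex.abs_re_le_norm (((G' s / G s : ℝ) : ℂ) + q' s * Complex.I)
        simpa using this
      have h5 : s ≤ s ^ ν := by
        simpa using pow_le_pow_of_le_one hs.le hs1.2.le hν1
      rw [le_div_iff₀ (half_pos hc0)]
      calc s * |G' s / G s| * (c / 2) = |G' s / G s| * (s * (c / 2)) := by ring
        _ ≤ ‖((G' s / G s : ℝ) : ℂ) + q' s * Complex.I‖ * (s ^ ν * ‖v s‖) := by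
            gcongr
        _ ≤ C := h1
    · obtain ⟨i, hi⟩ : ∃ i, ν = i + 1 := ⟨ν - 1, by omega⟩
      have hi0 : i ≠ 0 := by omega
      -- For ν ≥ 2 use the second relation. The factor z̄ / |z| lowers the angular frequency of l to
      -- ν - 1, which is positive, so a ray can be chosen where Λ / s ^ ν has a positive real limit;
      -- G' / G would then be bounded.
      obtain ⟨d, hd, hdv⟩ := exists_unit_pow_mul_eq_norm hv0 hi0
      have hd0 : d ≠ 0 := by rintro rfl; simp at hd
      have hray := tendsto_ray hd0
      have hdd : d * (starRingEnd ℂ) d = 1 := by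
        rw [Complex.mul_conj, Complex.normSq_eq_norm_sq, hd]; simp
      set S : ℝ → ℂ := fun s => e (s * d) ^ j * (d ^ i * v (s * d)) with hS
      have hSt : Tendsto S (𝓝[>] 0) (𝓝 (c : ℂ)) := by
        have h1 := ((tendsto_exp_mul_I (H.tendsto_q hid)).comp hray).pow j
        have h2 := h1.mul ((hvt.comp hray).const_mul (d ^ i))
        rw [hdv, one_pow, one_mul] at h2
        exact h2
      have hSre : ∀ᶠ s in 𝓝[>] (0 : ℝ), c / 2 < (S s).re :=
        ((Complex.continuous_re.tendsto _).comp hSt).eventually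
          (lt_mem_nhds (by rw [Complex.ofReal_re]; exact half_lt_self hc0))
      have hSim : ∀ᶠ s in 𝓝[>] (0 : ℝ), |(S s).im| < 1 :=
        ((Complex.continuous_im.tendsto _).comp hSt).abs.eventually
          (gt_mem_nhds (by rw [Complex.ofReal_im, abs_zero]; exact one_pos))
      obtain ⟨C, hC⟩ := (hre ν).bound
      obtain ⟨C', hC'⟩ := H.q'_isBigO_one.bound
      refine H.false_of_logDeriv_bounded ((C + C') / (c / 2)) ?_
      filter_upwards [hray.eventually hC, hray.eventually hC',
        hray.eventually (hlv.filter_mono nhdsWithin_le_nhds), hSre, hSim,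
        Ioo_mem_nhdsGT one_pos] with s h1 h2 h3 h4 h5 hs
      have hs0 : 0 < s := hs.1
      have hsd : ‖(s : ℂ) * d‖ = s := by
        rw [norm_mul, hd, mul_one, Complex.norm_real, Real.norm_of_nonneg hs0.le]
      have hΛ : e (s * d) ^ j * l (0, s * d) * (starRingEnd ℂ) (s * d) / (‖(s : ℂ) * d‖ : ℂ)
          = ((s ^ ν : ℝ) : ℂ) * S s := by
        have hs' : (s : ℂ) ≠ 0 := by exact_mod_cast hs0.ne'
        have hsd' : ((‖(s : ℂ) * d‖ : ℝ) : ℂ) = s := by rw [hsd]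
        rw [h3, map_mul, Complex.conj_ofReal, hsd', hi, hS]
        push_cast
        field_simp
        rw [mul_pow, pow_succ d]
        linear_combination (e (s * d) ^ j * (s : ℂ) ^ (i + 1) * d ^ i * v (s * d)) * hdd
      rw [hΛ, Complex.re_ofReal_mul, Complex.im_ofReal_mul, hsd, norm_pow,
        Real.norm_of_nonneg hs0.le, Real.norm_eq_abs] at h1
      rw [hsd, Real.norm_eq_abs, norm_one, mul_one] at h2
      have hsν : 0 < s ^ ν := by positivity
      have h6 : |G' s / G s * (S s).re + q' s * (S s).im| ≤ C := by
        refine le_of_mul_le_mul_right ?_ hsν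
        refine le_trans (le_of_eq ?_) h1
        rw [← abs_of_pos hsν, ← abs_mul, abs_of_pos hsν]
        congr 1; ring
      have h7 : |G' s / G s * (S s).re| ≤ C + C' := by
        have : G' s / G s * (S s).re
            = (G' s / G s * (S s).re + q' s * (S s).im) - q' s * (S s).im := by ring
        rw [this]
        refine (abs_sub _ _).trans (add_le_add h6 ?_)
        rw [abs_mul]
        nlinarith [abs_nonneg (q' s), abs_nonneg (S s).im]
      rw [abs_mul, abs_of_pos ((half_pos hc0).trans h4)] at h7
      rw [le_div_iff₀ (half_pos hc0)]
      have h8 := abs_nonneg (G' s / G s)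
      calc s * |G' s / G s| * (c / 2) ≤ 1 * |G' s / G s| * (c / 2) := by
            gcongr; exact hs.2.le
        _ ≤ |G' s / G s| * (S s).re := by rw [one_mul]; gcongr
        _ ≤ C + C' := h7
  refine ⟨eventually_eq_zero_of_isBigO hk.analyticAt fun n => ?_, hlzero⟩
  -- Once l(0, z) = 0, the first relation says that k(0, z), up to a unimodular factor, is flat.
  refine IsBigO.trans (IsBigO.of_bound 1 ?_) (hK n)
  filter_upwards [hlzero.filter_mono nhdsWithin_le_nhds] with z hz
  rw [hz]
  simp only [mul_zero, zero_mul, zero_div, sub_zero, one_mul]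
  rw [norm_mul, hejnorm, one_mul]

/-- On each complex line through 0 the function becomes a flat holomorphic function of one variable
on a disc containing t = 1, so the identity theorem applies. -/
theorem eq_zero_of_flat {F : ℂ × ℂ → ℂ} {r : ℝ} (hF : DifferentiableOn ℂ F (ball 0 r))
    (h : ∀ n : ℕ, F =O[𝓝 0] fun p => ‖p‖ ^ n) {p : ℂ × ℂ} (hp : p ∈ ball (0 : ℂ × ℂ) r) :
    F p = 0 := by
  rw [mem_ball_zero_iff] at hp
  have hr : 0 < r := (norm_nonneg p).trans_lt hp
  -- For p ≠ 0 this is the harmonic mean of 1 and r / ‖p‖, hence lies between them; it also makes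
  -- sense for p = 0.
  set R := 2 * r / (r + ‖p‖) with hR
  have hden : 0 < r + ‖p‖ := by positivity
  have hR1 : 1 < R := by rw [hR, one_lt_div hden]; linarith
  have hRp : R * ‖p‖ ≤ r := by
    rw [hR, div_mul_eq_mul_div, div_le_iff₀ hden]
    nlinarith [norm_nonneg p]
  set φ : ℂ → ℂ := fun t => F (t • p) with hφ
  have hd : DifferentiableOn ℂ φ (ball 0 R) := by
    refine hF.comp (f := fun t : ℂ => t • p) (by fun_prop) fun t ht => ?_
    rw [mem_ball_zero_iff] at ht ⊢
    rw [norm_smul]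
    rcases (norm_nonneg p).eq_or_lt with h0 | h0
    · rw [← h0, mul_zero]; exact hr
    · exact (mul_lt_mul_of_pos_right ht h0).trans_le hRp
  have han : AnalyticOnNhd ℂ φ (ball 0 R) := hd.analyticOnNhd isOpen_ball
  have h0mem : (0 : ℂ) ∈ ball (0 : ℂ) R := mem_ball_self (one_pos.trans hR1)
  have hev : ∀ᶠ t in 𝓝 0, φ t = 0 := by
    refine eventually_eq_zero_of_isBigO (han 0 h0mem) fun n => ?_
    have hlim : Tendsto (fun t : ℂ => t • p) (𝓝[≠] 0) (𝓝 0) := by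
      have : Continuous fun t : ℂ => t • p := by fun_prop
      simpa using (this.tendsto 0).mono_left nhdsWithin_le_nhds
    refine ((h n).comp_tendsto hlim).trans (IsBigO.of_bound (‖p‖ ^ n) ?_)
    refine Eventually.of_forall fun t => ?_
    simp only [Function.comp, norm_smul, norm_pow, norm_norm, mul_pow, norm_mul]
    rw [mul_comm]
  have := han.eqOn_zero_of_preconnected_of_eventuallyEq_zero (convex_ball 0 R).isPreconnected
    h0mem hev (show (1 : ℂ) ∈ ball 0 R by simpa using hR1)
  simpa [hφ] using this

theorem model_snd_congr {w z z' : ℂ} (h : ‖z‖ = ‖z'‖) :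
    (w, z) ∈ Model G q ↔ (w, z') ∈ Model G q := by
  simp only [Model, mem_ofPred_eq, h]

/-- The eventual behaviour in `z` as a statement about germs in `(w, z)`. -/
theorem eventually_snd {Q : ℂ → Prop} (h : ∀ᶠ z in 𝓝 0, Q z) :
    ∀ᶠ p : ℂ × ℂ in 𝓝 0, Q p.2 :=
  (continuous_snd.tendsto (0 : ℂ × ℂ)).eventually h

/-- Because f₁ = w k, the Jacobian matrix at 0 is triangular with diagonal entries k(0) and ∂f₂/∂z.
-/
theorem nondegenerate_of_injective (hk : IsSep k)
    (h1 : ∀ᶠ p in 𝓝 (0 : ℂ × ℂ), f₁ p = p.1 * k p) {L : ℂ × ℂ →L[ℂ] ℂ × ℂ}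
    (hL : HasFDerivAt (fun p => (f₁ p, f₂ p)) L 0) (hinj : Function.Injective L) :
    k 0 ≠ 0 ∧ deriv (fun z => f₂ (0, z)) 0 ≠ 0 := by
  have hL1 : HasFDerivAt f₁ ((ContinuousLinearMap.fst ℂ ℂ ℂ).comp L) 0 := hL.fst
  have hL2 : HasFDerivAt f₂ ((ContinuousLinearMap.snd ℂ ℂ ℂ).comp L) 0 := hL.snd
  have hz : HasDerivAt (fun z : ℂ => ((0 : ℂ), z)) (0, 1) 0 :=
    (hasDerivAt_const _ _).prodMk (hasDerivAt_id _)
  have hw : HasDerivAt (fun w : ℂ => (w, (0 : ℂ))) (1, 0) 0 :=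
    (hasDerivAt_id _).prodMk (hasDerivAt_const _ _)
  have hz0 : Tendsto (fun z : ℂ => ((0 : ℂ), z)) (𝓝 0) (𝓝 (0 : ℂ × ℂ)) := hz.continuousAt.tendsto
  have hw0 : Tendsto (fun w : ℂ => (w, (0 : ℂ))) (𝓝 0) (𝓝 (0 : ℂ × ℂ)) := hw.continuousAt.tendsto
  have e01 : (L (0, 1)).1 = 0 := by
    have ha : HasDerivAt (fun z => f₁ (0, z)) (L (0, 1)).1 0 :=
      HasFDerivAt.comp_hasDerivAt (l := f₁) (0 : ℂ) (f := fun z : ℂ => ((0 : ℂ), z)) hL1 hz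
    have hb : HasDerivAt (fun z => f₁ (0, z)) 0 0 := by
      refine (hasDerivAt_const (0 : ℂ) (0 : ℂ)).congr_of_eventuallyEq ?_
      filter_upwards [hz0.eventually h1] with z hz
      rw [hz]; simp
    exact ha.unique hb
  have e02 : (L (0, 1)).2 = deriv (fun z => f₂ (0, z)) 0 := by
    have ha : HasDerivAt (fun z => f₂ (0, z)) (L (0, 1)).2 0 :=
      HasFDerivAt.comp_hasDerivAt (l := f₂) (0 : ℂ) (f := fun z : ℂ => ((0 : ℂ), z)) hL2 hz
    exact ha.deriv.symm
  have e11 : (L (1, 0)).1 = k 0 := by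
    have ha : HasDerivAt (fun w => f₁ (w, 0)) (L (1, 0)).1 0 :=
      HasFDerivAt.comp_hasDerivAt (l := f₁) (0 : ℂ) (f := fun w : ℂ => (w, (0 : ℂ))) hL1 hw
    have hkd : DifferentiableAt ℂ (fun w => k (w, 0)) 0 := by
      obtain ⟨r, hr, hk⟩ := hk
      exact (hk.left 0 (mem_ball_self hr)).differentiableAt (ball_mem_nhds 0 hr)
    have hb : HasDerivAt (fun w => f₁ (w, 0)) (k 0) 0 := by
      have hc := (hasDerivAt_id (0 : ℂ)).mul hkd.hasDerivAt
      simp only [id, one_mul, zero_mul, add_zero, Prod.mk_zero_zero] at hc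
      refine hc.congr_of_eventuallyEq ?_
      filter_upwards [hw0.eventually h1] with w hw
      rw [hw]; rfl
    exact ha.unique hb
  have hb : deriv (fun z => f₂ (0, z)) 0 ≠ 0 := by
    intro h0
    have : L (0, 1) = L 0 := by rw [map_zero]; exact Prod.ext e01 (e02.trans h0)
    have := hinj this
    simp at this
  refine ⟨fun h0 => ?_, hb⟩
  set b := deriv (fun z => f₂ (0, z)) 0
  -- If k(0) = 0, this vector lies in the kernel, although its first entry b is nonzero.
  have hsplit : ((b, -(L (1, 0)).2) : ℂ × ℂ) = b • ((1, 0) : ℂ × ℂ) + (-(L (1, 0)).2) • ((0, 1) : ℂ × ℂ) := by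
    simp
  have : L (b, -(L (1, 0)).2) = L 0 := by
    rw [hsplit, map_add, map_smul, map_smul, map_zero]
    refine Prod.ext ?_ ?_
    · simp [e01, e11, h0]
    · simp only [Prod.snd_add, Prod.smul_snd, e02, smul_eq_mul, Prod.snd_zero]; ring
  have := congrArg Prod.fst (hinj this)
  exact hb this

/-- Germs of biholomorphisms preserving the model are rotations. -/
theorem eq_rotation (H : Profile G G' q q')
    (hd₁ : ∀ᶠ p in 𝓝 (0 : ℂ × ℂ), DifferentiableAt ℂ f₁ p)
    (hd₂ : ∀ᶠ p in 𝓝 (0 : ℂ × ℂ), DifferentiableAt ℂ f₂ p) (h1 : f₁ 0 = 0) (h2 : f₂ 0 = 0)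
    {L : ℂ × ℂ →L[ℂ] ℂ × ℂ} (hL : HasFDerivAt (fun p => (f₁ p, f₂ p)) L 0)
    (hinj : Function.Injective L)
    (hN : ∀ᶠ p in 𝓝 (0 : ℂ × ℂ), p ∈ Model G q → (f₁ p, f₂ p) ∈ Model G q) :
    ∃ b : ℂ, ‖b‖ = 1 ∧ ∀ᶠ p in 𝓝 (0 : ℂ × ℂ), f₁ p = p.1 ∧ f₂ p = b * p.2 := by
  have hf₁ := IsSep.of_differentiable hd₁
  have hf₂ := IsSep.of_differentiable hd₂
  obtain ⟨k, hk, hfk⟩ := hf₁.exists_eq_add_mul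
  have hfk' : ∀ᶠ p in 𝓝 (0 : ℂ × ℂ), f₁ p = p.1 * k p := by
    filter_upwards [eventually_snd (fst_eq_zero H hf₁ hf₂ h1 h2 hN)] with p hp
    rw [hfk p, hp, zero_add]
  obtain ⟨hk0, hb0⟩ := nondegenerate_of_injective hk hfk' hL hinj
  have hNk : ∀ᶠ p in 𝓝 (0 : ℂ × ℂ), p ∈ Model G q → (p.1 * k p, f₂ p) ∈ Model G q := by
    filter_upwards [hN, hfk'] with p hp hp' hm
    rw [← hp']; exact hp hm
  obtain ⟨b, hb, hk1, hfb⟩ := rotation_on_curve H hk hf₂ h2 hNk hk0 hb0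
  have hbne : b ≠ 0 := by rintro rfl; simp at hb
  -- Each round shows that the remainders k, l vanish on w = 0 and divides them by w once more; the
  -- base case is the statement that the map is a rotation on w = 0.
  have hind : ∀ j : ℕ, ∃ k l, IsSep k ∧ IsSep l ∧
      (∀ᶠ p in 𝓝 (0 : ℂ × ℂ), f₁ p = p.1 * (1 + p.1 ^ (j + 1) * k p)) ∧
      ∀ᶠ p in 𝓝 (0 : ℂ × ℂ), f₂ p = b * (p.2 + p.1 ^ (j + 1) * l p) := by
    intro j
    induction j with
    | zero =>
      obtain ⟨k', hk', hkk'⟩ := hk.exists_eq_add_mul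
      obtain ⟨l, hl, hfl⟩ := hf₂.exists_eq_add_mul
      refine ⟨k', fun p => b⁻¹ * l p, hk', hl.const_mul _, ?_, ?_⟩
      · filter_upwards [hfk', eventually_snd hk1] with p hp hp'
        rw [hp, hkk' p, hp', zero_add, pow_one]
      · filter_upwards [eventually_snd hfb] with p hp
        rw [hfl p, hp]
        field_simp
        ring
    | succ j ih =>
      obtain ⟨k, l, hk, hl, he1, he2⟩ := ih
      -- The rotation b may be dropped, since membership in the model depends on the second
      -- coordinate through its modulus.
      have hN' : ∀ᶠ p in 𝓝 (0 : ℂ × ℂ), p ∈ Model G q →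
          (p.1 * (1 + p.1 ^ (j + 1) * k p), p.2 + p.1 ^ (j + 1) * l p) ∈ Model G q := by
        filter_upwards [hN, he1, he2] with p hp hp1 hp2 hm
        have := hp hm
        rw [hp1, hp2] at this
        refine (model_snd_congr ?_).1 this
        rw [norm_mul, hb, one_mul]
      obtain ⟨hk0, hl0⟩ := tangency_improves H hk hl (Nat.succ_ne_zero j) hN'
      obtain ⟨k', hk', hkk'⟩ := hk.exists_eq_add_mul
      obtain ⟨l', hl', hll'⟩ := hl.exists_eq_add_mul
      refine ⟨k', l', hk', hl', ?_, ?_⟩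
      · filter_upwards [he1, eventually_snd hk0] with p hp hp'
        rw [hp, hkk' p, hp']; ring
      · filter_upwards [he2, eventually_snd hl0] with p hp hp'
        rw [hp, hll' p, hp']; ring
  have hpow : ∀ (n : ℕ) {k : ℂ × ℂ → ℂ}, IsSep k →
      (fun p : ℂ × ℂ => p.1 ^ n * k p) =O[𝓝 0] fun p => ‖p‖ ^ n := by
    intro n k hk
    have ha : (fun p : ℂ × ℂ => p.1 ^ n) =O[𝓝 0] fun p => ‖p‖ ^ n :=
      IsBigO.of_bound 1 (Eventually.of_forall fun p => by
        rw [norm_pow, norm_pow, norm_norm, one_mul]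
        exact pow_le_pow_left₀ (norm_nonneg _) (norm_fst_le p) n)
    simpa using ha.mul (hk.continuousAt.tendsto.isBigO_one ℝ)
  have hweak : ∀ n : ℕ, (fun p : ℂ × ℂ => ‖p‖ ^ (n + 1)) =O[𝓝 0] fun p => ‖p‖ ^ n := by
    intro n
    have hlim : Tendsto (fun p : ℂ × ℂ => ‖p‖) (𝓝 0) (𝓝 0) := by
      simpa using continuous_norm.tendsto (0 : ℂ × ℂ)
    have := (isBigO_refl (fun p : ℂ × ℂ => ‖p‖ ^ n) (𝓝 0)).mul (hlim.isBigO_one ℝ)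
    simpa [pow_succ] using this
  obtain ⟨r, hr, hd⟩ := Metric.eventually_nhds_iff_ball.1 (hd₁.and hd₂)
  refine ⟨b, hb, ?_⟩
  filter_upwards [ball_mem_nhds (0 : ℂ × ℂ) hr] with p hp
  constructor
  · refine sub_eq_zero.1 (eq_zero_of_flat (F := fun p => f₁ p - p.1) (r := r) ?_ ?_ hp)
    · exact fun p hp => ((hd p hp).1.sub differentiableAt_fst).differentiableWithinAt
    · intro n
      obtain ⟨k, l, hk, hl, he1, he2⟩ := hind n
      refine EventuallyEq.trans_isBigO ?_ (((hpow (n + 2) hk).trans (hweak _)).trans (hweak _))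
      filter_upwards [he1] with p hp
      rw [hp]; ring
  · refine sub_eq_zero.1 (eq_zero_of_flat (F := fun p => f₂ p - b * p.2) (r := r) ?_ ?_ hp)
    · exact fun p hp => ((hd p hp).2.sub (differentiableAt_snd.const_mul b)).differentiableWithinAt
    · intro n
      obtain ⟨k, l, hk, hl, he1, he2⟩ := hind n
      refine EventuallyEq.trans_isBigO ?_
        (((hpow (n + 1) hl).trans (hweak _)).const_mul_left b)
      filter_upwards [he2] with p hp
      rw [hp]; ring

end

/-! ### The given p and q provide a profile. -/

/-- The derivative of f(u) - f'(s) u is at most B |t - s| between s and t, so the mean value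
inequality applies twice. One-sided derivatives are allowed because q lives on [0, ε₀). -/
theorem abs_taylor_sub_le {f f' f'' : ℝ → ℝ} {S : Set ℝ} (hS : Convex ℝ S) {B : ℝ}
    (hf : ∀ u ∈ S, HasDerivWithinAt f (f' u) S u) (hf' : ∀ u ∈ S, HasDerivWithinAt f' (f'' u) S u)
    (hB : ∀ u ∈ S, |f'' u| ≤ B) {s t : ℝ} (hs : s ∈ S) (ht : t ∈ S) :
    |f t - f s - f' s * (t - s)| ≤ B * (t - s) ^ 2 := by
  have hsub : uIcc s t ⊆ S := hS.ordConnected.uIcc_subset hs ht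
  have hB0 : 0 ≤ B := (abs_nonneg _).trans (hB s hs)
  have hder : ∀ u ∈ uIcc s t, HasDerivWithinAt (fun u => f u - f' s * u) (f' u - f' s) (uIcc s t) u := by
    intro u hu
    have h1 := ((hf u (hsub hu)).mono hsub).sub ((hasDerivWithinAt_id u _).const_mul (f' s))
    rw [mul_one] at h1
    exact h1
  have hle : ∀ u ∈ uIcc s t, ‖f' u - f' s‖ ≤ B * |t - s| := by
    intro u hu
    refine (hS.norm_image_sub_le_of_norm_hasDerivWithin_le hf' hB hs (hsub hu)).trans ?_
    exact mul_le_mul_of_nonneg_left (abs_sub_left_of_mem_uIcc hu) hB0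
  have := (convex_uIcc s t).norm_image_sub_le_of_norm_hasDerivWithin_le hder hle left_mem_uIcc
    right_mem_uIcc
  rw [Real.norm_eq_abs, Real.norm_eq_abs, mul_assoc, ← sq, sq_abs] at this
  refine le_trans (le_of_eq ?_) this
  congr 1; ring

/-- Near a point where all derivatives of a smooth function vanish, these are all flat. -/
theorem iteratedDeriv_isBigO_pow {G : ℝ → ℝ} {ε : ℝ} (hε : 0 < ε)
    (hder : ∀ m : ℕ, ∀ s ∈ Ioo (-ε) ε,
      HasDerivAt (iteratedDeriv m G) (iteratedDeriv (m + 1) G s) s)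
    (h0 : ∀ m : ℕ, iteratedDeriv m G 0 = 0) (n m : ℕ) :
    iteratedDeriv m G =O[𝓝 0] fun s => |s| ^ n := by
  have hIoo : Ioo (-ε) ε ∈ 𝓝 (0 : ℝ) := Ioo_mem_nhds (by linarith) hε
  -- A bound of order n on derivative m + 1 integrates to one of order n + 1 on derivative m, so all
  -- m are treated at once.
  induction n generalizing m with
  | zero =>
    simpa using (hder m 0 ⟨by linarith, hε⟩).continuousAt.tendsto.isBigO_one ℝ
  | succ n ih =>
    obtain ⟨C, hC⟩ := (ih (m + 1)).bound
    obtain ⟨δ, hδ, hδ'⟩ := Metric.eventually_nhds_iff_ball.1 (hC.and hIoo)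
    refine IsBigO.of_bound C ?_
    filter_upwards [ball_mem_nhds (0 : ℝ) hδ] with s hs
    rw [mem_ball_zero_iff, Real.norm_eq_abs] at hs
    have hsub : ∀ u ∈ uIcc 0 s, |u| ≤ |s| := fun u hu => by
      simpa using abs_sub_left_of_mem_uIcc hu
    have hball : ∀ u ∈ uIcc 0 s, u ∈ ball (0 : ℝ) δ := fun u hu => by
      rw [mem_ball_zero_iff]; exact (hsub u hu).trans_lt hs
    have hC0 : 0 ≤ C ∨ s = 0 := by
      by_contra hcon
      push Not at hcon
      have h1 := (hδ' s (hball s right_mem_uIcc)).1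
      have h2 : 0 < ‖|s| ^ n‖ :=
        norm_pos_iff.2 (pow_ne_zero _ (abs_pos.2 hcon.2).ne')
      nlinarith [norm_nonneg (iteratedDeriv (m + 1) G s), hcon.1]
    rcases hC0 with hC0 | rfl
    · have := (convex_uIcc 0 s).norm_image_sub_le_of_norm_hasDerivWithin_le
        (f := iteratedDeriv m G) (f' := iteratedDeriv (m + 1) G) (C := C * |s| ^ n)
        (fun u hu => (hder m u (hδ' u (hball u hu)).2).hasDerivWithinAt) (fun u hu => ?_)
        left_mem_uIcc right_mem_uIcc
      · rw [h0, sub_zero, sub_zero, Real.norm_eq_abs s] at this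
        rw [norm_pow, Real.norm_eq_abs |s|, abs_abs, pow_succ, ← mul_assoc]
        exact this
      · refine ((hδ' u (hball u hu)).1).trans ?_
        rw [norm_pow, Real.norm_eq_abs, abs_abs]
        exact mul_le_mul_of_nonneg_left (pow_le_pow_left₀ (abs_nonneg _) (hsub u hu) n) hC0
    · simp [h0]

/-- One spare power of |s| absorbs the constant. -/
theorem eventually_le_of_isBigO_pow {u : ℝ → ℝ} (h : ∀ n : ℕ, u =O[𝓝 0] fun s => |s| ^ n) (n : ℕ) :
    ∀ᶠ s in 𝓝 0, |u s| ≤ |s| ^ n := by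
  obtain ⟨C, hC⟩ := (h (n + 1)).bound
  have hlim : Tendsto (fun s : ℝ => C * |s|) (𝓝 0) (𝓝 0) := by
    have : Continuous fun s : ℝ => C * |s| := by fun_prop
    simpa using this.tendsto 0
  filter_upwards [hC, hlim.eventually (gt_mem_nhds one_pos)] with s h1 h2
  rw [norm_pow, Real.norm_eq_abs, Real.norm_eq_abs, abs_abs, pow_succ] at h1
  have : 0 ≤ |s| ^ n := by positivity
  nlinarith

/-- The profile function `s ↦ e^{p(s)}`, extended as an even function. -/
noncomputable def radial (p : ℝ → ℝ) (s : ℝ) : ℝ := expRadial p (s : ℂ)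

theorem radial_norm (p : ℝ → ℝ) (z : ℂ) : radial p ‖z‖ = expRadial p z := by
  simp [radial, expRadial]

/-- Restricting the radial function on ℂ to the real axis gives a smooth function on a two-sided
neighbourhood of 0 whose derivatives all vanish there. For q, compactness of [0, ε₀ / 2] bounds the
first two derivatives. -/
theorem profile_of_smooth {ε₀ : ℝ} (hε₀ : 0 < ε₀) {p q : ℝ → ℝ}
    (hq : ContDiffOn ℝ ∞ q (Ico 0 ε₀)) (hq₀ : q 0 = 0)
    (hg : ContDiffOn ℝ ∞ (expRadial p) (ball (0 : ℂ) ε₀))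
    (hg₀ : VanishesToInfiniteOrder (expRadial p)) :
    Profile (radial p) (deriv (radial p)) q (derivWithin q (Ico 0 ε₀)) := by
  have hpre : Complex.ofRealCLM ⁻¹' ball (0 : ℂ) ε₀ = Ioo (-ε₀) ε₀ := by
    ext s
    simp [abs_lt]
  have hsm : ContDiffOn ℝ ∞ (radial p) (Ioo (-ε₀) ε₀) := by
    rw [← hpre]
    exact hg.comp_continuousLinearMap Complex.ofRealCLM
  have h0mem : (0 : ℝ) ∈ Ioo (-ε₀) ε₀ := ⟨by linarith, hε₀⟩
  have h0 : ∀ m : ℕ, iteratedDeriv m (radial p) 0 = 0 := by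
    intro m
    have h1 := Complex.ofRealCLM.iteratedFDerivWithin_comp_right (f := expRadial p) (n := ∞)
      hg isOpen_ball.uniqueDiffOn (by rw [hpre]; exact isOpen_Ioo.uniqueDiffOn) (x := 0)
      (by simpa using hε₀) (i := m) (by exact_mod_cast le_top)
    rw [hpre, iteratedFDerivWithin_of_isOpen m isOpen_Ioo h0mem,
      iteratedFDerivWithin_of_isOpen m isOpen_ball (by simpa using hε₀), map_zero, hg₀ m] at h1
    rw [iteratedDeriv_eq_iteratedFDeriv]
    change (iteratedFDeriv ℝ m (expRadial p ∘ Complex.ofRealCLM) 0) _ = 0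
    rw [h1]
    simp
  have hder : ∀ m : ℕ, ∀ s ∈ Ioo (-ε₀) ε₀,
      HasDerivAt (iteratedDeriv m (radial p)) (iteratedDeriv (m + 1) (radial p) s) s := by
    have hsm' : ∀ m : ℕ, ContDiffOn ℝ ∞ (iteratedDeriv m (radial p)) (Ioo (-ε₀) ε₀) := by
      intro m
      induction m with
      | zero => simpa using hsm
      | succ m ih =>
        rw [iteratedDeriv_succ]
        exact ih.deriv_of_isOpen isOpen_Ioo (by simp)
    intro m s hs
    rw [iteratedDeriv_succ]
    exact (((hsm' m).differentiableOn (by simp)).differentiableAt (isOpen_Ioo.mem_nhds hs)).hasDerivAt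
  have hflat := iteratedDeriv_isBigO_pow hε₀ hder h0
  have hIoo : Ioo (-ε₀) ε₀ ∈ 𝓝 (0 : ℝ) := isOpen_Ioo.mem_nhds h0mem
  refine ⟨by simp [radial, expRadial], ?_, ?_, ?_, ?_, ?_, hq₀, ?_⟩
  · filter_upwards [self_mem_nhdsWithin] with s hs
    have hs : (0 : ℝ) < s := hs
    simp only [radial, expRadial, Complex.ofReal_eq_zero, hs.ne', if_false]
    positivity
  · filter_upwards [hIoo] with s hs
    have := hder 0 s hs
    rwa [iteratedDeriv_zero, zero_add, iteratedDeriv_one] at this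
  · exact eventually_le_of_isBigO_pow fun n => by simpa using hflat n 0
  · exact eventually_le_of_isBigO_pow fun n => by simpa using hflat n 1
  · intro n
    -- The condition |t - s| ≤ s confines t to [0, 2 s]; the extra power in n + 1 pays for the
    -- factor 2 ^ (n + 1).
    obtain ⟨δ, hδ, h2⟩ := Metric.eventually_nhds_iff_ball.1
      ((eventually_le_of_isBigO_pow (fun n => hflat n 2) (n + 1)).and hIoo)
    have hlim : Tendsto (fun s : ℝ => 2 ^ (n + 1) * s) (𝓝[>] 0) (𝓝 0) := by
      have : Continuous fun s : ℝ => (2 : ℝ) ^ (n + 1) * s := by fun_prop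
      simpa using (this.tendsto 0).mono_left nhdsWithin_le_nhds
    filter_upwards [Ioo_mem_nhdsGT (half_pos hδ), hlim.eventually (gt_mem_nhds one_pos)]
      with s hs hs2 t ht
    have hs0 : 0 < s := hs.1
    have hin : ∀ u ∈ Icc 0 (2 * s), u ∈ ball (0 : ℝ) δ := by
      intro u hu
      rw [mem_ball_zero_iff, Real.norm_of_nonneg hu.1]
      linarith [hu.2, hs.2]
    refine abs_taylor_sub_le (f'' := iteratedDeriv 2 (radial p)) (convex_Icc 0 (2 * s)) ?_ ?_ ?_
      ⟨hs0.le, by linarith⟩ ⟨by linarith [(abs_le.1 ht).1], by linarith [(abs_le.1 ht).2]⟩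
    · intro u hu
      have := hder 0 u (h2 u (hin u hu)).2
      rw [iteratedDeriv_zero, zero_add, iteratedDeriv_one] at this
      exact this.hasDerivWithinAt
    · intro u hu
      have := hder 1 u (h2 u (hin u hu)).2
      rw [iteratedDeriv_one] at this
      exact this.hasDerivWithinAt
    · intro u hu
      refine (h2 u (hin u hu)).1.trans ?_
      rw [abs_of_nonneg hu.1]
      calc u ^ (n + 1) ≤ (2 * s) ^ (n + 1) := pow_le_pow_left₀ hu.1 hu.2 _
        _ = (2 ^ (n + 1) * s) * s ^ n := by rw [mul_pow, pow_succ s]; ring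
        _ ≤ 1 * s ^ n := by gcongr
        _ = s ^ n := one_mul _
  · have hun : UniqueDiffOn ℝ (Ico 0 ε₀) := uniqueDiffOn_Ico 0 ε₀
    have hq1 : ContDiffOn ℝ ∞ (derivWithin q (Ico 0 ε₀)) (Ico 0 ε₀) :=
      hq.derivWithin hun (by simp)
    have hq2 : ContDiffOn ℝ ∞ (derivWithin (derivWithin q (Ico 0 ε₀)) (Ico 0 ε₀)) (Ico 0 ε₀) :=
      hq1.derivWithin hun (by simp)
    have hsub : Icc 0 (ε₀ / 2) ⊆ Ico 0 ε₀ := fun s hs => ⟨hs.1, by linarith [hs.2]⟩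
    obtain ⟨C₁, hC₁⟩ := isCompact_Icc.exists_bound_of_continuousOn (hq1.continuousOn.mono hsub)
    obtain ⟨C₂, hC₂⟩ := isCompact_Icc.exists_bound_of_continuousOn (hq2.continuousOn.mono hsub)
    have hd1 : ∀ u ∈ Icc 0 (ε₀ / 2),
        HasDerivWithinAt q (derivWithin q (Ico 0 ε₀) u) (Icc 0 (ε₀ / 2)) u := fun u hu =>
      ((hq.differentiableOn (by simp)) u (hsub hu)).hasDerivWithinAt.mono hsub
    have hd2 : ∀ u ∈ Icc 0 (ε₀ / 2), HasDerivWithinAt (derivWithin q (Ico 0 ε₀))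
        (derivWithin (derivWithin q (Ico 0 ε₀)) (Ico 0 ε₀) u) (Icc 0 (ε₀ / 2)) u := fun u hu =>
      ((hq1.differentiableOn (by simp)) u (hsub hu)).hasDerivWithinAt.mono hsub
    set C := max (max C₁ C₂) 1 with hC
    have hC1 : C₁ ≤ C := (le_max_left _ _).trans (le_max_left _ _)
    have hC2 : C₂ ≤ C := (le_max_right _ _).trans (le_max_left _ _)
    refine ⟨C, ε₀ / 2, one_pos.trans_le (le_max_right _ _), by positivity, fun s hs =>
      ⟨(hC₁ s (Ico_subset_Icc_self hs)).trans hC1, fun t ht => ⟨?_, ?_⟩⟩⟩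
    · exact (convex_Icc 0 (ε₀ / 2)).norm_image_sub_le_of_norm_hasDerivWithin_le hd1
        (fun u hu => (hC₁ u hu).trans hC1) (Ico_subset_Icc_self hs) (Ico_subset_Icc_self ht)
    · exact abs_taylor_sub_le (convex_Icc 0 (ε₀ / 2)) hd1 hd2 (fun u hu => (hC₂ u hu).trans hC2)
        (Ico_subset_Icc_self hs) (Ico_subset_Icc_self ht)

/-! ### The coordinate change to the model, and the flow as a rotation. -/

/-- `∑ (a_n / n) z ^ n`. -/
noncomputable def primitive (c : ℕ → ℂ) (z : ℂ) : ℂ :=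
  ∑' n : ℕ, c (n + 1) / ((n : ℂ) + 1) * z ^ (n + 1)

theorem primitive_zero (c : ℕ → ℂ) : primitive c 0 = 0 := by simp [primitive]

/-- As 1 / i = -i, the real part of this series is Im A; this is how the second series enters the
factor e^{Im A}. -/
theorem tsum_div_I_mul (c : ℕ → ℂ) (z : ℂ) :
    ∑' n : ℕ, c (n + 1) / (Complex.I * ((n : ℂ) + 1)) * z ^ (n + 1)
      = -(Complex.I * primitive c z) := by
  rw [primitive, ← neg_mul, ← tsum_mul_left]
  congr 1
  ext n
  rw [mul_comm Complex.I, ← div_div, Complex.div_I]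
  ring

/-- The series is differentiated term by term, majorized on |w| < ρ by the series of a at ρ. The
relation is written z A' = a, which avoids dividing by z at 0. -/
theorem exists_hasDerivAt_primitive {ε₀ : ℝ} {a : ℂ → ℂ} {c : ℕ → ℂ}
    (ha : ∀ z ∈ ball (0 : ℂ) ε₀, HasSum (fun n : ℕ => c (n + 1) * z ^ (n + 1)) (a z))
    {z : ℂ} (hz : ‖z‖ < ε₀) : ∃ A', HasDerivAt (primitive c) A' z ∧ z * A' = a z := by
  obtain ⟨ρ, hρ1, hρ2⟩ := exists_between hz
  have hρ0 : 0 < ρ := (norm_nonneg z).trans_lt hρ1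
  have hsum : Summable fun n : ℕ => ‖c (n + 1) * (ρ : ℂ) ^ (n + 1)‖ :=
    (ha ρ (by rwa [mem_ball_zero_iff, Complex.norm_real, Real.norm_of_nonneg hρ0.le])).summable.norm
  have hdiff : ∀ n : ℕ, DifferentiableOn ℂ
      (fun w : ℂ => c (n + 1) / ((n : ℂ) + 1) * w ^ (n + 1)) (ball 0 ρ) := fun n => by fun_prop
  have hle : ∀ (n : ℕ) (w : ℂ), w ∈ ball (0 : ℂ) ρ →
      ‖c (n + 1) / ((n : ℂ) + 1) * w ^ (n + 1)‖ ≤ ‖c (n + 1) * (ρ : ℂ) ^ (n + 1)‖ := by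
    intro n w hw
    rw [mem_ball_zero_iff] at hw
    rw [norm_mul, norm_mul, norm_div, norm_pow, norm_pow, Complex.norm_real,
      Real.norm_of_nonneg hρ0.le]
    have h1 : (1 : ℝ) ≤ ‖(n : ℂ) + 1‖ := by
      have : ‖((n + 1 : ℕ) : ℂ)‖ = n + 1 := by rw [Complex.norm_natCast]; push_cast; ring
      push_cast at this
      rw [this]; linarith [Nat.cast_nonneg (α := ℝ) n]
    refine mul_le_mul (div_le_self (norm_nonneg _) h1) (pow_le_pow_left₀ (norm_nonneg _) hw.le _)
      (by positivity) (norm_nonneg _)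
  have hzρ : z ∈ ball (0 : ℂ) ρ := by simpa using hρ1
  have hd := Complex.differentiableOn_tsum_of_summable_norm hsum hdiff isOpen_ball hle
  have hs := Complex.hasSum_deriv_of_summable_norm hsum hdiff isOpen_ball hle hzρ
  refine ⟨_, (hd.differentiableAt (isOpen_ball.mem_nhds hzρ)).hasDerivAt, ?_⟩
  refine (hs.mul_left z).unique ?_
  suffices h : (fun n : ℕ => z * _root_.deriv
      (fun w : ℂ => c (n + 1) / ((n : ℂ) + 1) * w ^ (n + 1)) z) = fun n => c (n + 1) * z ^ (n + 1) by
    rw [h]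
    exact ha z (by simpa using hz)
  funext n
  have hn : (n : ℂ) + 1 ≠ 0 := Nat.cast_add_one_ne_zero n
  rw [((hasDerivAt_pow (n + 1) z).const_mul _).deriv]
  push_cast
  field_simp
  ring

/-- The coordinate linearizing the first component of the vector field. -/
noncomputable def zeta (α : ℝ) (w : ℂ) : ℂ :=
  if α = 0 then w else (1 - Complex.exp (-(α : ℂ) * w)) / α

/-- The principal logarithm makes this a right inverse of `zeta` where |α u| < 1, and a left inverse
on the strip |α Im w| < π. -/
noncomputable def zetaInv (α : ℝ) (u : ℂ) : ℂ :=
  if α = 0 then u else -(1 / (α : ℂ)) * Complex.log (1 - α * u)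

/-- The change of coordinates taking the hypersurface to its model. -/
noncomputable def toModel (A : ℂ → ℂ) (α : ℝ) (z : ℂ × ℂ) : ℂ × ℂ :=
  (zeta α z.1 * Complex.exp (Complex.I * A z.2), z.2)

noncomputable def ofModel (A : ℂ → ℂ) (α : ℝ) (p : ℂ × ℂ) : ℂ × ℂ :=
  (zetaInv α (p.1 * Complex.exp (-(Complex.I * A p.2))), p.2)

theorem differentiable_zeta (α : ℝ) : Differentiable ℂ (zeta α) := by
  unfold zeta
  split_ifs <;> fun_prop

theorem zeta_zero (α : ℝ) : zeta α 0 = 0 := by simp [zeta]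

theorem zetaInv_zero (α : ℝ) : zetaInv α 0 = 0 := by simp [zetaInv]

theorem slitPlane_of_norm_lt {u : ℂ} (hu : ‖u‖ < 1) : 1 - u ∈ Complex.slitPlane := by
  rw [Complex.mem_slitPlane_iff]
  left
  have := (Complex.re_le_norm u).trans_lt hu
  simp only [Complex.sub_re, Complex.one_re]
  linarith

theorem zeta_zetaInv {α : ℝ} {u : ℂ} (hu : ‖α * u‖ < 1) : zeta α (zetaInv α u) = u := by
  unfold zeta zetaInv
  split_ifs with h
  · rfl
  · have hα : (α : ℂ) ≠ 0 := by exact_mod_cast h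
    have h1 : -(α : ℂ) * (-(1 / (α : ℂ)) * Complex.log (1 - α * u)) = Complex.log (1 - α * u) := by
      field_simp
    rw [h1, Complex.exp_log (Complex.slitPlane_ne_zero (slitPlane_of_norm_lt hu))]
    field_simp
    ring

theorem zetaInv_zeta {α : ℝ} {w : ℂ} (hw : |α * w.im| < Real.pi) : zetaInv α (zeta α w) = w := by
  unfold zeta zetaInv
  split_ifs with h
  · rfl
  · have hα : (α : ℂ) ≠ 0 := by exact_mod_cast h
    have h1 : 1 - (α : ℂ) * ((1 - Complex.exp (-(α : ℂ) * w)) / α) = Complex.exp (-(α : ℂ) * w) := by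
      field_simp; ring
    have him : (-(α : ℂ) * w).im = -(α * w.im) := by simp
    rw [h1, Complex.log_exp]
    · field_simp
    · rw [him]; linarith [(abs_lt.1 hw).2]
    · rw [him]; linarith [(abs_lt.1 hw).1]

/-- For α ≠ 0 the left side is |arg (1 - α u)|, and 1 - α u lies in the slit plane. Hence the
inverse coordinate lands in the strip where it is a left inverse too. -/
theorem abs_mul_im_zetaInv_lt {α : ℝ} {u : ℂ} (hu : ‖α * u‖ < 1) :
    |α * (zetaInv α u).im| < Real.pi := by
  unfold zetaInv
  split_ifs with h
  · simp [h, Real.pi_pos]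
  · have hα : (α : ℂ) ≠ 0 := by exact_mod_cast h
    have h1 : α * (-(1 / (α : ℂ)) * Complex.log (1 - α * u)).im = -(1 - α * u).arg := by
      rw [← Complex.im_ofReal_mul, ← Complex.log_im, ← Complex.neg_im]
      congr 1
      field_simp
    rw [h1, abs_neg]
    have hs := slitPlane_of_norm_lt hu
    refine lt_of_le_of_ne (Complex.abs_arg_le_pi _) fun h2 => ?_
    rcases (abs_eq Real.pi_pos.le).1 h2 with h3 | h3
    · exact (Complex.mem_slitPlane_iff_arg.1 hs).1 h3
    · exact absurd h3 (Complex.neg_pi_lt_arg _).ne'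

theorem differentiableAt_zetaInv {α : ℝ} {u : ℂ} (hu : ‖α * u‖ < 1) :
    DifferentiableAt ℂ (zetaInv α) u := by
  by_cases h : α = 0
  · have : zetaInv α = fun u => u := by ext u; simp [zetaInv, h]
    rw [this]; fun_prop
  · have : zetaInv α = fun u => -(1 / (α : ℂ)) * Complex.log (1 - α * u) := by
      ext u; simp [zetaInv, h]
    rw [this]
    refine DifferentiableAt.const_mul (DifferentiableAt.clog (by fun_prop) ?_) _
    exact slitPlane_of_norm_lt hu

/-- `A` is a primitive of `a z / z`, and `ε`, `δ` are radii for which the coordinate change is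
biholomorphic. -/
structure ModelChart (a A : ℂ → ℂ) (α ε δ : ℝ) : Prop where
  pos : 0 < ε
  pos' : 0 < δ
  deriv : ∀ z, ‖z‖ < ε → ∃ A', HasDerivAt A A' z ∧ z * A' = a z
  small : ∀ w z, ‖w‖ < δ → ‖z‖ < ε →
    ‖(α : ℂ) * (w * Complex.exp (-(Complex.I * A z)))‖ < 1

theorem exists_modelChart {ε₀ : ℝ} (hε₀ : 0 < ε₀) {a : ℂ → ℂ} {c : ℕ → ℂ}
    (ha : ∀ z ∈ ball (0 : ℂ) ε₀, HasSum (fun n : ℕ => c (n + 1) * z ^ (n + 1)) (a z)) (α : ℝ) :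
    ∃ ε δ, ε ≤ ε₀ ∧ ModelChart a (primitive c) α ε δ := by
  obtain ⟨A', hA', -⟩ := exists_hasDerivAt_primitive ha (z := 0) (by simpa using hε₀)
  have hc : ContinuousAt (fun z => ‖Complex.exp (-(Complex.I * primitive c z))‖) 0 := by
    have := hA'.continuousAt
    fun_prop
  have h1 : ∀ᶠ z in 𝓝 (0 : ℂ), ‖Complex.exp (-(Complex.I * primitive c z))‖ < 2 := by
    refine hc.eventually (gt_mem_nhds ?_)
    simp [primitive_zero]
  obtain ⟨ε₁, hε₁, h2⟩ := Metric.eventually_nhds_iff_ball.1 h1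
  have hα : 0 ≤ |α| := abs_nonneg α
  -- Since |e^{-iA}| < 2 on the disc, |w| < 1 / (2 (|α| + 1)) gives |α w e^{-iA}| < 1.
  refine ⟨min ε₀ ε₁, 1 / (2 * (|α| + 1)), min_le_left _ _, by positivity, by positivity,
    fun z hz => exists_hasDerivAt_primitive ha (hz.trans_le (min_le_left _ _)),
    fun w z hw hz => ?_⟩
  have h3 := h2 z (by rw [mem_ball_zero_iff]; exact hz.trans_le (min_le_right _ _))
  rw [norm_mul, norm_mul, Complex.norm_real, Real.norm_eq_abs]
  rw [lt_div_iff₀ (by positivity)] at hw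
  have h4 : ‖w‖ * ‖Complex.exp (-(Complex.I * primitive c z))‖ ≤ ‖w‖ * 2 := by gcongr
  have h5 := mul_le_mul_of_nonneg_left h4 hα
  by_cases hw0 : ‖w‖ = 0
  · simp [hw0]
  · have : 0 < ‖w‖ := lt_of_le_of_ne (norm_nonneg _) (Ne.symm hw0)
    nlinarith

/-- The flow-invariant domain. -/
def domain (A : ℂ → ℂ) (α ε δ : ℝ) : Set (ℂ × ℂ) :=
  {z | (‖z.2‖ < ε ∧ |α * z.1.im| < Real.pi) ∧ ‖(toModel A α z).1‖ < δ}

namespace ModelChart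

variable {a A : ℂ → ℂ} {α ε δ : ℝ}

theorem continuousAt (C : ModelChart a A α ε δ) {z : ℂ} (hz : ‖z‖ < ε) : ContinuousAt A z := by
  obtain ⟨A', hA', -⟩ := C.deriv z hz
  exact hA'.continuousAt

theorem differentiableAt_toModel (C : ModelChart a A α ε δ) {z : ℂ × ℂ} (hz : ‖z.2‖ < ε) :
    DifferentiableAt ℂ (toModel A α) z := by
  obtain ⟨A', hA', -⟩ := C.deriv z.2 hz
  have hA : DifferentiableAt ℂ (fun z : ℂ × ℂ => A z.2) z :=
    hA'.differentiableAt.comp z differentiableAt_snd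
  have hζ : DifferentiableAt ℂ (fun z : ℂ × ℂ => zeta α z.1) z :=
    (differentiable_zeta α).differentiableAt.comp z differentiableAt_fst
  exact (hζ.mul (hA.const_mul Complex.I).cexp).prodMk differentiableAt_snd

theorem differentiableAt_ofModel (C : ModelChart a A α ε δ) {p : ℂ × ℂ} (h1 : ‖p.1‖ < δ)
    (h2 : ‖p.2‖ < ε) : DifferentiableAt ℂ (ofModel A α) p := by
  obtain ⟨A', hA', -⟩ := C.deriv p.2 h2
  have hA : DifferentiableAt ℂ (fun z : ℂ × ℂ => A z.2) p :=
    hA'.differentiableAt.comp p differentiableAt_snd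
  have hu : DifferentiableAt ℂ (fun p : ℂ × ℂ => p.1 * Complex.exp (-(Complex.I * A p.2))) p :=
    differentiableAt_fst.mul (hA.const_mul Complex.I).neg.cexp
  exact (DifferentiableAt.comp p (differentiableAt_zetaInv (C.small _ _ h1 h2)) hu).prodMk
    differentiableAt_snd

theorem toModel_ofModel (C : ModelChart a A α ε δ) {p : ℂ × ℂ} (h1 : ‖p.1‖ < δ)
    (h2 : ‖p.2‖ < ε) : toModel A α (ofModel A α p) = p := by
  refine Prod.ext ?_ rfl
  simp only [toModel, ofModel]
  rw [zeta_zetaInv (C.small _ _ h1 h2), mul_assoc, ← Complex.exp_add, neg_add_cancel,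
    Complex.exp_zero, mul_one]

theorem ofModel_toModel {z : ℂ × ℂ} (hz : |α * z.1.im| < Real.pi) :
    ofModel A α (toModel A α z) = z := by
  refine Prod.ext ?_ rfl
  simp only [toModel, ofModel]
  rw [mul_assoc, ← Complex.exp_add, add_neg_cancel, Complex.exp_zero, mul_one, zetaInv_zeta hz]

theorem ofModel_mem_domain (C : ModelChart a A α ε δ) {p : ℂ × ℂ} (h1 : ‖p.1‖ < δ)
    (h2 : ‖p.2‖ < ε) : ofModel A α p ∈ domain A α ε δ := by
  refine ⟨⟨h2, abs_mul_im_zetaInv_lt (C.small _ _ h1 h2)⟩, ?_⟩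
  rw [C.toModel_ofModel h1 h2]
  exact h1

theorem toModel_zero (A : ℂ → ℂ) (α : ℝ) : toModel A α 0 = 0 := by
  simp [toModel, zeta_zero]

theorem ofModel_zero (A : ℂ → ℂ) (α : ℝ) : ofModel A α 0 = 0 := by
  simp [ofModel, zetaInv_zero]

theorem zero_mem_domain (C : ModelChart a A α ε δ) : (0 : ℂ × ℂ) ∈ domain A α ε δ := by
  refine ⟨⟨by simpa using C.pos, by simpa using Real.pi_pos⟩, ?_⟩
  rw [toModel_zero]
  simpa using C.pos'

theorem isOpen_domain (C : ModelChart a A α ε δ) : IsOpen (domain A α ε δ) := by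
  have h1 : IsOpen {z : ℂ × ℂ | ‖z.2‖ < ε ∧ |α * z.1.im| < Real.pi} := by
    have h2 : IsOpen {z : ℂ × ℂ | ‖z.2‖ < ε} := isOpen_lt continuous_snd.norm continuous_const
    have h3 : IsOpen {z : ℂ × ℂ | |α * z.1.im| < Real.pi} :=
      isOpen_lt (continuous_const.mul (Complex.continuous_im.comp continuous_fst)).abs
        continuous_const
    exact h2.inter h3
  have h2 : ContinuousOn (fun z => ‖(toModel A α z).1‖)
      {z : ℂ × ℂ | ‖z.2‖ < ε ∧ |α * z.1.im| < Real.pi} := fun z hz =>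
    ((C.differentiableAt_toModel hz.1).continuousAt.fst.norm).continuousWithinAt
  exact h2.isOpen_inter_preimage h1 (isOpen_Iio (a := δ))

theorem norm_mul_exp_I (z : ℂ) (t : ℝ) : ‖z * Complex.exp (Complex.I * (t : ℂ))‖ = ‖z‖ := by
  rw [norm_mul, mul_comm Complex.I, Complex.norm_exp_ofReal_mul_I, mul_one]

theorem hasDerivAt_rotate (C : ModelChart a A α ε δ) {z : ℂ} (hz : ‖z‖ < ε) (t : ℝ) :
    HasDerivAt (fun τ : ℝ => A (z * Complex.exp (Complex.I * (τ : ℂ))))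
      (Complex.I * a (z * Complex.exp (Complex.I * (t : ℂ)))) t := by
  obtain ⟨A', hA', hza⟩ := C.deriv (z * Complex.exp (Complex.I * (t : ℂ)))
    (by rwa [norm_mul_exp_I])
  have h1 : HasDerivAt (fun τ : ℝ => Complex.I * (τ : ℂ)) (Complex.I * 1) t :=
    (Complex.ofRealCLM.hasDerivAt (x := t)).const_mul Complex.I
  have h2 := (h1.cexp.const_mul z)
  have h3 := HasDerivAt.comp_of_eq (h₂ := A) t hA' h2 rfl
  rw [← hza]
  refine h3.congr_deriv ?_
  ring

/-- From z A' = a, the derivative of A(z e^{iτ}) in τ is i a(z e^{iτ}), so the integral in the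
exponent is -i times the increment of A. -/
theorem flowFactor_eq (C : ModelChart a A α ε δ) {z : ℂ} (hz : ‖z‖ < ε) (t : ℝ) :
    flowFactor a t z
      = Complex.exp (-(Complex.I * (A (z * Complex.exp (Complex.I * (t : ℂ))) - A z))) := by
  have hd : ∀ τ : ℝ, HasDerivAt
      (fun τ : ℝ => -(Complex.I * A (z * Complex.exp (Complex.I * (τ : ℂ)))))
      (a (z * Complex.exp (Complex.I * (τ : ℂ)))) τ := by
    intro τ
    refine ((C.hasDerivAt_rotate hz τ).const_mul Complex.I).neg.congr_deriv ?_
    rw [← mul_assoc, Complex.I_mul_I]; ring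
  have hcont : Continuous fun τ : ℝ => a (z * Complex.exp (Complex.I * (τ : ℂ))) := by
    have hA : DifferentiableOn ℂ A (ball 0 ε) := fun w hw => by
      obtain ⟨A', hA', -⟩ := C.deriv w (by simpa using hw)
      exact hA'.differentiableAt.differentiableWithinAt
    have hA' : DifferentiableOn ℂ (_root_.deriv A) (ball 0 ε) := hA.deriv isOpen_ball
    have heq : ∀ w, ‖w‖ < ε → a w = w * _root_.deriv A w := by
      intro w hw
      obtain ⟨A', hA', h⟩ := C.deriv w hw
      rw [← h, hA'.deriv]
    have hn : ∀ τ : ℝ, ‖z * Complex.exp (Complex.I * (τ : ℂ))‖ < ε := fun τ => by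
      rwa [norm_mul_exp_I]
    have hfun : (fun τ : ℝ => a (z * Complex.exp (Complex.I * (τ : ℂ)))) = fun τ : ℝ =>
        z * Complex.exp (Complex.I * (τ : ℂ)) *
          _root_.deriv A (z * Complex.exp (Complex.I * (τ : ℂ))) := by
      ext τ; exact heq _ (hn τ)
    rw [hfun]
    have hrot : Continuous fun τ : ℝ => z * Complex.exp (Complex.I * (τ : ℂ)) := by fun_prop
    refine hrot.mul ?_
    exact hA'.continuousOn.comp_continuous hrot fun τ => by simpa using hn τ
  rw [flowFactor, intervalIntegral.integral_eq_sub_of_hasDerivAt (fun τ _ => hd τ)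
    (hcont.intervalIntegrable _ _)]
  simp only [Complex.ofReal_zero, mul_zero, Complex.exp_zero, mul_one]
  congr 1
  ring

/-- The rotation `(w, z) ↦ (w, z e^{it})`. -/
noncomputable def _root_.InfiniteType.rotate (t : ℝ) (p : ℂ × ℂ) : ℂ × ℂ :=
  (p.1, p.2 * Complex.exp (Complex.I * (t : ℂ)))

/-- The flow factor multiplies ζ by exactly what the change of e^{iA(z)} takes away, so w is
constant along the flow. -/
theorem φ_eq (C : ModelChart a A α ε δ) {z : ℂ × ℂ} (hz : ‖z.2‖ < ε) (t : ℝ) :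
    φ a α t z = ofModel A α (rotate t (toModel A α z)) := by
  refine Prod.ext ?_ rfl
  have h1 : zeta α z.1 * Complex.exp (Complex.I * A z.2) *
      Complex.exp (-(Complex.I * A (z.2 * Complex.exp (Complex.I * (t : ℂ)))))
      = zeta α z.1 * flowFactor a t z.2 := by
    rw [C.flowFactor_eq hz, mul_assoc, ← Complex.exp_add]
    congr 2
    ring
  simp only [φ, ofModel, rotate, toModel]
  rw [h1]
  unfold zeta zetaInv
  split_ifs with h
  · rfl
  · have hα : (α : ℂ) ≠ 0 := by exact_mod_cast h
    congr 2
    field_simp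
    ring

theorem φ_mem_domain (C : ModelChart a A α ε δ) {z : ℂ × ℂ} (hz : z ∈ domain A α ε δ) (t : ℝ) :
    φ a α t z ∈ domain A α ε δ := by
  rw [C.φ_eq hz.1.1]
  refine C.ofModel_mem_domain hz.2 ?_
  rw [rotate, norm_mul_exp_I]
  exact hz.1.1

theorem toModel_φ (C : ModelChart a A α ε δ) {z : ℂ × ℂ} (hz : z ∈ domain A α ε δ) (t : ℝ) :
    toModel A α (φ a α t z) = rotate t (toModel A α z) := by
  rw [C.φ_eq hz.1.1]
  refine C.toModel_ofModel hz.2 ?_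
  rw [rotate, norm_mul_exp_I]
  exact hz.1.1

theorem φ_add (C : ModelChart a A α ε δ) {z : ℂ × ℂ} (hz : z ∈ domain A α ε δ) (s t : ℝ) :
    φ a α s (φ a α t z) = φ a α (s + t) z := by
  rw [C.φ_eq (C.φ_mem_domain hz t).1.1, C.toModel_φ hz, C.φ_eq hz.1.1]
  congr 1
  refine Prod.ext rfl ?_
  simp only [rotate]
  rw [mul_assoc, ← Complex.exp_add]
  push_cast
  ring_nf

theorem φ_zero (C : ModelChart a A α ε δ) {z : ℂ × ℂ} (hz : z ∈ domain A α ε δ) :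
    φ a α 0 z = z := by
  rw [C.φ_eq hz.1.1]
  have : rotate 0 (toModel A α z) = toModel A α z := by simp [rotate]
  rw [this, ofModel_toModel hz.1.2]

theorem differentiableOn_φ (C : ModelChart a A α ε δ) (t : ℝ) :
    DifferentiableOn ℂ (φ a α t) (domain A α ε δ) := by
  have h1 : DifferentiableOn ℂ (fun z => ofModel A α (rotate t (toModel A α z)))
      (domain A α ε δ) := by
    intro z hz
    have hr : Differentiable ℂ (rotate t) := by unfold rotate; fun_prop
    have h2 : DifferentiableAt ℂ (fun z => rotate t (toModel A α z)) z :=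
      hr.differentiableAt.comp z (C.differentiableAt_toModel hz.1.1)
    have h3 : DifferentiableAt ℂ (ofModel A α) (rotate t (toModel A α z)) := by
      refine C.differentiableAt_ofModel hz.2 ?_
      rw [rotate, norm_mul_exp_I]
      exact hz.1.1
    exact (DifferentiableAt.comp z (f := fun z => rotate t (toModel A α z)) h3
      h2).differentiableWithinAt
  exact h1.congr fun z hz => C.φ_eq hz.1.1 t

theorem hasDerivAt_φ (C : ModelChart a A α ε δ) {z : ℂ × ℂ} (hz : z ∈ domain A α ε δ) (t : ℝ) :
    HasDerivAt (fun τ : ℝ => φ a α τ z) (H a α (φ a α t z)) t := by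
  have hfl : HasDerivAt (fun τ : ℝ => flowFactor a τ z.2)
      (flowFactor a t z.2 * a (z.2 * Complex.exp (Complex.I * (t : ℂ)))) t := by
    have h1 : HasDerivAt (fun τ : ℝ =>
        Complex.exp (-(Complex.I * (A (z.2 * Complex.exp (Complex.I * (τ : ℂ))) - A z.2))))
        (Complex.exp (-(Complex.I * (A (z.2 * Complex.exp (Complex.I * (t : ℂ))) - A z.2))) *
          -(Complex.I * (Complex.I * a (z.2 * Complex.exp (Complex.I * (t : ℂ)))))) t :=
      (((C.hasDerivAt_rotate hz.1.1 t).sub_const (A z.2)).const_mul Complex.I).neg.cexp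
    have h2 : (fun τ : ℝ => flowFactor a τ z.2) = fun τ : ℝ =>
        Complex.exp (-(Complex.I * (A (z.2 * Complex.exp (Complex.I * (τ : ℂ))) - A z.2))) := by
      ext τ; exact C.flowFactor_eq hz.1.1 τ
    rw [h2]
    refine h1.congr_deriv ?_
    rw [C.flowFactor_eq hz.1.1, ← mul_assoc, Complex.I_mul_I]
    ring
  have hsnd : HasDerivAt (fun τ : ℝ => z.2 * Complex.exp (Complex.I * (τ : ℂ)))
      (Complex.I * (z.2 * Complex.exp (Complex.I * (t : ℂ)))) t := by
    have h1 : HasDerivAt (fun τ : ℝ => Complex.I * (τ : ℂ)) (Complex.I * 1) t :=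
      (Complex.ofRealCLM.hasDerivAt (x := t)).const_mul Complex.I
    refine (h1.cexp.const_mul z.2).congr_deriv ?_
    ring
  refine HasDerivAt.prodMk ?_ hsnd
  by_cases h : α = 0
  · simp only [h, if_true, φ, L]
    refine (hfl.const_mul z.1).congr_deriv ?_
    ring
  · have hα : (α : ℂ) ≠ 0 := by exact_mod_cast h
    simp only [h, if_false, φ, L]
    -- The argument of the logarithm is 1 - α w e^{-i A(z e^{it})}; rotation preserves |z|, so the
    -- smallness condition of the chart applies for every t.
    have hslit : 1 + (Complex.exp (-(α : ℂ) * z.1) - 1) * flowFactor a t z.2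
        ∈ Complex.slitPlane := by
      have h1 := C.small (toModel A α z).1 (z.2 * Complex.exp (Complex.I * (t : ℂ))) hz.2
        (by rw [norm_mul_exp_I]; exact hz.1.1)
      have h2 := slitPlane_of_norm_lt h1
      convert h2 using 1
      have h3 : (toModel A α z).1 *
          Complex.exp (-(Complex.I * A (z.2 * Complex.exp (Complex.I * (t : ℂ)))))
          = zeta α z.1 * flowFactor a t z.2 := by
        rw [C.flowFactor_eq hz.1.1, toModel, mul_assoc, ← Complex.exp_add]
        congr 2
        ring
      rw [h3]
      simp only [zeta, h, if_false]
      field_simp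
      ring
    have hne := Complex.slitPlane_ne_zero hslit
    have h4 := (((hfl.const_mul (Complex.exp (-(α : ℂ) * z.1) - 1)).const_add 1).clog_real
      hslit).const_mul (-(1 / (α : ℂ)))
    refine h4.congr_deriv ?_
    -- With D the argument of the logarithm, D' = (D - 1) a, while L of the first component is (1 /
    -- D - 1) / α; both sides equal -(D - 1) a / (α D).
    have h5 : (α : ℂ) * (-(1 / (α : ℂ)) *
        Complex.log (1 + (Complex.exp (-(α : ℂ) * z.1) - 1) * flowFactor a t z.2))
        = -Complex.log (1 + (Complex.exp (-(α : ℂ) * z.1) - 1) * flowFactor a t z.2) := by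
      field_simp
    rw [h5, Complex.exp_neg, Complex.exp_log hne]
    set D := 1 + (Complex.exp (-(α : ℂ) * z.1) - 1) * flowFactor a t z.2 with hD
    have h6 : (Complex.exp (-(α : ℂ) * z.1) - 1) * flowFactor a t z.2 = D - 1 := by rw [hD]; ring
    rw [← mul_assoc (Complex.exp (-(α : ℂ) * z.1) - 1), h6]
    field_simp
    ring

end ModelChart

/-! ### The defining equation in model coordinates. -/

/-- Both equations say (1 + α Q) C = e^{-α x} C'; the sides are positive, so passing to logarithms
loses nothing. -/
theorem log_equation_iff {α x C C' Q : ℝ} (hα : α ≠ 0) (hC : 0 < C) (hC' : 0 < C')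
    (hQ : 0 < 1 + α * Q) :
    x + 1 / α * Real.log (1 + α * Q) + -(1 / α) * Real.log |C' / C| = 0
      ↔ (C - Real.exp (-α * x) * C') / α + Q * C = 0 := by
  rw [abs_of_pos (div_pos hC' hC), Real.log_div hC'.ne' hC.ne']
  have h1 : x + 1 / α * Real.log (1 + α * Q) + -(1 / α) * (Real.log C' - Real.log C) = 0
      ↔ Real.log (1 + α * Q) + Real.log C = -α * x + Real.log C' := by
    field_simp
    constructor <;> intro h <;> linarith
  have h2 : (C - Real.exp (-α * x) * C') / α + Q * C = 0
      ↔ (1 + α * Q) * C = Real.exp (-α * x) * C' := by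
    field_simp
    constructor <;> intro h <;> linarith
  rw [h1, h2, ← Real.log_mul hQ.ne' hC.ne', ← Real.log_exp (-α * x),
    ← Real.log_mul (Real.exp_pos _).ne' hC'.ne', Real.log_exp]
  exact Real.log_injOn_pos.eq_iff (mul_pos hQ hC) (mul_pos (Real.exp_pos _) hC')

theorem R_eq (c : ℕ → ℂ) (q : ℝ → ℝ) (z : ℂ) : R c q z = q ‖z‖ - (primitive c z).re := rfl

theorem P₁_eq {c : ℕ → ℂ} {p q : ℝ → ℝ} {z : ℂ} (h : 0 < Real.cos (R c q z)) :
    P₁ c p q z = radial p ‖z‖ * Real.exp (primitive c z).im / Real.cos (R c q z) := by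
  rw [radial_norm, P₁, expRadial]
  split_ifs with hz
  · simp
  · rw [tsum_div_I_mul, abs_of_pos h, Real.exp_sub, Real.exp_add, Real.exp_log h]
    simp

theorem re_zeta_mul_exp {α R : ℝ} (w : ℂ) :
    (zeta α w * Complex.exp (((-R : ℝ) : ℂ) * Complex.I)).re =
      if α = 0 then w.re * Real.cos R + w.im * Real.sin R
      else (Real.cos R - Real.exp (-α * w.re) * Real.cos (R + α * w.im)) / α := by
  unfold zeta
  split_ifs with h
  · rw [Complex.mul_re, Complex.exp_ofReal_mul_I_re, Complex.exp_ofReal_mul_I_im, Real.cos_neg,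
      Real.sin_neg]
    ring
  · have h1 : (1 - Complex.exp (-(α : ℂ) * w)) / α * Complex.exp (((-R : ℝ) : ℂ) * Complex.I)
        = (Complex.exp (((-R : ℝ) : ℂ) * Complex.I)
          - Complex.exp (-(α : ℂ) * w + ((-R : ℝ) : ℂ) * Complex.I)) / α := by
      rw [Complex.exp_add]; ring
    rw [h1, Complex.div_ofReal_re, Complex.sub_re, Complex.exp_ofReal_mul_I_re, Real.cos_neg,
      Complex.exp_re]
    congr 3
    · simp
    · rw [← Real.cos_neg]
      congr 1
      simp

/-- With R = q - Re A one has w e^{-iq} = e^{-Im A} ζ e^{-iR}. Multiplying the model equation by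
e^{Im A} therefore gives Re (ζ e^{-iR}) + P₁ cos R = 0, which is the original equation after
division by cos R if α = 0, and after exponentiation if α ≠ 0. Positivity of the cosines removes the
absolute values. -/
theorem mem_M_iff {ε₀ : ℝ} {c : ℕ → ℂ} {α : ℝ} {p q : ℝ → ℝ} {z : ℂ × ℂ} (hz : ‖z.2‖ < ε₀)
    (h1 : 0 < Real.cos (R c q z.2)) (h2 : 0 < Real.cos (R c q z.2 + α * z.1.im))
    (h3 : 0 < 1 + α * P₁ c p q z.2) :
    z ∈ M ε₀ c α p q ↔ toModel (primitive c) α z ∈ Model (radial p) q := by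
  set A := primitive c z.2 with hA
  have hmodel : toModel (primitive c) α z ∈ Model (radial p) q ↔
      (zeta α z.1 * Complex.exp (((-R c q z.2 : ℝ) : ℂ) * Complex.I)).re
        + P₁ c p q z.2 * Real.cos (R c q z.2) = 0 := by
    have h4 : zeta α z.1 * Complex.exp (Complex.I * A)
        * Complex.exp (((-q ‖z.2‖ : ℝ) : ℂ) * Complex.I)
        = (Real.exp (-A.im) : ℂ) *
          (zeta α z.1 * Complex.exp (((-R c q z.2 : ℝ) : ℂ) * Complex.I)) := by
      rw [mul_assoc, ← Complex.exp_add, Complex.ofReal_exp, mul_left_comm, ← Complex.exp_add]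
      congr 2
      rw [R_eq, ← hA]
      conv_lhs => rw [← Complex.re_add_im A]
      push_cast
      linear_combination (A.im : ℂ) * Complex.I_mul_I
    simp only [Model, toModel, mem_ofPred_eq]
    rw [← hA, h4, Complex.re_ofReal_mul, P₁_eq h1, ← hA, div_mul_cancel₀ _ h1.ne']
    have h5 := Real.exp_pos (-A.im)
    have h6 : Real.exp (-A.im) * Real.exp A.im = 1 := by
      rw [← Real.exp_add, neg_add_cancel, Real.exp_zero]
    rw [← mul_eq_zero_iff_left h5.ne' (b := _ + radial p ‖z.2‖ * Real.exp A.im), mul_add]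
    rw [show Real.exp (-A.im) * (radial p ‖z.2‖ * Real.exp A.im) = radial p ‖z.2‖ by
      linear_combination radial p ‖z.2‖ * h6]
  rw [hmodel, re_zeta_mul_exp]
  simp only [M, P, F, mem_ofPred_eq, hz, true_and]
  split_ifs with hα
  · rw [Real.tan_eq_sin_div_cos]
    rw [← mul_eq_zero_iff_left h1.ne' (b := z.1.re + P₁ c p q z.2 + _)]
    have : Real.cos (R c q z.2) * (z.1.re + P₁ c p q z.2 +
        Real.sin (R c q z.2) / Real.cos (R c q z.2) * z.1.im)
        = z.1.re * Real.cos (R c q z.2) + z.1.im * Real.sin (R c q z.2)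
          + P₁ c p q z.2 * Real.cos (R c q z.2) := by
      field_simp; ring
    rw [this]
  · exact log_equation_iff hα h1 h2 h3

theorem eventually_mem_M_iff {ε₀ : ℝ} (hε₀ : 0 < ε₀) {c : ℕ → ℂ} {p q G' q' : ℝ → ℝ} (α : ℝ)
    (H : Profile (radial p) G' q q') (hA : ContinuousAt (primitive c) 0) :
    ∀ᶠ z in 𝓝 (0 : ℂ × ℂ),
      z ∈ M ε₀ c α p q ↔ toModel (primitive c) α z ∈ Model (radial p) q := by
  have hsnd : Tendsto (fun z : ℂ × ℂ => z.2) (𝓝 0) (𝓝 0) := continuous_snd.tendsto 0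
  have hA' : Tendsto (fun z : ℂ × ℂ => primitive c z.2) (𝓝 0) (𝓝 0) := by
    have := hA.tendsto
    rw [primitive_zero] at this
    exact this.comp hsnd
  have hre : Tendsto (fun z : ℂ × ℂ => (primitive c z.2).re) (𝓝 0) (𝓝 0) :=
    (Complex.continuous_re.tendsto 0).comp hA'
  have him : Tendsto (fun z : ℂ × ℂ => (primitive c z.2).im) (𝓝 0) (𝓝 0) :=
    (Complex.continuous_im.tendsto 0).comp hA'
  have hR : Tendsto (fun z : ℂ × ℂ => R c q z.2) (𝓝 0) (𝓝 0) := by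
    have h1 : Tendsto (fun z : ℂ × ℂ => q ‖z.2‖) (𝓝 0) (𝓝 0) :=
      (H.tendsto_q tendsto_id).comp hsnd
    simpa [R_eq] using h1.sub hre
  have hy : Tendsto (fun z : ℂ × ℂ => R c q z.2 + α * z.1.im) (𝓝 0) (𝓝 0) := by
    have : Tendsto (fun z : ℂ × ℂ => z.1.im) (𝓝 0) (𝓝 0) :=
      (Complex.continuous_im.comp continuous_fst).tendsto 0
    simpa using hR.add (this.const_mul α)
  have hcos : Tendsto Real.cos (𝓝 0) (𝓝 1) := by
    simpa using Real.continuous_cos.tendsto 0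
  have hcosR := hcos.comp hR
  have hG : Tendsto (fun z : ℂ × ℂ => radial p ‖z.2‖) (𝓝 0) (𝓝 0) := by
    have h1 := H.G_deriv.self_of_nhds.continuousAt.tendsto
    rw [H.G_zero] at h1
    have h2 : Tendsto (fun z : ℂ × ℂ => ‖z.2‖) (𝓝 0) (𝓝 0) := by simpa using hsnd.norm
    exact h1.comp h2
  have hP : Tendsto (fun z : ℂ × ℂ =>
      1 + α * (radial p ‖z.2‖ * Real.exp (primitive c z.2).im / Real.cos (R c q z.2)))
      (𝓝 0) (𝓝 1) := by
    have h1 : Tendsto (fun z : ℂ × ℂ => Real.exp (primitive c z.2).im) (𝓝 0) (𝓝 1) := by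
      have h2 := Real.continuous_exp.tendsto 0
      rw [Real.exp_zero] at h2
      exact h2.comp him
    simpa using (((hG.mul h1).div hcosR one_ne_zero).const_mul α).const_add 1
  have hball : ∀ᶠ z in 𝓝 (0 : ℂ × ℂ), ‖z.2‖ < ε₀ := by
    have h2 : Tendsto (fun z : ℂ × ℂ => ‖z.2‖) (𝓝 0) (𝓝 0) := by simpa using hsnd.norm
    exact h2.eventually (gt_mem_nhds hε₀)
  filter_upwards [hball, hcosR.eventually (lt_mem_nhds one_pos),
    (hcos.comp hy).eventually (lt_mem_nhds one_pos), hP.eventually (lt_mem_nhds one_pos)]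
    with z h1 h2 h3 h4
  refine mem_M_iff h1 h2 h3 ?_
  rwa [P₁_eq h2]

/-! ### Transfer of automorphisms between the hypersurface and the model. -/

namespace ModelChart

variable {a A : ℂ → ℂ} {α ε δ : ℝ}

theorem eventually_mem_domain (C : ModelChart a A α ε δ) :
    ∀ᶠ z in 𝓝 (0 : ℂ × ℂ), z ∈ domain A α ε δ :=
  C.isOpen_domain.mem_nhds C.zero_mem_domain

theorem eventually_small (C : ModelChart a A α ε δ) :
    ∀ᶠ p in 𝓝 (0 : ℂ × ℂ), ‖p.1‖ < δ ∧ ‖p.2‖ < ε := by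
  have h1 : Tendsto (fun p : ℂ × ℂ => ‖p.1‖) (𝓝 0) (𝓝 0) := by
    simpa using (continuous_fst.norm).tendsto (0 : ℂ × ℂ)
  have h2 : Tendsto (fun p : ℂ × ℂ => ‖p.2‖) (𝓝 0) (𝓝 0) := by
    simpa using (continuous_snd.norm).tendsto (0 : ℂ × ℂ)
  exact (h1.eventually (gt_mem_nhds C.pos')).and (h2.eventually (gt_mem_nhds C.pos))

theorem tendsto_toModel (C : ModelChart a A α ε δ) : Tendsto (toModel A α) (𝓝 0) (𝓝 0) := by
  have h := (C.differentiableAt_toModel (z := 0) (by simpa using C.pos)).continuousAt.tendsto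
  rwa [toModel_zero] at h

theorem tendsto_ofModel (C : ModelChart a A α ε δ) : Tendsto (ofModel A α) (𝓝 0) (𝓝 0) := by
  have h := (C.differentiableAt_ofModel (p := 0) (by simpa using C.pos')
    (by simpa using C.pos)).continuousAt.tendsto
  rwa [ofModel_zero] at h

/-- A map of the ambient space read in the model coordinates. -/
noncomputable def _root_.InfiniteType.conj (A : ℂ → ℂ) (α : ℝ) (f : ℂ × ℂ → ℂ × ℂ) (p : ℂ × ℂ) :
    ℂ × ℂ :=
  toModel A α (f (ofModel A α p))

theorem conj_zero {f : ℂ × ℂ → ℂ × ℂ} (hf₀ : f 0 = 0) : conj A α f 0 = 0 := by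
  rw [conj, ofModel_zero, hf₀, toModel_zero]

theorem eventually_differentiableAt_conj (C : ModelChart a A α ε δ) {f : ℂ × ℂ → ℂ × ℂ}
    (hf : ∀ᶠ z in 𝓝 (0 : ℂ × ℂ), DifferentiableAt ℂ f z) (hf₀ : f 0 = 0) :
    ∀ᶠ p in 𝓝 (0 : ℂ × ℂ), DifferentiableAt ℂ (conj A α f) p := by
  have hlim : Tendsto f (𝓝 0) (𝓝 0) := by
    have := hf.self_of_nhds.continuousAt.tendsto
    rwa [hf₀] at this
  filter_upwards [C.eventually_small, C.tendsto_ofModel.eventually hf,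
    (hlim.comp C.tendsto_ofModel).eventually C.eventually_small] with p h1 h2 h3
  have h4 : DifferentiableAt ℂ (fun p => f (ofModel A α p)) p :=
    DifferentiableAt.comp p h2 (C.differentiableAt_ofModel h1.1 h1.2)
  have h5 : DifferentiableAt ℂ (toModel A α) (f (ofModel A α p)) := C.differentiableAt_toModel h3.2
  exact DifferentiableAt.comp p (f := fun p => f (ofModel A α p)) h5 h4

theorem eventually_conj_conj (C : ModelChart a A α ε δ) {f g : ℂ × ℂ → ℂ × ℂ}
    (hlim : Tendsto f (𝓝 0) (𝓝 0)) (hgf : ∀ᶠ z in 𝓝 (0 : ℂ × ℂ), g (f z) = z) :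
    ∀ᶠ p in 𝓝 (0 : ℂ × ℂ), conj A α g (conj A α f p) = p := by
  filter_upwards [C.eventually_small, C.tendsto_ofModel.eventually hgf,
    (hlim.comp C.tendsto_ofModel).eventually C.eventually_mem_domain] with p h1 h2 h3
  rw [conj, conj, ofModel_toModel (z := f _) h3.1.2, h2, C.toModel_ofModel h1.1 h1.2]

theorem eventually_conj_mem (C : ModelChart a A α ε δ) {f : ℂ × ℂ → ℂ × ℂ} {S N : Set (ℂ × ℂ)}
    (hS : ∀ᶠ z in 𝓝 (0 : ℂ × ℂ), z ∈ S ↔ toModel A α z ∈ N)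
    (hlim : Tendsto f (𝓝 0) (𝓝 0)) (hf : ∀ᶠ z in 𝓝 (0 : ℂ × ℂ), z ∈ S → f z ∈ S) :
    ∀ᶠ p in 𝓝 (0 : ℂ × ℂ), p ∈ N → conj A α f p ∈ N := by
  filter_upwards [C.eventually_small, C.tendsto_ofModel.eventually hS,
    C.tendsto_ofModel.eventually hf,
    (hlim.comp C.tendsto_ofModel).eventually hS] with p h1 h2 h3 h4 hp
  rw [C.toModel_ofModel h1.1 h1.2] at h2
  exact h4.1 (h3 (h2.2 hp))

theorem eventually_eq_φ (C : ModelChart a A α ε δ) {f : ℂ × ℂ → ℂ × ℂ}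
    (hlim : Tendsto f (𝓝 0) (𝓝 0)) {t : ℝ}
    (hf : ∀ᶠ p in 𝓝 (0 : ℂ × ℂ), conj A α f p = rotate t p) :
    f =ᶠ[𝓝 0] φ a α t := by
  filter_upwards [C.eventually_mem_domain, hlim.eventually C.eventually_mem_domain,
    C.tendsto_toModel.eventually hf] with z h1 h2 h3
  rw [conj, ofModel_toModel h1.1.2] at h3
  rw [C.φ_eq h1.1.1, ← h3, ofModel_toModel h2.1.2]

theorem φ_apply_zero (C : ModelChart a A α ε δ) (t : ℝ) : φ a α t 0 = 0 := by
  rw [C.φ_eq (by simpa using C.pos), toModel_zero]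
  simp [rotate, ofModel, zetaInv_zero]

/-- The flow at time `t` on the invariant domain. -/
noncomputable def flowHomeomorph (C : ModelChart a A α ε δ) (t : ℝ) :
    OpenPartialHomeomorph (ℂ × ℂ) (ℂ × ℂ) where
  toFun := φ a α t
  invFun := φ a α (-t)
  source := domain A α ε δ
  target := domain A α ε δ
  map_source' _ hz := C.φ_mem_domain hz t
  map_target' _ hz := C.φ_mem_domain hz (-t)
  left_inv' _ hz := by rw [C.φ_add hz, neg_add_cancel, C.φ_zero hz]
  right_inv' _ hz := by rw [C.φ_add hz, add_neg_cancel, C.φ_zero hz]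
  open_source := C.isOpen_domain
  open_target := C.isOpen_domain
  continuousOn_toFun := (C.differentiableOn_φ t).continuousOn
  continuousOn_invFun := (C.differentiableOn_φ (-t)).continuousOn

theorem φ_mem_Aut (C : ModelChart a A α ε δ) {S : Set (ℂ × ℂ)} {G q : ℝ → ℝ}
    (hS : ∀ᶠ z in 𝓝 (0 : ℂ × ℂ), z ∈ S ↔ toModel A α z ∈ Model G q) (t : ℝ) :
    (φ a α t : Germ (𝓝 (0 : ℂ × ℂ)) (ℂ × ℂ)) ∈ Aut S 0 := by
  refine ⟨C.flowHomeomorph t, C.zero_mem_domain, C.differentiableOn_φ t, C.differentiableOn_φ (-t),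
    C.φ_apply_zero t, ?_, rfl⟩
  have hlim : Tendsto (φ a α t) (𝓝 0) (𝓝 0) := by
    have := ((C.differentiableOn_φ t).differentiableAt
      C.eventually_mem_domain).continuousAt.tendsto
    rwa [C.φ_apply_zero] at this
  filter_upwards [hS, hlim.eventually hS, C.eventually_mem_domain] with z h1 h2 h3 hz
  refine h2.2 ?_
  rw [C.toModel_φ h3]
  exact (model_snd_congr (norm_mul_exp_I _ _)).2 (h1.1 hz)

theorem exists_eq_φ_of_mem_Aut (C : ModelChart a A α ε δ) {S : Set (ℂ × ℂ)} {G G' q q' : ℝ → ℝ}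
    (H : Profile G G' q q')
    (hS : ∀ᶠ z in 𝓝 (0 : ℂ × ℂ), z ∈ S ↔ toModel A α z ∈ Model G q)
    {f : Germ (𝓝 (0 : ℂ × ℂ)) (ℂ × ℂ)} (hf : f ∈ Aut S 0) :
    ∃ t : ℝ, (φ a α t : Germ (𝓝 (0 : ℂ × ℂ)) (ℂ × ℂ)) = f := by
  obtain ⟨e, h0, hd, hd', he0, hM, rfl⟩ := hf
  have hs0 : e.symm 0 = 0 := by simpa only [he0] using e.left_inv h0
  have hd0 : ∀ᶠ z in 𝓝 (0 : ℂ × ℂ), DifferentiableAt ℂ e z := by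
    filter_upwards [e.open_source.mem_nhds h0] with z hz
    exact hd.differentiableAt (e.open_source.mem_nhds hz)
  have hd0' : ∀ᶠ z in 𝓝 (0 : ℂ × ℂ), DifferentiableAt ℂ e.symm z := by
    have : (0 : ℂ × ℂ) ∈ e.target := by
      have := e.map_source h0
      rwa [he0] at this
    filter_upwards [e.open_target.mem_nhds this] with z hz
    exact hd'.differentiableAt (e.open_target.mem_nhds hz)
  have hlim : Tendsto e (𝓝 0) (𝓝 0) := by
    have := hd0.self_of_nhds.continuousAt.tendsto
    rwa [he0] at this
  have hD := C.eventually_differentiableAt_conj hd0 he0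
  have hD' := (C.eventually_differentiableAt_conj hd0' hs0).self_of_nhds
  have hL := hD.self_of_nhds.hasFDerivAt
  have hinv := C.eventually_conj_conj (g := e.symm) hlim (e.eventually_left_inverse h0)
  -- The inverse germ, read in the same coordinates, is differentiable at 0, so the chain rule makes
  -- the differential injective.
  have hcomp : (fderiv ℂ (conj A α e.symm) 0).comp (fderiv ℂ (conj A α e) 0)
      = ContinuousLinearMap.id ℂ (ℂ × ℂ) := by
    have h1 : HasFDerivAt (conj A α e.symm) (fderiv ℂ (conj A α e.symm) 0) (conj A α e 0) := by
      rw [conj_zero he0]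
      exact hD'.hasFDerivAt
    refine (h1.comp 0 hL).unique ?_
    exact (hasFDerivAt_id (𝕜 := ℂ) (0 : ℂ × ℂ)).congr_of_eventuallyEq hinv
  have hinj : Function.Injective (fderiv ℂ (conj A α e) 0) := by
    refine Function.LeftInverse.injective (g := fderiv ℂ (conj A α e.symm) 0) fun v => ?_
    exact DFunLike.congr_fun hcomp v
  obtain ⟨b, hb, hrot⟩ := eq_rotation H (f₁ := fun p => (conj A α e p).1)
    (f₂ := fun p => (conj A α e p).2) (hD.mono fun _ h => h.fst) (hD.mono fun _ h => h.snd)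
    (by simp only [conj_zero he0, Prod.fst_zero]) (by simp only [conj_zero he0, Prod.snd_zero])
    hL hinj (C.eventually_conj_mem hS hlim hM)
  -- As |b| = 1, b = e^{it} with t = arg b.
  refine ⟨b.arg, (Germ.coe_eq.2 (C.eventually_eq_φ hlim (hrot.mono fun p hp => ?_))).symm⟩
  refine Prod.ext hp.1 ?_
  have hbe : Complex.exp (Complex.I * (b.arg : ℂ)) = b := by
    have := Complex.norm_mul_exp_arg_mul_I b
    rwa [hb, Complex.ofReal_one, one_mul, mul_comm] at this
  rw [hp.2, rotate, hbe, mul_comm]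

end ModelChart

end InfiniteType

theorem theoremA
    (ε₀ : ℝ) (hε₀ : 0 < ε₀)
    (a : ℂ → ℂ) (c : ℕ → ℂ)
    (ha : ∀ z ∈ Metric.ball (0 : ℂ) ε₀, HasSum (fun n : ℕ => c (n + 1) * z ^ (n + 1)) (a z))
    (ha₀ : ∃ z ∈ Metric.ball (0 : ℂ) ε₀, a z ≠ 0)
    (α : ℝ)
    (p q : ℝ → ℝ)
    (hp : ContDiffOn ℝ ∞ p (Set.Ioo 0 ε₀))
    (hq : ContDiffOn ℝ ∞ q (Set.Ico 0 ε₀))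
    (hq₀ : q 0 = 0)
    (hg : ContDiffOn ℝ ∞ (InfiniteType.expRadial p) (Metric.ball (0 : ℂ) ε₀))
    (hg₀ : InfiniteType.VanishesToInfiniteOrder (InfiniteType.expRadial p)) :
    InfiniteType.Aut (InfiniteType.M ε₀ c α p q) (0 : ℂ × ℂ) =
        Set.range (fun t : ℝ =>
          (InfiniteType.φ a α t : Filter.Germ (𝓝 (0 : ℂ × ℂ)) (ℂ × ℂ))) ∧
      ∃ U : Set (ℂ × ℂ), IsOpen U ∧ (0 : ℂ × ℂ) ∈ U ∧
        (∀ t : ℝ, DifferentiableOn ℂ (InfiniteType.φ a α t) U) ∧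
        (∀ z ∈ U, InfiniteType.φ a α 0 z = z) ∧
        (∀ z ∈ U, ∀ s t : ℝ,
          InfiniteType.φ a α s (InfiniteType.φ a α t z) = InfiniteType.φ a α (s + t) z) ∧
        (∀ z ∈ U, ∀ t : ℝ,
          HasDerivAt (fun τ : ℝ => InfiniteType.φ a α τ z)
            (InfiniteType.H a α (InfiniteType.φ a α t z)) t) := by
  obtain ⟨ε, δ, -, C⟩ := InfiniteType.exists_modelChart hε₀ ha α
  have hprof := InfiniteType.profile_of_smooth hε₀ hq hq₀ hg hg₀
  have hS := InfiniteType.eventually_mem_M_iff hε₀ (c := c) α hprof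
    (C.continuousAt (by simpa using C.pos))
  refine ⟨Set.Subset.antisymm (fun f hf => C.exists_eq_φ_of_mem_Aut hprof hS hf) ?_, ?_⟩
  · rintro _ ⟨t, rfl⟩
    exact C.φ_mem_Aut hS t
  · exact ⟨InfiniteType.domain (InfiniteType.primitive c) α ε δ, C.isOpen_domain,
      C.zero_mem_domain, C.differentiableOn_φ, fun z hz => C.φ_zero hz,
      fun z hz => C.φ_add hz, fun z hz => C.hasDerivAt_φ hz⟩
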